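/- Let $0<q<1$, $-1<s<0$. For $k\ge 0$ let $\mathrm{Sign}_k^+$ be the set of integer sequences $\mu_1\ge\dots\ge\mu_k\ge 0$, write $\mu=0^{n_0}1^{n_1}2^{n_2}\cdots$ (so $n_x=n_x(\mu)$ is the number of parts of $\mu$ equal to $x$), let $(z;q)_n=\prod_{i=0}^{n-1}(1-zq^i)$, and put $c(\mu)=\prod_{x\ge0}\frac{(s^2;q)_{n_x}}{(q;q)_{n_x}}$. Define the vertex weights, for integers $g\ge0$, $$w_u(g,0;g,0)=\tfrac{1-sq^gu}{1-su},\quad w_u(g+1,0;g,1)=\tfrac{(1-s^2q^g)u}{1-su},\quad w_u(g,1;g,1)=\tfrac{u-sq^g}{1-su},\quad w_u(g,1;g+1,0)=\tfrac{1-q^{g+1}}{1-su},$$ and $w_u=0$ otherwise, where in $w_u(i_1,j_1;i_2,j_2)$ the numbers of arrows entering a vertex from below and from the left are $i_1,j_1$, and the numbers of arrows leaving it upwards and to the right are $i_2,j_2$. The weight of a collection of up-right paths in $\mathbb{Z}_{\ge0}\times\{1,\dots,n\}$, where the vertices in row $y$ carry the spectral parameter $u_y$, is the product of the weights of all vertices.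 For $\mu,\kappa\in\mathrm{Sign}_k^+$, $\mathsf G_{\mu/\kappa}(v_1,\dots,v_N)$ is the sum of the weights of all collections of $k$ up-right paths in $N$ rows with spectral parameters $v_1,\dots,v_N$ which enter from below at the horizontal positions $\kappa_1,\dots,\kappa_k$ (no path enters from the left) and leave at the top at the positions $\mu_1,\dots,\mu_k$; $\mathsf G_\mu:=\mathsf G_{\mu/(0,\dots,0)}$. For $\kappa\in\mathrm{Sign}_k^+$, $\mathsf F_\kappa(u_1,\dots,u_k)$ is the sum of the weights of all collections of $k$ up-right paths in $k$ rows with spectral parameters $u_1,\dots,u_k$ such that one path enters each row from the left, none enters from below, and the paths leave at the top at the positions $\kappa_1,\dots,\kappa_k$; $\mathsf F^c_\kappa:=c(\kappa)\mathsf F_\kappa$. Let $k,N\ge1$ and let $\gamma_1,\dots,\gamma_k$ be positively oriented closed (piecewise $C^1$) contours in $\mathbb{C}$ such that each $\gamma_\alpha$ encircles $s$ and leaves $s^{-1}$ outside; for all $\beta>\alpha$ the interior of $\gamma_\alpha$ contains the contour $q\gamma_\beta$; and $\gamma_k$ does not intersect $q\gamma_k$. Let $v_1,\dots,v_N\in\mathbb{C}$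 be such that all points $v_j^{-1}$ are outside all the contours $\gamma_1,\dots,\gamma_k$ (for $v_j=0$, $v_j^{-1}=\infty$ counts as outside). Then for all $\mu,\kappa\in\mathrm{Sign}_k^+$ $$\mathsf G_{\mu/\kappa}(v_1,\dots,v_N)=\oint_{\gamma_1}\frac{du_1}{2\pi i}\cdots\oint_{\gamma_k}\frac{du_k}{2\pi i}\prod_{1\le\alpha<\beta\le k}\frac{u_\alpha-u_\beta}{u_\alpha-qu_\beta}\;\mathsf F^c_\kappa(u_1,\dots,u_k)\prod_{i=1}^k\frac1{u_i-s}\Big(\frac{1-su_i}{u_i-s}\Big)^{\mu_i}\prod_{i=1}^k\prod_{j=1}^N\frac{1-qu_iv_j}{1-u_iv_j},$$ and in particular, for all $\mu\in\mathrm{Sign}_k^+$, $$\mathsf G_{\mu}(v_1,\dots,v_N)=(s^2;q)_k\oint_{\gamma_1}\frac{du_1}{2\pi i}\cdots\oint_{\gamma_k}\frac{du_k}{2\pi i}\prod_{1\le\alpha<\beta\le k}\frac{u_\alpha-u_\beta}{u_\alpha-qu_\beta}\prod_{i=1}^k\frac1{(u_i-s)(1-su_i)}\Big(\frac{1-su_i}{u_i-s}\Big)^{\mu_i}\prod_{i=1}^k\prod_{j=1}^N\frac{1-qu_iv_j}{1-u_iv_j}.$$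 -/

import Mathlib

open scoped BigOperators

noncomputable section

namespace HigherSpin

/-- Nonnegative signatures `μ₁ ≥ μ₂ ≥ ... ≥ μ_k ≥ 0` of length `k`. -/
abbrev Signature (k : ℕ) : Type := {μ : Fin k → ℕ // Antitone μ}

/-- The signature `(0, ..., 0)` of length `k`. -/
def zeroSignature (k : ℕ) : Signature k := ⟨fun _ => 0, fun _ _ _ => le_rfl⟩

/-- The number of parts of `μ` equal to `x` (so that `μ = 0^{n_0} 1^{n_1} 2^{n_2} ...`); in the
vertex model, the number of paths on the vertical edge at the horizontal coordinate `x`. -/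
def mult {k : ℕ} (μ : Signature k) (x : ℕ) : ℕ :=
  (Finset.univ.filter (fun i => μ.1 i = x)).card

/-- The `q`-Pochhammer symbol `(z; q)_n` for `n ≥ 0`. -/
def qPoch (q z : ℂ) (n : ℕ) : ℂ := ∏ i ∈ Finset.range n, (1 - z * q ^ i)

/-- The vertex weight `w_u(i₁, j₁; i₂, j₂)`: `i₁` arrows enter from below and `j₁` from the left,
`i₂` arrows leave upwards and `j₂` to the right. -/
def vertexWeight (q s u : ℂ) (i₁ : ℕ) (j₁ : ℤ) (i₂ : ℕ) (j₂ : ℤ) : ℂ :=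
  if j₁ = 0 ∧ j₂ = 0 ∧ i₂ = i₁ then (1 - s * q ^ i₁ * u) / (1 - s * u)
  else if j₁ = 0 ∧ j₂ = 1 ∧ i₁ = i₂ + 1 then (1 - s ^ 2 * q ^ i₂) * u / (1 - s * u)
  else if j₁ = 1 ∧ j₂ = 1 ∧ i₂ = i₁ then (u - s * q ^ i₁) / (1 - s * u)
  else if j₁ = 1 ∧ j₂ = 0 ∧ i₂ = i₁ + 1 then (1 - q ^ (i₁ + 1)) / (1 - s * u)
  else 0

/-- The number of paths on the horizontal edge `x - 1 → x` of a row whose vertical edges are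
occupied according to `lam` (below the row) and `mu` (above it), if `h` paths enter the row from
the left. It is determined by arrow preservation; a value other than `0` or `1` means that there is
no such row, and then some vertex weight of the row vanishes. -/
def horizontal {M N : ℕ} (h : ℕ) (lam : Signature M) (mu : Signature N) (x : ℕ) : ℤ :=
  (h : ℤ) + ∑ y ∈ Finset.range x, ((mult lam y : ℤ) - (mult mu y : ℤ))

/-- The weight of a single row of vertices `(x, 1)`, `x = 0, 1, 2, ...`, with spectral parameter
`u`, with the paths `lam` entering from below, `h` paths entering from the left, and the paths `mu`
leaving upwards: the product of all vertex weights of the row (all but finitely many vertices are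
empty and have weight `1`). -/
def rowWeight (q s u : ℂ) (h : ℕ) {M N : ℕ} (lam : Signature M) (mu : Signature N) : ℂ :=
  ∏ᶠ x : ℕ, vertexWeight q s u (mult lam x) (horizontal h lam mu x)
    (mult mu x) (horizontal h lam mu (x + 1))

/-- The skew function `G_{mu/lam}(v₁, ..., v_n)`: the total weight of the collections of `k`
up-right paths in a strip of `n` rows (the `j`-th row from the bottom has spectral parameter `v_j`)
which start as `lam` at the bottom and end as `mu` at the top. The sum over such collections is
organized by the signature `kap` that describes the vertical edges entering the top row; only
finitely many `kap` contribute. -/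
def skewG (q s : ℂ) {k : ℕ} : (n : ℕ) → (mu lam : Signature k) → (Fin n → ℂ) → ℂ
  | 0, mu, lam, _ => if mu = lam then 1 else 0
  | n + 1, mu, lam, v =>
      ∑ᶠ kap : Signature k,
        skewG q s n kap lam (Fin.init v) * rowWeight q s (v (Fin.last n)) 0 kap mu

/-- The function `G_mu = G_{mu/(0,...,0)}`. -/
def funG (q s : ℂ) {k : ℕ} (n : ℕ) (mu : Signature k) (v : Fin n → ℂ) : ℂ :=
  skewG q s n mu (zeroSignature k) v

/-- The function `F_mu(u₁, ..., u_n) = F_{mu/∅}(u₁, ..., u_n)`: the total weight of the collections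
of `n` up-right paths in a strip of `n` rows (the `j`-th row from the bottom has spectral parameter
`u_j`), one path entering each row from the left, none entering from below, which end as `mu` at
the top. As for `skewG`, `kap` describes the vertical edges entering the top row. -/
def funF (q s : ℂ) : (n : ℕ) → (mu : Signature n) → (Fin n → ℂ) → ℂ
  | 0, _, _ => 1
  | n + 1, mu, u =>
      ∑ᶠ kap : Signature n,
        funF q s n kap (Fin.init u) * rowWeight q s (u (Fin.last n)) 1 kap mu

/-- `c(mu) = ∏_x (s²; q)_{n_x} / (q; q)_{n_x}` for `mu = 0^{n_0} 1^{n_1} 2^{n_2} ...`. -/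
def cFactor (q s : ℂ) {k : ℕ} (mu : Signature k) : ℂ :=
  ∏ᶠ x : ℕ, qPoch q (s ^ 2) (mult mu x) / qPoch q q (mult mu x)

/-- The conjugated function `F^c_mu = c(mu) F_mu` (note that `c(∅) = 1`). -/
def funFc (q s : ℂ) {k : ℕ} (mu : Signature k) (u : Fin k → ℂ) : ℂ :=
  cFactor q s mu * funF q s k mu u

/-- The contour integral `∮_γ f(z) dz / (2πi)` along a path `γ` parametrized by `[0, 1]`. -/
def contourIntegral (γ : ℝ → ℂ) (f : ℂ → ℂ) : ℂ :=
  (2 * (Real.pi : ℂ) * Complex.I)⁻¹ * ∫ t in (0 : ℝ)..1, f (γ t) * deriv γ t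

/-- The set of points of the contour `γ`. -/
def trace (γ : ℝ → ℂ) : Set ℂ := γ '' Set.Icc (0 : ℝ) 1

/-- `z` is inside (encircled by) `γ`: it lies in a bounded component of the complement of `γ`. -/
def Inside (γ : ℝ → ℂ) (z : ℂ) : Prop :=
  z ∉ trace γ ∧ Bornology.IsBounded (connectedComponentIn (trace γ)ᶜ z)

/-- `z` is outside `γ`: it lies in the unbounded component of the complement of `γ`. -/
def Outside (γ : ℝ → ℂ) (z : ℂ) : Prop :=
  z ∉ trace γ ∧ ¬ Bornology.IsBounded (connectedComponentIn (trace γ)ᶜ z)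

/-- Positively oriented closed contours: closed piecewise `C¹` curves, parametrized by `[0, 1]`,
that wind exactly once, counterclockwise, around every point inside. Every piecewise `C¹` Jordan
curve is such a contour when it is traversed counterclockwise. -/
structure IsPositiveContour (γ : ℝ → ℂ) : Prop where
  closed : γ 0 = γ 1
  piecewise_smooth : ∃ (n : ℕ) (t : Fin (n + 1) → ℝ), StrictMono t ∧ t 0 = 0 ∧ t (Fin.last n) = 1 ∧
    ∀ i : Fin n, ContDiffOn ℝ 1 γ (Set.Icc (t i.castSucc) (t i.succ))
  winding : ∀ z : ℂ, Inside γ z → contourIntegral γ (fun w => (w - z)⁻¹) = 1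

/-- The `q`-nested contours `γ₁⁺[s], ..., γ_k⁺[s]`. -/
structure IsNestedFamily (q s : ℂ) {k : ℕ} (γ : Fin k → ℝ → ℂ) : Prop where
  contour : ∀ a, IsPositiveContour (γ a)
  encircles : ∀ a, Inside (γ a) s
  leaves_outside : ∀ a, Outside (γ a) s⁻¹
  nested : ∀ a b, a < b → ∀ u ∈ trace (γ b), Inside (γ a) (q * u)
  last_small : ∀ a : Fin k, (a : ℕ) + 1 = k →
    Disjoint (trace (γ a)) ((fun u => q * u) '' trace (γ a))

/-- The iterated contour integral `∮_{γ₁} du₁/(2πi) ... ∮_{γ_k} du_k/(2πi) f(u₁, ..., u_k)`. -/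
def iteratedIntegral : (k : ℕ) → (Fin k → ℝ → ℂ) → ((Fin k → ℂ) → ℂ) → ℂ
  | 0, _, f => f Fin.elim0
  | k + 1, γ, f =>
      contourIntegral (γ 0)
        (fun u => iteratedIntegral k (fun i => γ i.succ) (fun w => f (Fin.cons u w)))

end HigherSpin

end

noncomputable section

section

namespace HigherSpin

/-! ### Column operators and the RLL relation -/

/-! The proof is an algebraic Bethe ansatz on finitely many columns, combined with residue
arguments. The row operators built from vertex weights with cleared denominators satisfy the RLL
relation with the six vertex R-matrix (`rOp_mul_tensor_monodromy`). Write A, B, D for the entries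
(0,0), (1,0), (1,1) of the monodromy matrix. On L columns, with L larger than all parts of μ and κ,
the vector B(u_1)...B(u_k)|0⟩ (`bvec`) has the coordinates ∏(1 - s u_i)^L F_κ(u)
(`bvec_eq_sum_funF`).

The theorem follows by induction on N. A row of G with parameter v, turned upside down and
conjugated by c, is the operator D at u = 1/v (`homWeight_dual`, `monodromy_one_one_bvec_mult`);
homogeneous parameters (1, v) include v = 0. By the exchange relations D multiplies the Bethe vector
by (1 - s v)^L ∏(1 - q u_i v)/(1 - u_i v), up to unwanted terms in which some u_j is traded for 1/v.
An unwanted term carries (u_j - s)^L, which removes the pole at s. Once multiplied by the pair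
weight ∏(u_α - u_β)/(u_α - q u_β) it has, in the variable u_j, no pole inside γ_j, so it integrates
to zero (`integral_exchangeTerm`). Hence each row of G contributes exactly its spectral factor to
the integrand, and no limit in L is needed.

The case N = 0 is spatial orthogonality (`integral_bvec`), proved by induction on the number of
columns. `bvec_first_column` expands the Bethe vector over the set S of paths that stop in the first
column. If S contains an index that should go further, some variable has all its poles inside its
contour and the integrand decays quadratically. If S misses an index that should stop, some variable
has all its poles outside. Both integrals vanish. For the one remaining S the integrand factors into
the same problem with a column fewer and an explicit integral equal to 1/(s²;q)_m
(`integral_pairWeight`).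

All integrands are rational in each variable separately. Winding numbers, primitives and partial
fractions therefore replace a general residue theorem (`contourIntegral_of_inside`,
`contourIntegral_of_outside`, `contourIntegral_cauchy`), and Fubini's theorem allows any variable to
be integrated first (`iteratedIntegral_eq_zero`). The second formula is the case κ = (0,...,0),
where F and c are explicit. -/

/-- Functions of the occupation numbers of the columns. -/
abbrev StateFn : Type := (ℕ → ℕ) → ℂ

/-- The vertex weights with cleared denominators, in the homogeneous spectral parameter
`p = (x, y)` with `u = x / y`; `g` is the number of arrows leaving upwards. -/
def siteCoef (q s : ℂ) (p : ℂ × ℂ) (i j : Fin 2) (g : ℕ) : ℂ :=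
  if i = 0 then (if j = 0 then p.2 - s * p.1 * q ^ g else p.1 * (1 - s ^ 2 * q ^ g))
  else (if j = 0 then p.2 * (1 - q ^ g) else p.1 - s * p.2 * q ^ g)

/-- The configuration below a vertex of column `c` with horizontal arrows `i` (in), `j` (out). -/
def shiftConf (c : ℕ) (i j : Fin 2) (ν : ℕ → ℕ) : ℕ → ℕ :=
  Function.update ν c (ν c + j.val - i.val)

/-- The action of a vertex in column `c` on functions of the configuration. -/
def siteOp (q s : ℂ) (c : ℕ) (p : ℂ × ℂ) (i j : Fin 2) : Module.End ℂ StateFn where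
  toFun f ν := siteCoef q s p i j (ν c) * f (shiftConf c i j ν)
  map_add' f g := by ext ν; simp [mul_add]
  map_smul' a f := by ext ν; simp [mul_left_comm]

lemma siteOp_apply (q s : ℂ) (c : ℕ) (p : ℂ × ℂ) (i j : Fin 2) (f : StateFn) (ν : ℕ → ℕ) :
    siteOp q s c p i j f ν = siteCoef q s p i j (ν c) * f (shiftConf c i j ν) := rfl

lemma siteOp_commute (q s : ℂ) {c d : ℕ} (h : c ≠ d) (p p' : ℂ × ℂ) (i j k l : Fin 2) :
    Commute (siteOp q s c p i j) (siteOp q s d p' k l) := by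
  ext f ν
  simp only [Module.End.mul_apply, siteOp_apply, shiftConf]
  rw [Function.update_of_ne h, Function.update_of_ne h.symm, Function.update_comm h]
  ring

section Matrices

variable {R : Type*} [Ring R]

/-- The tensor product of two matrices, entries of the first factor acting last. -/
def tensor (X Y : Matrix (Fin 2) (Fin 2) R) : Matrix (Fin 2 × Fin 2) (Fin 2 × Fin 2) R :=
  fun a b => X a.1 b.1 * Y a.2 b.2

/-- The tensor product of two matrices, entries of the second factor acting last. -/
def tensorOp (X Y : Matrix (Fin 2) (Fin 2) R) : Matrix (Fin 2 × Fin 2) (Fin 2 × Fin 2) R :=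
  fun a b => Y a.2 b.2 * X a.1 b.1

/-- Only the entries of X' and Y have to pass each other. In the application they belong to
different columns, so the one-column relation can be multiplied up column by column. -/
lemma tensor_mul (X X' Y Y' : Matrix (Fin 2) (Fin 2) R)
    (h : ∀ i j k l, Commute (X' i j) (Y k l)) :
    tensor (X * X') (Y * Y') = tensor X Y * tensor X' Y' := by
  ext ⟨i, j⟩ ⟨k, l⟩
  simp only [tensor, Matrix.mul_apply, Finset.sum_mul_sum, Fintype.sum_prod_type]
  refine Finset.sum_congr rfl fun a _ => Finset.sum_congr rfl fun b _ => ?_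
  rw [mul_assoc, ← mul_assoc (X' a k), (h a k j b).eq]
  noncomm_ring

lemma tensorOp_mul (X X' Y Y' : Matrix (Fin 2) (Fin 2) R)
    (h : ∀ i j k l, Commute (Y' i j) (X k l)) :
    tensorOp (X * X') (Y * Y') = tensorOp X Y * tensorOp X' Y' := by
  ext ⟨i, j⟩ ⟨k, l⟩
  simp only [tensorOp, Matrix.mul_apply, Finset.sum_mul_sum, Fintype.sum_prod_type]
  rw [Finset.sum_comm]
  refine Finset.sum_congr rfl fun a _ => Finset.sum_congr rfl fun b _ => ?_
  rw [mul_assoc, ← mul_assoc (Y' b l), (h b l i a).eq]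
  noncomm_ring

end Matrices

/-- The six vertex `R`-matrix. -/
def rMatrix (q : ℂ) (p p' : ℂ × ℂ) (a b : Fin 2 × Fin 2) : ℂ :=
  let X := p.1 * p'.2
  let X' := p'.1 * p.2
  if a = b then
    (if a.1 = a.2 then q * X - X' else if a.1 = 0 then X - X' else q * (X - X'))
  else if a.1 = b.2 ∧ a.2 = b.1 then (if a.1 = 0 then -(1 - q) * X else -(1 - q) * X')
  else 0

/-- The `R`-matrix with operator entries. -/
def rOp (q : ℂ) (p p' : ℂ × ℂ) :
    Matrix (Fin 2 × Fin 2) (Fin 2 × Fin 2) (Module.End ℂ StateFn) :=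
  fun a b => rMatrix q p p' a b • 1

set_option maxHeartbeats 4000000 in
/-- The RLL relation for a single column. -/
lemma rOp_mul_tensor_siteOp (q s : ℂ) (c : ℕ) (p p' : ℂ × ℂ) :
    rOp q p p' * tensor (siteOp q s c p) (siteOp q s c p') =
      tensorOp (siteOp q s c p) (siteOp q s c p') * rOp q p p' := by
  obtain ⟨x, y⟩ := p
  obtain ⟨x', y'⟩ := p'
  ext ⟨i, j⟩ ⟨k, l⟩ f ν
  obtain ⟨g, hg⟩ : ∃ g, ν c = g := ⟨_, rfl⟩
  -- Occupation number 0 is a separate case: there the natural subtraction in `shiftConf` truncates,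
  -- and the coefficient 1 - q^0 vanishes.
  fin_cases i <;> fin_cases j <;> fin_cases k <;> fin_cases l <;>
    rcases g with _ | g <;>
    simp [Matrix.mul_apply, Fintype.sum_prod_type, rOp, rMatrix, tensor, tensorOp, siteOp_apply,
      siteCoef, shiftConf, hg, Module.End.mul_apply, pow_succ,
      -mul_eq_mul_left_iff, -mul_eq_mul_right_iff] <;> ring

end HigherSpin

end

section

namespace HigherSpin

/-! ### The monodromy matrix of a range of columns -/

/-- The row transfer operators of the columns `a, ..., a + L - 1`, indexed by the horizontal arrows
entering from the left and leaving to the right. -/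
def monodromy (q s : ℂ) : (a L : ℕ) → (p : ℂ × ℂ) → Matrix (Fin 2) (Fin 2) (Module.End ℂ StateFn)
  | _, 0, _ => 1
  | a, L + 1, p => Matrix.of (siteOp q s a p) * monodromy q s (a + 1) L p

lemma monodromy_succ_apply (q s : ℂ) (a L : ℕ) (p : ℂ × ℂ) (i j : Fin 2) :
    monodromy q s a (L + 1) p i j =
      siteOp q s a p i 0 * monodromy q s (a + 1) L p 0 j +
        siteOp q s a p i 1 * monodromy q s (a + 1) L p 1 j := by
  simp [monodromy, Matrix.mul_apply]

/-- An operator commuting with all columns `≥ a` commutes with their monodromy. -/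
lemma commute_monodromy (q s : ℂ) (O : Module.End ℂ StateFn) (a L : ℕ) (p : ℂ × ℂ) (i j : Fin 2)
    (h : ∀ c, a ≤ c → c < a + L → ∀ i j, Commute O (siteOp q s c p i j)) :
    Commute O (monodromy q s a L p i j) := by
  induction L generalizing a i j with
  | zero =>
    rw [monodromy, Matrix.one_apply]
    split_ifs
    · exact Commute.one_right _
    · exact Commute.zero_right _
  | succ L ih =>
    rw [monodromy_succ_apply]
    have h' := fun i j => ih (a + 1) i j fun c hc hc' => h c (by omega) (by omega)
    have h0 := h a le_rfl (by omega)
    exact ((h0 i 0).mul_right (h' 0 j)).add_right ((h0 i 1).mul_right (h' 1 j))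

lemma siteOp_commute_monodromy (q s : ℂ) {c a : ℕ} (hc : c < a) (L : ℕ) (p p' : ℂ × ℂ)
    (i j k l : Fin 2) :
    Commute (siteOp q s c p i j) (monodromy q s a L p' k l) :=
  commute_monodromy q s _ a L p' k l fun d hd _ _ _ => siteOp_commute q s (by omega) _ _ _ _ _ _

/-- The RLL relation for the monodromy matrix. -/
lemma rOp_mul_tensor_monodromy (q s : ℂ) (a L : ℕ) (p p' : ℂ × ℂ) :
    rOp q p p' * tensor (monodromy q s a L p) (monodromy q s a L p') =
      tensorOp (monodromy q s a L p) (monodromy q s a L p') * rOp q p p' := by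
  induction L generalizing a with
  | zero =>
    have h1 : tensor (1 : Matrix (Fin 2) (Fin 2) (Module.End ℂ StateFn)) 1 = 1 := by
      ext1 ⟨i, j⟩ ⟨k, l⟩
      simp [tensor, Matrix.one_apply, Prod.ext_iff, ← ite_and]
      congr 1
      simp [and_comm]
    have h2 : tensorOp (1 : Matrix (Fin 2) (Fin 2) (Module.End ℂ StateFn)) 1 = 1 := by
      ext1 ⟨i, j⟩ ⟨k, l⟩
      simp [tensorOp, Matrix.one_apply, Prod.ext_iff, ← ite_and]
    simp [monodromy, h1, h2]
  | succ L ih =>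
    rw [monodromy, monodromy,
      tensor_mul _ _ (Matrix.of (siteOp q s a p')) _ (fun i j k l => (siteOp_commute_monodromy q s (Nat.lt_succ_self a)
        L p' p k l i j).symm),
      tensorOp_mul (Matrix.of (siteOp q s a p)) _ _ _ (fun i j k l => (siteOp_commute_monodromy q s (Nat.lt_succ_self a)
        L p p' k l i j).symm), ← mul_assoc]
    have h0 := rOp_mul_tensor_siteOp q s a p p'
    change rOp q p p' * tensor (Matrix.of (siteOp q s a p)) (Matrix.of (siteOp q s a p')) =
      tensorOp (Matrix.of (siteOp q s a p)) (Matrix.of (siteOp q s a p')) * rOp q p p' at h0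
    rw [h0, mul_assoc, ih, mul_assoc]

section Relations

variable (q s : ℂ) (a L : ℕ) (p p' : ℂ × ℂ)

/-- This is the entry ((0,1),(0,0)) of the RLL relation: the exchange of A with the creation
operator B. Denominators are cleared, so coinciding parameters are allowed. -/
lemma monodromy_zero_one_mul :
    (p.1 * p'.2 - p'.1 * p.2) • (monodromy q s a L p 0 0 * monodromy q s a L p' 1 0) =
      (q * (p.1 * p'.2) - p'.1 * p.2) • (monodromy q s a L p' 1 0 * monodromy q s a L p 0 0) +
      ((1 - q) * (p.1 * p'.2)) • (monodromy q s a L p 1 0 * monodromy q s a L p' 0 0) := by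
  have h := congrFun (congrFun (rOp_mul_tensor_monodromy q s a L p p') (0, 1)) (0, 0)
  simp only [Matrix.mul_apply, Fintype.sum_prod_type, Fin.sum_univ_two, rOp, rMatrix, tensor,
    tensorOp, smul_mul_assoc, one_mul, mul_smul_comm, mul_one] at h
  simp at h
  rw [← h]
  module

/-- The exchange of D with B, read off from the entry ((1,1),(0,1)) with p and p' interchanged. It
is the source of the spectral factors of G. -/
lemma monodromy_one_one_mul :
    (p'.1 * p.2 - p.1 * p'.2) • (monodromy q s a L p 1 1 * monodromy q s a L p' 1 0) =
      (q * (p'.1 * p.2) - p.1 * p'.2) • (monodromy q s a L p' 1 0 * monodromy q s a L p 1 1) +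
      ((1 - q) * (p.1 * p'.2)) • (monodromy q s a L p 1 0 * monodromy q s a L p' 1 1) := by
  have h := congrFun (congrFun (rOp_mul_tensor_monodromy q s a L p' p) (1, 1)) (0, 1)
  simp only [Matrix.mul_apply, Fintype.sum_prod_type, Fin.sum_univ_two, rOp, rMatrix, tensor,
    tensorOp, smul_mul_assoc, one_mul, mul_smul_comm, mul_one] at h
  simp at h
  rw [h]
  module

/-- The scalar can vanish, so this alone does not give commutativity. Interchanging p and p' gives a
second scalar, and for q² ≠ 1 both vanish only if the products p.1 * p'.2 and p'.1 * p.2 do. -/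
lemma monodromy_creation_mul :
    (q * (p.1 * p'.2) - p'.1 * p.2) • (monodromy q s a L p 1 0 * monodromy q s a L p' 1 0) =
      (q * (p.1 * p'.2) - p'.1 * p.2) • (monodromy q s a L p' 1 0 * monodromy q s a L p 1 0) := by
  have h := congrFun (congrFun (rOp_mul_tensor_monodromy q s a L p p') (1, 1)) (0, 0)
  simp only [Matrix.mul_apply, Fintype.sum_prod_type, Fin.sum_univ_two, rOp, rMatrix, tensor,
    tensorOp, smul_mul_assoc, one_mul, mul_smul_comm, mul_one] at h
  simpa using h

/-- The creation operators commute. -/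
lemma monodromy_creation_commute (hq : q ^ 2 ≠ 1)
    (h : p = p' ∨ p.1 * p'.2 ≠ 0 ∨ p'.1 * p.2 ≠ 0) :
    Commute (monodromy q s a L p 1 0) (monodromy q s a L p' 1 0) := by
  rcases h with rfl | h
  · exact Commute.refl _
  by_cases h1 : q * (p.1 * p'.2) - p'.1 * p.2 = 0
  · have h2 : q * (p'.1 * p.2) - p.1 * p'.2 ≠ 0 := by
      intro h2
      have h3 : (q ^ 2 - 1) * (p.1 * p'.2) = 0 := by linear_combination q * h1 + h2
      have h4 : (q ^ 2 - 1) * (p'.1 * p.2) = 0 := by linear_combination q * h2 + h1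
      have h5 : q ^ 2 - 1 ≠ 0 := sub_ne_zero.2 hq
      rcases h with h | h
      · exact (mul_ne_zero h5 h) h3
      · exact (mul_ne_zero h5 h) h4
    exact (smul_right_injective _ h2 (monodromy_creation_mul q s a L p' p)).symm
  · exact smul_right_injective _ h1 (monodromy_creation_mul q s a L p p')

end Relations

open Classical in
/-- The indicator function of the empty configuration. -/
def vacuum : StateFn := fun ν => if ν = 0 then 1 else 0

end HigherSpin

end

section

namespace HigherSpin

/-! ### Exchange relations and products of creation operators -/

section Exchange

variable {ι M : Type*} [DecidableEq ι] [AddCommGroup M] [Module ℂ M]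

omit [DecidableEq ι] in
lemma pairwise_onFun_commute {B : ι → Module.End ℂ M} (hB : ∀ i j, Commute (B i) (B j))
    (U : Finset ι) : (U : Set ι).Pairwise (Function.onFun Commute B) :=
  fun i _ j _ _ => hB i j

/-- The vector `∏_{i ∈ U} B_i v` for commuting operators `B_i`. -/
def bethe (B : ι → Module.End ℂ M) (hB : ∀ i j, Commute (B i) (B j)) (v : M)
    (U : Finset ι) : M :=
  U.noncommProd B (pairwise_onFun_commute hB U) v

variable {B : ι → Module.End ℂ M} {hB : ∀ i j, Commute (B i) (B j)} {v : M}

omit [DecidableEq ι] in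
@[simp] lemma bethe_empty : bethe B hB v ∅ = v := by
  rw [bethe, Finset.noncommProd_empty]; rfl

lemma bethe_insert {U : Finset ι} {k : ι} (hk : k ∉ U) :
    bethe B hB v (insert k U) = B k (bethe B hB v U) := by
  rw [bethe, Finset.noncommProd_insert_of_notMem _ _ _ _ hk]; rfl

/-- The action of an operator with a two-term exchange relation on a product of creation
operators. -/
lemma exchange_bethe (X : ι → Module.End ℂ M) (α β : ι → ι → ℂ) (x : ι → ℂ)
    (hX : ∀ k m, k ≠ m → X k * B m = α k m • (B m * X k) + β k m • (B k * X m))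
    (hαβ : ∀ k m j, k ≠ m → m ≠ j → j ≠ k →
      α k m * β k j + β k m * β m j = β k j * α j m)
    (hv : ∀ k, X k v = x k • v) (U : Finset ι) (k : ι) (hk : k ∉ U) :
    X k (bethe B hB v U) = ((∏ j ∈ U, α k j) * x k) • bethe B hB v U +
      ∑ j ∈ U, (β k j * (∏ i ∈ U.erase j, α j i) * x j) • bethe B hB v (insert k (U.erase j)) := by
  induction U using Finset.induction_on generalizing k with
  | empty => simp [hv]
  | insert m U hm ih =>
    have hkm : k ≠ m := fun h => hk (by simp [h])
    have hkU : k ∉ U := fun h => hk (by simp [h])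
    have e1 : X k (B m (bethe B hB v U)) =
        α k m • B m (X k (bethe B hB v U)) + β k m • B k (X m (bethe B hB v U)) := by
      have := LinearMap.congr_fun (hX k m hkm) (bethe B hB v U)
      simpa using this
    rw [bethe_insert hm, e1, ih k hkU, ih m hm, Finset.prod_insert hm, Finset.sum_insert hm,
      Finset.erase_insert hm, bethe_insert hkU]
    simp only [map_add, map_smul, map_sum, smul_add, Finset.smul_sum, smul_smul]
    rw [add_assoc]
    congr 1
    · rw [mul_assoc]
    rw [add_left_comm]
    congr 1
    · rw [mul_assoc]
    -- The vector with j removed and k added arises twice: from X_k after passing B_m, and from X_m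
    -- after the exchange of k and m. The relation `hαβ` merges the two coefficients.
    rw [← Finset.sum_add_distrib]
    refine Finset.sum_congr rfl fun j hj => ?_
    have hjm : m ≠ j := fun h => hm (h ▸ hj)
    have hjk : j ≠ k := fun h => hkU (h ▸ hj)
    have hm' : m ∉ U.erase j := fun h => hm (Finset.mem_of_mem_erase h)
    have hk' : k ∉ U.erase j := fun h => hkU (Finset.mem_of_mem_erase h)
    have h1 : (insert m U).erase j = insert m (U.erase j) := Finset.erase_insert_of_ne hjm
    have h2 : bethe B hB v (insert k (insert m (U.erase j))) =
        B k (B m (bethe B hB v (U.erase j))) := by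
      rw [bethe_insert (by simp [hkm, hk']), bethe_insert hm']
    have h3 : B m (B k (bethe B hB v (U.erase j))) = B k (B m (bethe B hB v (U.erase j))) :=
      LinearMap.congr_fun (hB m k).eq _
    rw [h1, h2, bethe_insert hk', bethe_insert hm', h3, Finset.prod_insert hm', ← add_smul]
    congr 1
    linear_combination ((∏ i ∈ U.erase j, α j i) * x j) * hαβ k m j hkm hjm hjk

/-- An annihilation operator `Y` with `Y B = q B Y + (1 - q) Z`, where `Z` satisfies a two-term
exchange relation, removes the factors of a product of creation operators one by one. -/
lemma annihilate_bethe (q : ℂ) (Y : Module.End ℂ M) (Z : ι → Module.End ℂ M) (α β : ι → ι → ℂ)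
    (x : ι → ℂ) (hY : ∀ k, Y * B k = q • (B k * Y) + (1 - q) • Z k) (hYv : Y v = 0)
    (hZ : ∀ k m, k ≠ m → Z k * B m = α k m • (B m * Z k) + β k m • (B k * Z m))
    (hαβ : ∀ k m j, k ≠ m → m ≠ j → j ≠ k →
      α k m * β k j + β k m * β m j = β k j * α j m)
    (hα : ∀ j k, j ≠ k → α j k = q + β k j)
    (hv : ∀ k, Z k v = x k • v) (U : Finset ι) :
    Y (bethe B hB v U) =
      ∑ j ∈ U, ((1 - q) * x j * ∏ i ∈ U.erase j, α j i) • bethe B hB v (U.erase j) := by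
  induction U using Finset.induction_on with
  | empty => simp [hYv]
  | insert k U hk ih =>
    have e1 : Y (B k (bethe B hB v U)) =
        q • B k (Y (bethe B hB v U)) + (1 - q) • Z k (bethe B hB v U) := by
      have := LinearMap.congr_fun (hY k) (bethe B hB v U)
      simpa using this
    rw [bethe_insert hk, e1, ih, exchange_bethe Z α β x hZ hαβ hv U k hk, Finset.sum_insert hk,
      Finset.erase_insert hk]
    simp only [map_smul, map_sum, smul_add, Finset.smul_sum, smul_smul]
    rw [add_left_comm]
    congr 1
    · congr 1; ring
    rw [← Finset.sum_add_distrib]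
    refine Finset.sum_congr rfl fun j hj => ?_
    have hjk : j ≠ k := fun h => hk (h ▸ hj)
    have hk' : k ∉ U.erase j := fun h => hk (Finset.mem_of_mem_erase h)
    rw [Finset.erase_insert_of_ne hjk.symm, bethe_insert hk', Finset.prod_insert hk', ← add_smul,
      hα j k hjk]
    congr 1
    ring

/-- Double counting of the sets of n + 1 removed factors with a marked element, the one removed
first. -/
lemma sum_erase_powersetCard {A : Type*} [AddCommMonoid A] (n : ℕ) (U : Finset ι)
    (g : ι → Finset ι → A) :
    ∑ j ∈ U, ∑ S ∈ (U.erase j).powersetCard n, g j S =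
      ∑ S ∈ U.powersetCard (n + 1), ∑ j ∈ S, g j (S.erase j) := by
  rw [Finset.sum_sigma', Finset.sum_sigma']
  refine Finset.sum_bij' (fun x _ => ⟨insert x.1 x.2, x.1⟩) (fun x _ => ⟨x.2, x.1.erase x.2⟩)
    ?_ ?_ ?_ ?_ ?_
  · rintro ⟨j, S⟩ h
    simp only [Finset.mem_sigma, Finset.mem_powersetCard] at h ⊢
    have hj : j ∉ S := fun h' => by simpa using h.2.1 h'
    refine ⟨⟨Finset.insert_subset h.1 fun i hi => Finset.mem_of_mem_erase (h.2.1 hi), ?_⟩, by simp⟩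
    rw [Finset.card_insert_of_notMem hj, h.2.2]
  · rintro ⟨S, j⟩ h
    simp only [Finset.mem_sigma, Finset.mem_powersetCard] at h ⊢
    refine ⟨h.1.1 h.2, Finset.erase_subset_erase _ h.1.1, ?_⟩
    rw [Finset.card_erase_of_mem h.2, h.1.2]; rfl
  · rintro ⟨j, S⟩ h
    simp only [Finset.mem_sigma, Finset.mem_powersetCard] at h ⊢
    have hj : j ∉ S := fun h' => by simpa using h.2.1 h'
    simp [hj]
  · rintro ⟨S, j⟩ h
    simp only [Finset.mem_sigma, Finset.mem_powersetCard] at h ⊢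
    simp [Finset.insert_erase h.2]
  · rintro ⟨j, S⟩ h
    simp only [Finset.mem_sigma, Finset.mem_powersetCard] at h ⊢
    have hj : j ∉ S := fun h' => by simpa using h.2.1 h'
    simp [hj]

/-- Iterating an annihilation operator sums over the subsets of removed factors. -/
lemma annihilate_pow_bethe (q : ℂ) (Y : Module.End ℂ M) (α : ι → ι → ℂ) (x : ι → ℂ)
    (hY : ∀ U : Finset ι, Y (bethe B hB v U) =
      ∑ j ∈ U, ((1 - q) * x j * ∏ i ∈ U.erase j, α j i) • bethe B hB v (U.erase j))
    (hsum : ∀ S : Finset ι, (1 - q) * ∑ j ∈ S, ∏ i ∈ S.erase j, α j i = 1 - q ^ S.card)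
    (n : ℕ) (U : Finset ι) :
    (Y ^ n) (bethe B hB v U) =
      ∑ S ∈ U.powersetCard n, (qPoch q q n * (∏ i ∈ S, x i) * ∏ i ∈ S, ∏ j ∈ U \ S, α i j) •
        bethe B hB v (U \ S) := by
  induction n generalizing U with
  | zero => simp [qPoch]
  | succ n ih =>
    rw [pow_succ, Module.End.mul_apply, hY]
    simp only [map_sum, map_smul, ih, Finset.smul_sum, smul_smul]
    rw [sum_erase_powersetCard n U (fun j S => ((1 - q) * x j * (∏ i ∈ U.erase j, α j i) *
      (qPoch q q n * (∏ i ∈ S, x i) * ∏ i ∈ S, ∏ j ∈ U.erase j \ S, α i j)) •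
        bethe B hB v (U.erase j \ S))]
    refine Finset.sum_congr rfl fun S hS => ?_
    obtain ⟨hSU, hc⟩ := Finset.mem_powersetCard.1 hS
    have key : ∀ j ∈ S, ((1 - q) * x j * (∏ i ∈ U.erase j, α j i) *
      (qPoch q q n * (∏ i ∈ S.erase j, x i) *
        ∏ i ∈ S.erase j, ∏ l ∈ U.erase j \ S.erase j, α i l)) •
        bethe B hB v (U.erase j \ S.erase j) =
        ((qPoch q q n * (∏ i ∈ S, x i) * ∏ i ∈ S, ∏ j ∈ U \ S, α i j) *
          ((1 - q) * ∏ i ∈ S.erase j, α j i)) • bethe B hB v (U \ S) := by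
      intro j hj
      have h1 : U.erase j \ S.erase j = U \ S := by
        ext i
        simp only [Finset.mem_sdiff, Finset.mem_erase]
        constructor
        · rintro ⟨⟨h1, h2⟩, h3⟩
          exact ⟨h2, fun h => h3 ⟨h1, h⟩⟩
        · rintro ⟨h1, h2⟩
          have : i ≠ j := fun h => h2 (h ▸ hj)
          exact ⟨⟨this, h1⟩, fun h => h2 h.2⟩
      have h2 : U.erase j = S.erase j ∪ (U \ S) := by
        rw [← h1, Finset.union_sdiff_of_subset (Finset.erase_subset_erase _ hSU)]
      have h3 : Disjoint (S.erase j) (U \ S) := by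
        rw [← h1]; exact Finset.disjoint_sdiff
      rw [h1]
      congr 1
      rw [h2, Finset.prod_union h3, ← Finset.mul_prod_erase S x hj,
        ← Finset.mul_prod_erase S (fun i => ∏ j ∈ U \ S, α i j) hj]
      ring
    -- Summing over the factor removed first is the symmetrization `hsum`, which produces the next
    -- factor 1 - q^(n+1) of the q-Pochhammer symbol.
    rw [Finset.sum_congr rfl key, ← Finset.sum_smul, ← Finset.mul_sum, ← Finset.mul_sum, hsum, hc]
    congr 1
    rw [qPoch, qPoch, Finset.prod_range_succ, pow_succ']
    ring

end Exchange

end HigherSpin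

end

section

namespace HigherSpin

/-! ### Action on the vacuum and removal of the first column -/

section Vacuum

variable (q s : ℂ) (a L : ℕ) (p : ℂ × ℂ)

lemma vacuum_update_succ (ν : ℕ → ℕ) (c g : ℕ) : vacuum (Function.update ν c (g + 1)) = 0 := by
  rw [vacuum, if_neg]
  intro h
  simpa using congrFun h c

lemma siteOp_zero_one_vacuum (c : ℕ) : siteOp q s c p 0 1 vacuum = 0 := by
  ext ν
  simp [siteOp_apply, shiftConf, vacuum_update_succ]

lemma siteOp_zero_zero_vacuum (c : ℕ) :
    siteOp q s c p 0 0 vacuum = (p.2 - s * p.1) • vacuum := by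
  ext ν
  by_cases h : ν = 0 <;> simp [siteOp_apply, shiftConf, vacuum, siteCoef, h]

lemma siteOp_one_one_vacuum (c : ℕ) :
    siteOp q s c p 1 1 vacuum = (p.1 - s * p.2) • vacuum := by
  ext ν
  by_cases h : ν = 0 <;> simp [siteOp_apply, shiftConf, vacuum, siteCoef, h]

lemma monodromy_zero_one_vacuum : monodromy q s a L p 0 1 vacuum = 0 := by
  induction L generalizing a with
  | zero => simp [monodromy]
  | succ L ih =>
    rw [monodromy_succ_apply, LinearMap.add_apply, Module.End.mul_apply, ih, map_zero, zero_add,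
      (siteOp_commute_monodromy q s (Nat.lt_succ_self a) L p p 0 1 1 1).eq,
      Module.End.mul_apply, siteOp_zero_one_vacuum, map_zero]

lemma monodromy_zero_zero_vacuum :
    monodromy q s a L p 0 0 vacuum = (p.2 - s * p.1) ^ L • vacuum := by
  induction L generalizing a with
  | zero => simp [monodromy]
  | succ L ih =>
    rw [monodromy_succ_apply, LinearMap.add_apply, Module.End.mul_apply, ih, map_smul,
      siteOp_zero_zero_vacuum,
      (siteOp_commute_monodromy q s (Nat.lt_succ_self a) L p p 0 1 1 0).eq,
      Module.End.mul_apply, siteOp_zero_one_vacuum, map_zero, add_zero, smul_smul, pow_succ]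

lemma monodromy_one_one_vacuum :
    monodromy q s a L p 1 1 vacuum = (p.1 - s * p.2) ^ L • vacuum := by
  induction L generalizing a with
  | zero => simp [monodromy]
  | succ L ih =>
    rw [monodromy_succ_apply, LinearMap.add_apply, Module.End.mul_apply, Module.End.mul_apply, ih,
      monodromy_zero_one_vacuum, map_smul, siteOp_one_one_vacuum, map_zero, zero_add, smul_smul,
      pow_succ]

end Vacuum

/-- The shift of the occupation number of a column. -/
def lower (c : ℕ) : Module.End ℂ StateFn where
  toFun f ν := f (Function.update ν c (ν c + 1))
  map_add' f g := by ext ν; simp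
  map_smul' a f := by ext ν; simp

lemma lower_apply (c : ℕ) (f : StateFn) (ν : ℕ → ℕ) :
    lower c f ν = f (Function.update ν c (ν c + 1)) := rfl

lemma lower_pow_apply (c n : ℕ) (f : StateFn) (ν : ℕ → ℕ) :
    (lower c ^ n) f ν = f (Function.update ν c (ν c + n)) := by
  induction n generalizing ν with
  | zero => simp
  | succ n ih =>
    rw [pow_succ', Module.End.mul_apply, lower_apply, ih]
    simp [add_assoc, add_comm 1 n]

lemma lower_commute_monodromy (q s : ℂ) {c a : ℕ} (hc : c < a) (L : ℕ) (p : ℂ × ℂ) (i j : Fin 2) :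
    Commute (lower c) (monodromy q s a L p i j) := by
  refine commute_monodromy q s _ a L p i j fun d hd _ i j => ?_
  ext f ν
  have h : c ≠ d := by omega
  simp only [Module.End.mul_apply, siteOp_apply, lower_apply, shiftConf]
  rw [Function.update_of_ne h, Function.update_of_ne h.symm, Function.update_comm h]

/-- The operator produced by commuting `lower a` with a creation operator. -/
def lowerA (q s : ℂ) (a L : ℕ) (p : ℂ × ℂ) : Module.End ℂ StateFn :=
  p.2 • monodromy q s (a + 1) L p 0 0 + p.1 • (lower a * monodromy q s (a + 1) L p 1 0)

/-- The coefficients of the first column are affine in q^g. Raising g by one multiplies them by q up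
to a multiple of 1 - q, and these constant parts make up `lowerA`. -/
lemma lower_mul_creation (q s : ℂ) (a L : ℕ) (p : ℂ × ℂ) :
    lower a * monodromy q s a (L + 1) p 1 0 =
      q • (monodromy q s a (L + 1) p 1 0 * lower a) + (1 - q) • lowerA q s a L p := by
  have h1 : lower a * siteOp q s a p 1 0 =
      q • (siteOp q s a p 1 0 * lower a) + ((1 - q) * p.2) • 1 := by
    ext f ν
    simp only [Module.End.mul_apply, siteOp_apply, lower_apply, shiftConf, siteCoef,
      LinearMap.add_apply, LinearMap.smul_apply, Pi.add_apply, Pi.smul_apply, smul_eq_mul,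
      Module.End.one_apply]
    rcases h : ν a with _ | g
    · have hu : Function.update ν a 0 = ν := by rw [← h]; simp
      simp [hu, -mul_eq_mul_left_iff, -mul_eq_mul_right_iff]; ring
    · have hu : Function.update ν a (g + 1) = ν := by rw [← h]; simp
      simp [hu, -mul_eq_mul_left_iff, -mul_eq_mul_right_iff]; ring
  have h2 : lower a * siteOp q s a p 1 1 =
      q • (siteOp q s a p 1 1 * lower a) + ((1 - q) * p.1) • lower a := by
    ext f ν
    simp only [Module.End.mul_apply, siteOp_apply, lower_apply, shiftConf, siteCoef,
      LinearMap.add_apply, LinearMap.smul_apply, Pi.add_apply, Pi.smul_apply, smul_eq_mul]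
    simp
    ring
  rw [monodromy_succ_apply, mul_add, ← mul_assoc, h1, ← mul_assoc, h2, lowerA]
  have c1 := (lower_commute_monodromy q s (Nat.lt_succ_self a) L p 0 0).eq
  have c2 := (lower_commute_monodromy q s (Nat.lt_succ_self a) L p 1 0).eq
  simp only [add_mul, smul_mul_assoc, mul_assoc, one_mul, smul_add, smul_smul, ← c1, ← c2,
    Nat.succ_eq_add_one] at *
  abel

lemma creation_apply (q s : ℂ) (a L : ℕ) (p : ℂ × ℂ) (f : StateFn) (ν : ℕ → ℕ) :
    monodromy q s a (L + 1) p 1 0 f ν =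
      p.2 * (1 - q ^ ν a) * monodromy q s (a + 1) L p 0 0 f (Function.update ν a (ν a - 1)) +
      (p.1 - s * p.2 * q ^ ν a) * monodromy q s (a + 1) L p 1 0 f ν := by
  rw [monodromy_succ_apply]
  simp [siteOp_apply, shiftConf, siteCoef]

lemma lowerA_apply (q s : ℂ) (a L : ℕ) (p : ℂ × ℂ) (f : StateFn) (ν : ℕ → ℕ) :
    lowerA q s a L p f ν = p.2 * monodromy q s (a + 1) L p 0 0 f ν +
      p.1 * monodromy q s (a + 1) L p 1 0 f (Function.update ν a (ν a + 1)) := rfl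

lemma monodromy_creation_apply (q s : ℂ) (a L : ℕ) (p p' : ℂ × ℂ) (i j : Fin 2) (f : StateFn)
    (ν : ℕ → ℕ) :
    monodromy q s (a + 1) L p i j (monodromy q s a (L + 1) p' 1 0 f) ν =
      p'.2 * (1 - q ^ ν a) * monodromy q s (a + 1) L p i j
        (monodromy q s (a + 1) L p' 0 0 f) (Function.update ν a (ν a - 1)) +
      (p'.1 - s * p'.2 * q ^ ν a) *
        monodromy q s (a + 1) L p i j (monodromy q s (a + 1) L p' 1 0 f) ν := by
  have h := fun k => LinearMap.congr_fun
    (siteOp_commute_monodromy q s (Nat.lt_succ_self a) L p' p 1 k i j).eq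
      (monodromy q s (a + 1) L p' k 0 f)
  simp only [Module.End.mul_apply, Nat.succ_eq_add_one] at h
  rw [monodromy_succ_apply, LinearMap.add_apply, Module.End.mul_apply, Module.End.mul_apply,
    map_add, ← h, ← h, Pi.add_apply, siteOp_apply, siteOp_apply]
  simp [shiftConf, siteCoef]

lemma monodromy_lowerA_apply (q s : ℂ) (a L : ℕ) (p p' : ℂ × ℂ) (i j : Fin 2) (f : StateFn)
    (ν : ℕ → ℕ) :
    monodromy q s (a + 1) L p i j (lowerA q s a L p' f) ν =
      p'.2 * monodromy q s (a + 1) L p i j (monodromy q s (a + 1) L p' 0 0 f) ν +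
      p'.1 * monodromy q s (a + 1) L p i j
        (monodromy q s (a + 1) L p' 1 0 f) (Function.update ν a (ν a + 1)) := by
  have h := LinearMap.congr_fun (lower_commute_monodromy q s (Nat.lt_succ_self a) L p i j).eq
      (monodromy q s (a + 1) L p' 1 0 f)
  simp only [Module.End.mul_apply, Nat.succ_eq_add_one] at h
  rw [lowerA, LinearMap.add_apply, map_add, LinearMap.smul_apply, LinearMap.smul_apply, map_smul,
    map_smul, Module.End.mul_apply, ← h]
  rfl

/-- `lowerA` obeys the same exchange relation with B as A does. Expanding both sides in column a
reduces it to the AA, BB and AB relations on the columns after a. -/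
lemma lowerA_mul_creation (q s : ℂ) (a L : ℕ) (p p' : ℂ × ℂ) (h : p.1 * p'.2 - p'.1 * p.2 ≠ 0) :
    (p.1 * p'.2 - p'.1 * p.2) • (lowerA q s a L p * monodromy q s a (L + 1) p' 1 0) =
      (q * (p.1 * p'.2) - p'.1 * p.2) • (monodromy q s a (L + 1) p' 1 0 * lowerA q s a L p) +
      ((1 - q) * (p.1 * p'.2)) • (monodromy q s a (L + 1) p 1 0 * lowerA q s a L p') := by
  ext f ν
  have hAA : ∀ ν, (q * (p.1 * p'.2) - p'.1 * p.2) * monodromy q s (a + 1) L p 0 0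
      (monodromy q s (a + 1) L p' 0 0 f) ν = (q * (p.1 * p'.2) - p'.1 * p.2) *
      monodromy q s (a + 1) L p' 0 0 (monodromy q s (a + 1) L p 0 0 f) ν := by
    intro ν
    have h := congrFun (congrFun (rOp_mul_tensor_monodromy q s (a + 1) L p p') (0, 0)) (0, 0)
    simp only [Matrix.mul_apply, Fintype.sum_prod_type, Fin.sum_univ_two, rOp, rMatrix, tensor,
      tensorOp, smul_mul_assoc, one_mul, mul_smul_comm, mul_one] at h
    simp at h
    exact congrFun (LinearMap.congr_fun h f) ν
  have hBB : ∀ ν, (q * (p.1 * p'.2) - p'.1 * p.2) * monodromy q s (a + 1) L p 1 0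
      (monodromy q s (a + 1) L p' 1 0 f) ν = (q * (p.1 * p'.2) - p'.1 * p.2) *
      monodromy q s (a + 1) L p' 1 0 (monodromy q s (a + 1) L p 1 0 f) ν := fun ν =>
    congrFun (LinearMap.congr_fun (monodromy_creation_mul q s (a + 1) L p p') f) ν
  have hAB : (p.1 * p'.2 - p'.1 * p.2) * monodromy q s (a + 1) L p 0 0
      (monodromy q s (a + 1) L p' 1 0 f) ν = (q * (p.1 * p'.2) - p'.1 * p.2) *
      monodromy q s (a + 1) L p' 1 0 (monodromy q s (a + 1) L p 0 0 f) ν +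
      (1 - q) * (p.1 * p'.2) * monodromy q s (a + 1) L p 1 0
      (monodromy q s (a + 1) L p' 0 0 f) ν :=
    congrFun (LinearMap.congr_fun (monodromy_zero_one_mul q s (a + 1) L p p') f) ν
  have hAB' : (p'.1 * p.2 - p.1 * p'.2) * monodromy q s (a + 1) L p' 0 0
      (monodromy q s (a + 1) L p 1 0 f) ν = (q * (p'.1 * p.2) - p.1 * p'.2) *
      monodromy q s (a + 1) L p 1 0 (monodromy q s (a + 1) L p' 0 0 f) ν +
      (1 - q) * (p'.1 * p.2) * monodromy q s (a + 1) L p' 1 0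
      (monodromy q s (a + 1) L p 0 0 f) ν :=
    congrFun (LinearMap.congr_fun (monodromy_zero_one_mul q s (a + 1) L p' p) f) ν
  simp only [LinearMap.add_apply, LinearMap.smul_apply, Pi.add_apply, Pi.smul_apply, smul_eq_mul,
    Module.End.mul_apply, lowerA_apply, creation_apply, monodromy_creation_apply,
    monodromy_lowerA_apply]
  obtain ⟨x, y⟩ := p
  obtain ⟨x', y'⟩ := p'
  simp only [Function.update_self, Function.update_idem, add_tsub_cancel_right,
    Function.update_eq_self] at *
  -- The combination of relations used below is available only after one more factor x y' - x' y.
  refine mul_left_cancel₀ h ?_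
  rcases hg : ν a with _ | g
  · simp only [hg, pow_zero, sub_self, mul_zero, zero_mul, zero_add, pow_one] at *
    linear_combination (x * y' - x' * y) * x * (x' - s * y') * hBB (Function.update ν a 1) +
      ((x * y' - x' * y) * y * (x' - s * y')) * hAB
  · have hu : Function.update ν a (g + 1) = ν := by rw [← hg]; simp
    simp only [hg, add_tsub_cancel_right, hu] at *
    linear_combination
      (x * y' - x' * y) * x * (x' - s * y' * q ^ (g + 1)) *
        hBB (Function.update ν a (g + 1 + 1)) +
      (x * y' - x' * y) * y * y' * (1 - q ^ (g + 1)) * hAA (Function.update ν a g) +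
      ((x * y' - x' * y) * y * (x' - s * y' * q ^ (g + 1)) -
        (1 - q) * x * y' * y * x' * (1 - q ^ (g + 1))) * hAB +
      (q * (x * y') - x' * y) * x * y' * (1 - q ^ (g + 1)) * hAB'

end HigherSpin

end

section

namespace HigherSpin

/-! ### Products of creation operators applied to the vacuum -/

lemma monodromy_smul (q s c : ℂ) (a L : ℕ) (p : ℂ × ℂ) (i j : Fin 2) :
    monodromy q s a L (c • p) i j = c ^ L • monodromy q s a L p i j := by
  have h : ∀ a i j, siteOp q s a (c • p) i j = c • siteOp q s a p i j := by
    intro a i j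
    ext f ν
    simp only [LinearMap.smul_apply, Pi.smul_apply, siteOp_apply, smul_eq_mul]
    fin_cases i <;> fin_cases j <;> simp [siteCoef] <;> ring
  induction L generalizing a i j with
  | zero => simp [monodromy]
  | succ L ih =>
    simp only [monodromy_succ_apply, ih, h, smul_mul_assoc, mul_smul_comm, smul_smul, smul_add,
      pow_succ, mul_comm]

/-- The creation operators commute for all spectral parameters. -/
lemma creation_commute (q s : ℂ) (hq : q ^ 2 ≠ 1) (a L : ℕ) (p p' : ℂ × ℂ) :
    Commute (monodromy q s a L p 1 0) (monodromy q s a L p' 1 0) := by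
  by_cases h : p.1 * p'.2 ≠ 0 ∨ p'.1 * p.2 ≠ 0
  · exact monodromy_creation_commute q s a L p p' hq (Or.inr h)
  push Not at h
  -- When both products vanish the parameters are proportional, and the monodromy is homogeneous in
  -- its parameter.
  have hc : (∃ c : ℂ, p = c • p') ∨ ∃ c : ℂ, p' = c • p := by
    obtain ⟨x, y⟩ := p
    obtain ⟨x', y'⟩ := p'
    obtain ⟨h1, h2⟩ := h
    simp only [mul_eq_zero] at h1 h2
    by_cases hx : x = 0 <;> by_cases hy : y = 0
    · exact Or.inl ⟨0, by simp [hx, hy]⟩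
    · have hx' : x' = 0 := h2.resolve_right hy
      refine Or.inr ⟨y' / y, ?_⟩
      simp [hx, hx', hy]
    · have hy' : y' = 0 := h1.resolve_left hx
      refine Or.inr ⟨x' / x, ?_⟩
      simp [hx, hy', hy]
    · have hx' : x' = 0 := h2.resolve_right hy
      have hy' : y' = 0 := h1.resolve_left hx
      exact Or.inr ⟨0, by simp [hx', hy']⟩
  rcases hc with ⟨c, rfl⟩ | ⟨c, rfl⟩
  · rw [monodromy_smul]
    exact (Commute.refl _).smul_left _
  · rw [monodromy_smul]
    exact (Commute.refl _).smul_right _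

section Bethe

variable {ι : Type*} [DecidableEq ι]

/-- The off-shell vector `∏_{i ∈ U} B(p_i) |0⟩` on the columns `a, ..., a + L - 1`. -/
def bvec (q s : ℂ) (hq : q ^ 2 ≠ 1) (a L : ℕ) (p : ι → ℂ × ℂ) (U : Finset ι) : StateFn :=
  bethe (fun i => monodromy q s a L (p i) 1 0) (fun i j => creation_commute q s hq a L (p i) (p j))
    vacuum U

variable {q s : ℂ} {hq : q ^ 2 ≠ 1} {a L : ℕ} {p : ι → ℂ × ℂ}

omit [DecidableEq ι] in
@[simp] lemma bvec_empty : bvec q s hq a L p ∅ = vacuum := bethe_empty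

lemma bvec_insert {U : Finset ι} {k : ι} (hk : k ∉ U) :
    bvec q s hq a L p (insert k U) = monodromy q s a L (p k) 1 0 (bvec q s hq a L p U) :=
  bethe_insert hk

/-- In a single column every path has to stop, and the g-th one contributes 1 - q^g whatever its
parameter and s are. -/
lemma bvec_one_column (U : Finset ι) :
    bvec q s hq 0 1 (fun i => ((p i).1, 1)) U (Function.update 0 0 U.card) =
      qPoch q q U.card := by
  induction U using Finset.induction_on with
  | empty => simp [qPoch, vacuum]
  | insert k U hk ih =>
    rw [bvec_insert hk, creation_apply, Finset.card_insert_of_notMem hk]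
    simp only [monodromy]
    rw [qPoch, Finset.prod_range_succ, ← qPoch, ← ih]
    simp [pow_succ']
    ring

/-- The creation of a path through an empty first column. -/
lemma bvec_of_apply_eq_zero (U : Finset ι) {ν : ℕ → ℕ} (hν : ν a = 0) :
    bvec q s hq a (L + 1) p U ν =
      (∏ i ∈ U, ((p i).1 - s * (p i).2)) * bvec q s hq (a + 1) L p U ν := by
  classical
  -- P projects onto the functions supported on configurations with empty column a. It turns B on
  -- the columns from a on into (u - s) B on the columns from a + 1 on.
  let P : Module.End ℂ StateFn :=
    { toFun := fun f ν => if ν a = 0 then f ν else 0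
      map_add' := fun f g => by ext ν; simp; split_ifs <;> simp
      map_smul' := fun c f => by ext ν; simp }
  have hP : ∀ (f : StateFn) ν, P f ν = if ν a = 0 then f ν else 0 := fun _ _ => rfl
  have hcomm : ∀ p i j, Commute P (monodromy q s (a + 1) L p i j) := by
    intro p i j
    refine commute_monodromy q s _ _ L p i j fun d hd _ i j => ?_
    ext f ν
    have h : a ≠ d := by omega
    simp only [Module.End.mul_apply, hP, siteOp_apply, shiftConf]
    rw [Function.update_of_ne h]
    split_ifs <;> simp
  have hB : ∀ p f, P (monodromy q s a (L + 1) p 1 0 f) =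
      (p.1 - s * p.2) • monodromy q s (a + 1) L p 1 0 (P f) := by
    intro p f
    have h := LinearMap.congr_fun (hcomm p 1 0).eq f
    simp only [Module.End.mul_apply] at h
    rw [← h]
    ext ν
    simp only [hP, creation_apply, Pi.smul_apply, smul_eq_mul]
    split_ifs with h0
    · simp [h0]
    · simp
  have key : P (bvec q s hq a (L + 1) p U) =
      (∏ i ∈ U, ((p i).1 - s * (p i).2)) • P (bvec q s hq (a + 1) L p U) := by
    induction U using Finset.induction_on with
    | empty => simp
    | insert k U hk ih =>
      have h := LinearMap.congr_fun (hcomm (p k) 1 0).eq (bvec q s hq (a + 1) L p U)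
      simp only [Module.End.mul_apply] at h
      rw [bvec_insert hk, hB, ih, bvec_insert hk, h, map_smul, smul_smul, Finset.prod_insert hk]
  simpa [hP, hν] using congrFun key ν

lemma lowerA_vacuum (p : ℂ × ℂ) :
    lowerA q s a L p vacuum = (p.2 * (p.2 - s * p.1) ^ L) • vacuum := by
  have h := LinearMap.congr_fun (lower_commute_monodromy q s (Nat.lt_succ_self a) L p 1 0).eq vacuum
  have h0 : lower a vacuum = 0 := by
    ext ν
    simp [lower_apply, vacuum_update_succ]
  simp only [Module.End.mul_apply, h0, map_zero, Nat.succ_eq_add_one] at h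
  rw [lowerA, LinearMap.add_apply, LinearMap.smul_apply, LinearMap.smul_apply,
    Module.End.mul_apply, h, monodromy_zero_zero_vacuum, smul_zero, add_zero, smul_smul]

lemma lower_vacuum (c : ℕ) : lower c vacuum = 0 := by
  ext ν
  simp [lower_apply, vacuum_update_succ]

/-- An instance of `annihilate_bethe` with Z = `lowerA`. The power (1 - s u_j)^L is the eigenvalue
of A on the vacuum of the L later columns, which the removed path never reaches. -/
lemma lower_bvec {u : ι → ℂ} (hu : Function.Injective u) (U : Finset ι) :
    lower a (bvec q s hq a (L + 1) (fun i => (u i, 1)) U) =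
      ∑ j ∈ U, ((1 - q) * (1 - s * u j) ^ L *
        ∏ i ∈ U.erase j, (q * u j - u i) / (u j - u i)) •
          bvec q s hq a (L + 1) (fun i => (u i, 1)) (U.erase j) := by
  have hne : ∀ {i j}, i ≠ j → u i - u j ≠ 0 := fun h => sub_ne_zero.2 (hu.ne h)
  refine annihilate_bethe (x := fun j => (1 - s * u j) ^ L)
    (α := fun j i => (q * u j - u i) / (u j - u i)) q (lower a)
    (fun k => lowerA q s a L (u k, 1)) (fun k m => (1 - q) * u k / (u k - u m))
    (fun k => lower_mul_creation q s a L (u k, 1)) (lower_vacuum a) ?_ ?_ ?_ ?_ U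
  · intro k m hkm
    have h := lowerA_mul_creation q s a L (u k, 1) (u m, 1) (by simpa using hne hkm)
    simp only [mul_one] at h
    refine smul_right_injective _ (hne hkm) ?_
    simp only [h, smul_add, smul_smul]
    congr 2 <;> field_simp [hne hkm]
  · intro k m j hkm hmj hjk
    have h1 := hne hkm
    have h2 := hne hmj
    have h3 := hne hjk
    have h4 := hne hjk.symm
    have h5 := hne hmj.symm
    field_simp
    ring
  · intro j k hjk
    have h1 := hne hjk
    have h2 := hne hjk.symm
    field_simp
    ring
  · intro k
    simpa using lowerA_vacuum (q := q) (s := s) (a := a) (L := L) (u k, 1)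

/-- The symmetrization identity `∑_j ∏_{i ≠ j} (q u_j - u_i) / (u_j - u_i) = (1 - q^n) / (1 - q)`. -/
lemma sum_prod_erase_div {u : ι → ℂ} (hu : Function.Injective u) (hq' : ∀ n, 0 < n → q ^ n ≠ 1)
    (S : Finset ι) :
    (1 - q) * ∑ j ∈ S, ∏ i ∈ S.erase j, (q * u j - u i) / (u j - u i) = 1 - q ^ S.card := by
  rcases S.eq_empty_or_nonempty with rfl | hS
  · simp
  obtain ⟨m, hm⟩ : ∃ m, S.card = m + 1 := ⟨S.card - 1, by have := hS.card_pos; omega⟩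
  -- The identity does not involve s or the columns, so it can be read off from one column with s =
  -- 0. By `bvec_one_column` the two sides of `lower_bvec` become (q;q)_{m+1} and the wanted sum
  -- times (q;q)_m.
  have h := congrFun (lower_bvec (s := 0) (hq := hq' 2 (by norm_num)) (a := 0) (L := 0) hu S)
    (Function.update 0 0 m)
  have hm0 : qPoch q q m ≠ 0 := by
    rw [qPoch, Finset.prod_ne_zero_iff]
    intro i _
    rw [← pow_succ']
    exact sub_ne_zero.2 (hq' _ (by omega)).symm
  have e := bvec_one_column (q := q) (s := 0) (hq := hq' 2 (by norm_num))
    (p := fun i : ι => (u i, 1)) S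
  rw [hm] at e
  rw [lower_apply] at h
  simp only [zero_add, Finset.sum_apply, Pi.smul_apply, smul_eq_mul, Function.update_self,
    Function.update_idem] at h e
  rw [e] at h
  have e2 : ∀ j ∈ S, bvec q 0 (hq' 2 (by norm_num)) 0 1 (fun i => (u i, 1)) (S.erase j)
      (Function.update 0 0 m) = qPoch q q m := by
    intro j hj
    have := bvec_one_column (q := q) (s := 0) (hq := hq' 2 (by norm_num))
      (p := fun i : ι => (u i, 1)) (S.erase j)
    rwa [Finset.card_erase_of_mem hj, hm, Nat.add_sub_cancel] at this
  rw [Finset.sum_congr rfl fun j hj => by rw [e2 j hj]] at h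
  rw [hm]
  refine mul_right_cancel₀ hm0 ?_
  rw [qPoch, Finset.prod_range_succ, ← qPoch, ← pow_succ', mul_comm] at h
  rw [h, Finset.mul_sum, Finset.sum_mul]
  simp

/-- Decomposition with respect to the subset of the paths that stop in the first column. -/
theorem bvec_first_column {u : ι → ℂ} (hu : Function.Injective u)
    (hq' : ∀ n, 0 < n → q ^ n ≠ 1) (U : Finset ι) (ν : ℕ → ℕ) :
    bvec q s hq a (L + 1) (fun i => (u i, 1)) U ν =
      ∑ S ∈ U.powersetCard (ν a), qPoch q q (ν a) * (∏ i ∈ S, (1 - s * u i) ^ L) *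
        (∏ i ∈ S, ∏ j ∈ U \ S, (q * u i - u j) / (u i - u j)) *
        ((∏ i ∈ U \ S, (u i - s)) *
          bvec q s hq (a + 1) L (fun i => (u i, 1)) (U \ S) (Function.update ν a 0)) := by
  -- The value at ν equals the value of the (ν a)-th power of `lower a` at ν with column a emptied;
  -- there `bvec_of_apply_eq_zero` strips the column.
  have h := congrFun (annihilate_pow_bethe (v := vacuum)
    (B := fun i => monodromy q s a (L + 1) (u i, 1) 1 0)
    (hB := fun i j => creation_commute q s hq a (L + 1) (u i, 1) (u j, 1)) q (lower a)
    (fun j i => (q * u j - u i) / (u j - u i)) (fun j => (1 - s * u j) ^ L)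
    (fun U => lower_bvec (hq := hq) hu U) (fun S => sum_prod_erase_div hu hq' S) (ν a) U)
    (Function.update ν a 0)
  rw [lower_pow_apply] at h
  simp only [Function.update_self, zero_add, Function.update_idem, Function.update_eq_self] at h
  rw [bvec, h]
  simp only [Finset.sum_apply, Pi.smul_apply, smul_eq_mul]
  refine Finset.sum_congr rfl fun S _ => ?_
  congr 1
  have := bvec_of_apply_eq_zero (q := q) (s := s) (hq := hq) (a := a) (L := L)
    (p := fun i => (u i, 1)) (U \ S) (ν := Function.update ν a 0) (by simp)
  simp only [mul_one] at this
  exact this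

/-- The action of the diagonal operator `D` on the off-shell vector. -/
theorem monodromy_one_one_bvec
    (hp : ∀ i j, i ≠ j → (p j).1 * (p i).2 - (p i).1 * (p j).2 ≠ 0) {k : ι} {U : Finset ι}
    (hk : k ∉ U) :
    monodromy q s a L (p k) 1 1 (bvec q s hq a L p U) =
      ((∏ j ∈ U, (q * ((p j).1 * (p k).2) - (p k).1 * (p j).2) /
        ((p j).1 * (p k).2 - (p k).1 * (p j).2)) * ((p k).1 - s * (p k).2) ^ L) •
          bvec q s hq a L p U +
      ∑ j ∈ U, ((1 - q) * ((p k).1 * (p j).2) / ((p j).1 * (p k).2 - (p k).1 * (p j).2) *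
        (∏ i ∈ U.erase j, (q * ((p i).1 * (p j).2) - (p j).1 * (p i).2) /
          ((p i).1 * (p j).2 - (p j).1 * (p i).2)) * ((p j).1 - s * (p j).2) ^ L) •
          bvec q s hq a L p (insert k (U.erase j)) := by
  refine exchange_bethe (fun k => monodromy q s a L (p k) 1 1)
    (fun k m => (q * ((p m).1 * (p k).2) - (p k).1 * (p m).2) /
      ((p m).1 * (p k).2 - (p k).1 * (p m).2))
    (fun k m => (1 - q) * ((p k).1 * (p m).2) / ((p m).1 * (p k).2 - (p k).1 * (p m).2))
    (fun j => ((p j).1 - s * (p j).2) ^ L) ?_ ?_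
    (fun k => monodromy_one_one_vacuum q s a L (p k)) U k hk
  · intro k m hkm
    have h := monodromy_one_one_mul q s a L (p k) (p m)
    have h1 := hp k m hkm
    refine smul_right_injective _ h1 ?_
    simp only [h, smul_add, smul_smul]
    congr 2 <;> field_simp
  · intro k m j hkm hmj hjk
    have h1 := hp k m hkm
    have h2 := hp m j hmj
    have h3 := hp j k hjk
    have h4 := hp k j hjk.symm
    have h5 := hp j m hmj.symm
    rw [div_mul_div_comm, div_mul_div_comm, div_mul_div_comm, div_add_div _ _ (mul_ne_zero h1 h4)
      (mul_ne_zero h1 h2), div_eq_div_iff (mul_ne_zero (mul_ne_zero h1 h4) (mul_ne_zero h1 h2))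
      (mul_ne_zero h4 h5)]
    ring

end Bethe

end HigherSpin

end

section

namespace HigherSpin

/-! ### Matrix elements of the monodromy -/

lemma monodromy_last (q s : ℂ) (a L : ℕ) (p : ℂ × ℂ) :
    monodromy q s a (L + 1) p = monodromy q s a L p * Matrix.of (siteOp q s (a + L) p) := by
  induction L generalizing a with
  | zero => simp [monodromy]
  | succ L ih =>
    rw [monodromy, ih, ← mul_assoc, monodromy, add_right_comm, add_assoc]

/-- Columns are split off on the right because `horiz` sums over the columns to the left, so
changing the last column does not affect the earlier horizontal occupations. -/
lemma monodromy_last_apply (q s : ℂ) (L : ℕ) (p : ℂ × ℂ) (i j : Fin 2) (f : StateFn)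
    (ν : ℕ → ℕ) :
    monodromy q s 0 (L + 1) p i j f ν =
      ∑ k, siteCoef q s p k j (ν L) * monodromy q s 0 L p i k f (shiftConf L k j ν) := by
  have hc : ∀ k, Commute (monodromy q s 0 L p i k) (siteOp q s L p k j) := fun k =>
    (commute_monodromy q s _ 0 L p i k fun d _ hd _ _ =>
      siteOp_commute q s (by omega) _ _ _ _ _ _).symm
  rw [monodromy_last, Matrix.mul_apply, LinearMap.sum_apply, Finset.sum_apply]
  refine Finset.sum_congr rfl fun k _ => ?_
  rw [Matrix.of_apply, zero_add, (hc k).eq, Module.End.mul_apply, siteOp_apply]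

open Classical in
/-- The indicator function of a configuration. -/
def delta (lam : ℕ → ℕ) : StateFn := fun ν => if lam = ν then 1 else 0

/-- The horizontal occupation numbers determined by the configurations below and above a row. -/
def horiz (h : ℤ) (lam ν : ℕ → ℕ) (x : ℕ) : ℤ :=
  h + ∑ y ∈ Finset.range x, ((lam y : ℤ) - (ν y : ℤ))

lemma horiz_succ (h : ℤ) (lam ν : ℕ → ℕ) (x : ℕ) :
    horiz h lam ν (x + 1) = horiz h lam ν x + (lam x - ν x) := by
  rw [horiz, horiz, Finset.sum_range_succ, add_assoc]

/-- The vertex weight in a homogeneous spectral parameter. -/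
def homWeight (q s : ℂ) (p : ℂ × ℂ) (i₁ : ℕ) (j₁ : ℤ) (i₂ : ℕ) (j₂ : ℤ) : ℂ :=
  if j₁ = 0 ∧ j₂ = 0 ∧ i₂ = i₁ then p.2 - s * q ^ i₁ * p.1
  else if j₁ = 0 ∧ j₂ = 1 ∧ i₁ = i₂ + 1 then (1 - s ^ 2 * q ^ i₂) * p.1
  else if j₁ = 1 ∧ j₂ = 1 ∧ i₂ = i₁ then p.1 - s * q ^ i₁ * p.2
  else if j₁ = 1 ∧ j₂ = 0 ∧ i₂ = i₁ + 1 then (1 - q ^ (i₁ + 1)) * p.2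
  else 0

-- Arrow conservation leaves at most one arrangement of horizontal arrows between two given
-- configurations, so a matrix element is a single product.
open Classical in
lemma monodromy_delta (q s : ℂ) (L : ℕ) (p : ℂ × ℂ) (i j : Fin 2) (lam ν : ℕ → ℕ) :
    monodromy q s 0 L p i j (delta lam) ν =
      if (∀ x, L ≤ x → lam x = ν x) ∧ horiz (i : ℕ) lam ν L = (j : ℕ) then
        ∏ x ∈ Finset.range L, homWeight q s p (lam x) (horiz (i : ℕ) lam ν x) (ν x)
          (horiz (i : ℕ) lam ν (x + 1))
      else 0 := by
  induction L generalizing j ν with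
  | zero =>
    simp only [monodromy, horiz, Finset.range_zero, Finset.sum_empty, Finset.prod_empty,
      Matrix.one_apply, add_zero, Nat.cast_inj, Fin.val_inj]
    by_cases hij : i = j <;> simp [hij, delta, funext_iff]
  | succ L ih =>
    have hh : ∀ k x, x ≤ L → horiz (i : ℕ) lam (shiftConf L k j ν) x = horiz (i : ℕ) lam ν x := by
      intro k x hx
      unfold horiz
      congr 1
      refine Finset.sum_congr rfl fun y hy => ?_
      rw [shiftConf, Function.update_of_ne (by have := Finset.mem_range.1 hy; omega)]
    have hprod : ∀ k, ∏ x ∈ Finset.range L, homWeight q s p (lam x)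
        (horiz (i : ℕ) lam (shiftConf L k j ν) x) (shiftConf L k j ν x)
        (horiz (i : ℕ) lam (shiftConf L k j ν) (x + 1)) =
        ∏ x ∈ Finset.range L, homWeight q s p (lam x) (horiz (i : ℕ) lam ν x) (ν x)
          (horiz (i : ℕ) lam ν (x + 1)) := by
      intro k
      refine Finset.prod_congr rfl fun x hx => ?_
      have hx' := Finset.mem_range.1 hx
      rw [hh k x hx'.le, hh k (x + 1) hx', shiftConf, Function.update_of_ne (by omega)]
    have hcond : ∀ k : Fin 2, (∀ x, L ≤ x → lam x = shiftConf L k j ν x) ↔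
        (lam L = ν L + j.val - k.val ∧ ∀ x, L + 1 ≤ x → lam x = ν x) := by
      intro k
      constructor
      · intro h
        refine ⟨by simpa [shiftConf] using h L le_rfl, fun x hx => ?_⟩
        rw [h x (by omega), shiftConf, Function.update_of_ne (by omega)]
      · rintro ⟨h1, h2⟩ x hx
        rcases eq_or_lt_of_le hx with rfl | hx
        · simpa [shiftConf] using h1
        · rw [shiftConf, Function.update_of_ne (by omega), h2 x hx]
    rw [monodromy_last_apply]
    simp only [ih, hh _ L le_rfl, hprod, hcond]
    rw [Finset.prod_range_succ, horiz_succ]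
    generalize ∏ x ∈ Finset.range L, homWeight q s p (lam x) (horiz (i : ℕ) lam ν x) (ν x)
          (horiz (i : ℕ) lam ν (x + 1)) = P
    generalize horiz (i : ℕ) lam ν L = e
    generalize lam L = g
    generalize (∀ x, L + 1 ≤ x → lam x = ν x) = Q
    by_cases hx : Q
    swap
    · simp [hx]
    simp only [hx, and_true, true_and, Fin.sum_univ_two]
    generalize ν L = m
    by_cases he0 : e = 0
    · subst he0
      by_cases hj : j = 0
      · subst hj
        by_cases hgm : g = m
        · subst hgm
          simp [homWeight, siteCoef, -mul_eq_mul_left_iff, -mul_eq_mul_right_iff]; ring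
        · have : (g : ℤ) - m ≠ 0 := by omega
          simp [hgm, this]
      · obtain rfl : j = 1 := by omega
        by_cases hgm : g = m + 1
        · subst hgm
          simp [homWeight, siteCoef, -mul_eq_mul_left_iff, -mul_eq_mul_right_iff]; ring
        · have : (g : ℤ) - m ≠ 1 := by omega
          simp [hgm, this]
    by_cases he1 : e = 1
    · subst he1
      by_cases hj : j = 0
      · subst hj
        by_cases hgm : m = g + 1
        · subst hgm
          simp [homWeight, siteCoef, -mul_eq_mul_left_iff, -mul_eq_mul_right_iff]; ring
        · have h1 : (1 : ℤ) + (g - m) ≠ 0 := by omega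
          rcases Nat.eq_zero_or_pos m with rfl | hm
          · have h2 : (1 : ℤ) + g ≠ 0 := by omega
            simp [h2, siteCoef]
          · have h2 : g ≠ m - 1 := by omega
            simp [h1, h2]
      · obtain rfl : j = 1 := by omega
        by_cases hgm : g = m
        · subst hgm
          simp [homWeight, siteCoef, -mul_eq_mul_left_iff, -mul_eq_mul_right_iff]; ring
        · have : (1 : ℤ) + (g - m) ≠ 1 := by omega
          simp [hgm, this]
    · simp [he0, he1, homWeight]

/-! ### Signatures and configurations -/

lemma mult_comp_equiv {k : ℕ} (f : Fin k → ℕ) (e : Equiv.Perm (Fin k)) (x : ℕ) :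
    (Finset.univ.filter (fun i => f (e i) = x)).card =
      (Finset.univ.filter (fun i => f i = x)).card := by
  refine Finset.card_equiv e fun i => by simp

/-- Equal multiplicities give a permutation carrying one sequence to the other, and a weakly
decreasing rearrangement is unique. -/
lemma mult_injective {k : ℕ} : Function.Injective (mult : Signature k → ℕ → ℕ) := by
  intro μ κ h
  have e : ∀ c : ℕ, { i : Fin k // κ.1 i = c } ≃ { i : Fin k // μ.1 i = c } := fun c =>
    Fintype.equivOfCardEq (by
      have := congrFun h c
      simp only [mult] at this
      rw [Fintype.card_subtype, Fintype.card_subtype, this])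
  have hσ : ∀ i, μ.1 (Equiv.ofFiberEquiv e i) = κ.1 i := fun i => Equiv.ofFiberEquiv_map e i
  have h1 : Monotone ((OrderDual.toDual ∘ μ.1) ∘ (Equiv.refl (Fin k))) := fun i j hij => μ.2 hij
  have h2 : Monotone ((OrderDual.toDual ∘ μ.1) ∘ (Equiv.ofFiberEquiv e)) := by
    intro i j hij
    simp only [Function.comp_apply, hσ]
    exact κ.2 hij
  have h3 := Tuple.unique_monotone h1 h2
  ext i
  have h4 := congrFun h3 i
  simp only [Function.comp_apply, Equiv.refl_apply, hσ] at h4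
  exact OrderDual.toDual_inj.1 h4

lemma exists_signature {k L : ℕ} (ν : ℕ → ℕ) (h0 : ∀ x, L ≤ x → ν x = 0)
    (hs : ∑ x ∈ Finset.range L, ν x = k) :
    ∃ μ : Signature k, mult μ = ν ∧ ∀ i, μ.1 i < L := by
  have hcard : Fintype.card (Σ x : Fin L, Fin (ν x)) = k := by
    rw [Fintype.card_sigma, ← hs, Finset.sum_range]
    simp
  let e : Fin k ≃ (Σ x : Fin L, Fin (ν x)) := (Fintype.equivFinOfCardEq hcard).symm
  let f : Fin k → ℕ := fun i => (e i).1
  have hf : ∀ x, (Finset.univ.filter (fun i => f i = x)).card = ν x := by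
    intro x
    by_cases hx : x < L
    · rw [← Fintype.card_fin (ν x), ← Finset.card_univ]
      symm
      refine Finset.card_bij (fun i _ => e.symm ⟨⟨x, hx⟩, i⟩) ?_ ?_ ?_
      · intro i _
        simp [f]
      · intro i _ j _ hij
        simpa using hij
      · intro i hi
        simp only [Finset.mem_filter, Finset.mem_univ, true_and, f] at hi
        subst hi
        exact ⟨(e i).2, Finset.mem_univ _, by simp⟩
    · rw [h0 x (by omega), Finset.card_eq_zero, Finset.filter_eq_empty_iff]
      intro i _ hi
      exact hx (hi ▸ (e i).1.2)
  refine ⟨⟨fun i => f (Tuple.sort (OrderDual.toDual ∘ f) i), fun i j hij =>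
    Tuple.monotone_sort (OrderDual.toDual ∘ f) hij⟩, ?_, fun i => (e _).1.2⟩
  ext x
  rw [mult, ← hf x]
  exact mult_comp_equiv f _ x

lemma finite_signature_lt (k L : ℕ) : {μ : Signature k | ∀ i, μ.1 i < L}.Finite := by
  have h : (Set.univ.pi fun _ : Fin k => Set.Iio L).Finite :=
    Set.Finite.pi fun _ => Set.finite_Iio L
  refine (h.preimage (f := Subtype.val) Subtype.val_injective.injOn).subset fun μ hμ => ?_
  simpa using hμ

/-- The signatures with all parts smaller than `L`. -/
def signaturesLT (k L : ℕ) : Finset (Signature k) := (finite_signature_lt k L).toFinset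

@[simp] lemma mem_signaturesLT {k L : ℕ} {μ : Signature k} :
    μ ∈ signaturesLT k L ↔ ∀ i, μ.1 i < L := by
  simp [signaturesLT]

lemma mult_eq_zero {k L : ℕ} {μ : Signature k} (h : ∀ i, μ.1 i < L) {x : ℕ} (hx : L ≤ x) :
    mult μ x = 0 := by
  rw [mult, Finset.card_eq_zero, Finset.filter_eq_empty_iff]
  intro i _ hi
  have := h i
  omega

lemma sum_mult {k : ℕ} (μ : Signature k) (L : ℕ) :
    ∑ x ∈ Finset.range L, mult μ x = (Finset.univ.filter (fun i => μ.1 i < L)).card := by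
  simp only [mult]
  rw [Finset.card_eq_sum_card_fiberwise (f := μ.1) (t := Finset.range L)]
  · refine Finset.sum_congr rfl fun x hx => ?_
    rw [Finset.filter_filter]
    congr 1
    ext i
    have := Finset.mem_range.1 hx
    simp only [Finset.mem_filter, Finset.mem_univ, true_and]
    constructor
    · intro h; exact ⟨by omega, h⟩
    · exact fun h => h.2
  · intro i hi
    simpa using hi

lemma sum_mult_of_lt {k L : ℕ} {μ : Signature k} (h : ∀ i, μ.1 i < L) :
    ∑ x ∈ Finset.range L, mult μ x = k := by
  rw [sum_mult, Finset.filter_true_of_mem (fun i _ => h i)]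
  simp

lemma horizontal_eq_horiz {M N : ℕ} (h : ℕ) (lam : Signature M) (mu : Signature N) (x : ℕ) :
    horizontal h lam mu x = horiz h (mult lam) (mult mu) x := rfl

lemma horiz_mult {M N L : ℕ} (h : ℤ) {lam : Signature M} {mu : Signature N}
    (hl : ∀ i, lam.1 i < L) (hm : ∀ i, mu.1 i < L) :
    horiz h (mult lam) (mult mu) L = h + (M - N) := by
  rw [horiz, Finset.sum_sub_distrib]
  congr 2
  · exact_mod_cast sum_mult_of_lt hl
  · exact_mod_cast sum_mult_of_lt hm

/-- A row as a finite product. -/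
lemma rowWeight_eq_prod {q s u : ℂ} (hu : 1 - s * u ≠ 0) {h M N L : ℕ} (hMN : h + M = N)
    {lam : Signature M} {mu : Signature N} (hl : ∀ i, lam.1 i < L) (hm : ∀ i, mu.1 i < L) :
    rowWeight q s u h lam mu = ∏ x ∈ Finset.range L, vertexWeight q s u (mult lam x)
      (horiz h (mult lam) (mult mu) x) (mult mu x) (horiz h (mult lam) (mult mu) (x + 1)) := by
  rw [rowWeight]
  refine finprod_eq_prod_of_mulSupport_subset _ fun x hx => ?_
  by_contra hx'
  refine hx ?_
  have hx'' : L ≤ x := by simpa using hx'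
  have e : ∀ y, L ≤ y → horiz h (mult lam) (mult mu) y = 0 := by
    intro y hy
    rw [horiz_mult (L := y) _ (fun i => (hl i).trans_le hy) (fun i => (hm i).trans_le hy)]
    omega
  simp only [horizontal_eq_horiz]
  rw [e x hx'', e (x + 1) (by omega), mult_eq_zero hl hx'', mult_eq_zero hm hx'']
  simp [vertexWeight, div_self hu]

/-- A row cannot move paths to the left. -/
lemma rowWeight_eq_zero {q s u : ℂ} (hu : 1 - s * u ≠ 0) {h M N L : ℕ} (hMN : h + M = N)
    {lam : Signature M} {mu : Signature N} (hl : ¬ ∀ i, lam.1 i < L) (hm : ∀ i, mu.1 i < L) :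
    rowWeight q s u h lam mu = 0 := by
  obtain ⟨L', hL'⟩ : ∃ L', ∀ i, lam.1 i < L' :=
    ⟨∑ i, lam.1 i + 1, fun i => Nat.lt_succ_of_le
      (Finset.single_le_sum (fun _ _ => Nat.zero_le _) (Finset.mem_univ i))⟩
  have hLL : L < L' := by
    push Not at hl
    obtain ⟨i, hi⟩ := hl
    exact hi.trans_lt (hL' i)
  rw [rowWeight_eq_prod hu hMN hL' (fun i => (hm i).trans hLL)]
  refine Finset.prod_eq_zero (Finset.mem_range.2 hLL) ?_
  -- All h + M paths have left upwards before column L, while fewer than M of them entered from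
  -- below there. The edge into column L would carry a negative number of paths.
  have h1 : horiz h (mult lam) (mult mu) L < 0 := by
    have h2 : ∑ x ∈ Finset.range L, mult lam x < M := by
      rw [sum_mult]
      conv_rhs => rw [← Fintype.card_fin M, ← Finset.card_univ]
      refine Finset.card_lt_card (Finset.filter_ssubset.2 ?_)
      push Not at hl ⊢
      obtain ⟨i, hi⟩ := hl
      exact ⟨i, Finset.mem_univ _, hi⟩
    have h3 := sum_mult_of_lt hm
    rw [horiz, Finset.sum_sub_distrib]
    zify at h2 h3
    omega
  have h2 : horiz h (mult lam) (mult mu) L ≠ 0 := h1.ne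
  have h3 : horiz h (mult lam) (mult mu) L ≠ 1 := by omega
  simp [vertexWeight, h2, h3]

end HigherSpin

end

section

namespace HigherSpin

/-! ### The functions `F` and `G` as matrix elements -/

lemma bvec_map {ι κ : Type*} [DecidableEq ι] [DecidableEq κ] {q s : ℂ} {hq : q ^ 2 ≠ 1} {a L : ℕ}
    (p : κ → ℂ × ℂ) (e : ι ↪ κ) (U : Finset ι) :
    bvec q s hq a L p (U.map e) = bvec q s hq a L (fun i => p (e i)) U := by
  induction U using Finset.induction_on with
  | empty => simp
  | insert k U hk ih =>
    rw [Finset.map_insert, bvec_insert (by simpa using hk), bvec_insert hk, ih]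

lemma bvec_univ_succ {q s : ℂ} {hq : q ^ 2 ≠ 1} {a L n : ℕ} (p : Fin (n + 1) → ℂ × ℂ) :
    bvec q s hq a L p Finset.univ = monodromy q s a L (p (Fin.last n)) 1 0
      (bvec q s hq a L (fun i : Fin n => p i.castSucc) Finset.univ) := by
  have h : (Finset.univ : Finset (Fin (n + 1))) =
      insert (Fin.last n) (Finset.univ.map Fin.castSuccEmb) := by
    rw [Fin.univ_castSuccEmb, Finset.cons_eq_insert]
  rw [h, bvec_insert (by simp), bvec_map]
  rfl

lemma homWeight_affine {q s u : ℂ} (hu : 1 - s * u ≠ 0) (i₁ : ℕ) (j₁ : ℤ) (i₂ : ℕ) (j₂ : ℤ) :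
    homWeight q s (u, 1) i₁ j₁ i₂ j₂ = (1 - s * u) * vertexWeight q s u i₁ j₁ i₂ j₂ := by
  unfold homWeight vertexWeight
  split_ifs
  · rw [mul_div_cancel₀ _ hu]
  · rw [mul_div_cancel₀ _ hu]
  · rw [mul_div_cancel₀ _ hu]; ring
  · rw [mul_div_cancel₀ _ hu]; ring
  · simp

lemma monodromy_creation_delta {q s u : ℂ} (hu : 1 - s * u ≠ 0) {n L : ℕ} {κ : Signature n}
    {μ : Signature (n + 1)} (hκ : ∀ i, κ.1 i < L) (hμ : ∀ i, μ.1 i < L) :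
    monodromy q s 0 L (u, 1) 1 0 (delta (mult κ)) (mult μ) =
      (1 - s * u) ^ L * rowWeight q s u 1 κ μ := by
  rw [monodromy_delta, if_pos, rowWeight_eq_prod hu (add_comm 1 n) hκ hμ]
  · simp only [homWeight_affine hu, Finset.prod_mul_distrib, Finset.prod_const, Finset.card_range]
    rfl
  · refine ⟨fun x hx => by rw [mult_eq_zero hκ hx, mult_eq_zero hμ hx], ?_⟩
    rw [horiz_mult _ hκ hμ]
    push_cast
    simp

lemma sum_smul_delta_apply {n : ℕ} (Λ : Finset (Signature n)) (c : Signature n → ℂ)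
    {μ : Signature n} (hμ : μ ∈ Λ) : (∑ κ ∈ Λ, c κ • delta (mult κ)) (mult μ) = c μ := by
  rw [Finset.sum_apply, Finset.sum_eq_single_of_mem μ hμ]
  · simp [delta]
  · intro κ _ hκ
    have : mult κ ≠ mult μ := fun h => hκ (mult_injective h)
    simp [delta, this]

lemma funF_succ {q s : ℂ} {n L : ℕ} {u : Fin (n + 1) → ℂ} (hu : 1 - s * u (Fin.last n) ≠ 0)
    {μ : Signature (n + 1)} (hμ : ∀ i, μ.1 i < L) :
    funF q s (n + 1) μ u = ∑ κ ∈ signaturesLT n L,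
      funF q s n κ (Fin.init u) * rowWeight q s (u (Fin.last n)) 1 κ μ := by
  rw [funF]
  refine finsum_eq_sum_of_support_subset _ fun κ hκ => ?_
  by_contra h
  refine hκ ?_
  rw [Finset.mem_coe, mem_signaturesLT] at h
  simp only
  rw [rowWeight_eq_zero hu (add_comm 1 n) h hμ, mul_zero]

/-- The off-shell vector in the basis of configurations. -/
theorem bvec_eq_sum_funF {q s : ℂ} {hq : q ^ 2 ≠ 1} (L : ℕ) {n : ℕ} {u : Fin n → ℂ}
    (hu : ∀ i, 1 - s * u i ≠ 0) :
    bvec q s hq 0 L (fun i => (u i, 1)) Finset.univ =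
      ∑ κ ∈ signaturesLT n L, ((∏ i, (1 - s * u i) ^ L) * funF q s n κ u) • delta (mult κ) := by
  induction n with
  | zero =>
    have h : ∀ κ : Signature 0, κ = zeroSignature 0 := fun κ => Subtype.ext (Subsingleton.elim _ _)
    have h' : signaturesLT 0 L = {zeroSignature 0} := by
      ext κ
      simp [h κ]
    have h0 : mult (zeroSignature 0) = 0 := by
      ext x
      simp [mult]
    rw [h', Finset.sum_singleton, h0, Finset.univ_eq_empty, bvec_empty]
    ext ν
    by_cases hν : ν = 0
    · simp [funF, delta, vacuum, hν]
    · have hν' : ¬ 0 = ν := fun h => hν h.symm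
      simp [delta, vacuum, hν, hν']
  | succ n ih =>
    rw [bvec_univ_succ, ih (u := fun i => u i.castSucc) fun i => hu _]
    ext ν
    simp only [map_sum, map_smul]
    by_cases hν : ∃ μ : Signature (n + 1), mult μ = ν ∧ ∀ i, μ.1 i < L
    · obtain ⟨μ, rfl, hμ⟩ := hν
      rw [sum_smul_delta_apply _ _ (by simpa using hμ), funF_succ (hu _) hμ, Finset.sum_apply,
        Finset.mul_sum]
      refine Finset.sum_congr rfl fun κ hκ => ?_
      rw [Pi.smul_apply, monodromy_creation_delta (hu _) (by simpa using hκ) hμ,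
        Fin.prod_univ_castSucc, smul_eq_mul]
      change (∏ i : Fin n, (1 - s * u i.castSucc) ^ L) * funF q s n κ (Fin.init u) * _ = _
      ring
    · rw [Finset.sum_apply, Finset.sum_apply, Finset.sum_eq_zero, Finset.sum_eq_zero]
      · intro μ hμ
        have : mult μ ≠ ν := fun h => hν ⟨μ, h, by simpa using hμ⟩
        simp [delta, this]
      · intro κ hκ
        have hκ' : ∀ i, κ.1 i < L := by simpa using hκ
        rw [Pi.smul_apply, monodromy_delta, if_neg, smul_zero]
        rintro ⟨h1, h2⟩
        refine hν (exists_signature (L := L) ν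
          (fun x hx => by rw [← h1 x hx, mult_eq_zero hκ' hx]) ?_)
        have h3 := sum_mult_of_lt hκ'
        rw [horiz, Finset.sum_sub_distrib] at h2
        zify at h3 ⊢
        rw [h3] at h2
        simp at h2
        linarith

lemma bvec_mult {q s : ℂ} {hq : q ^ 2 ≠ 1} {L n : ℕ} {u : Fin n → ℂ}
    (hu : ∀ i, 1 - s * u i ≠ 0) {κ : Signature n} (hκ : ∀ i, κ.1 i < L) :
    bvec q s hq 0 L (fun i => (u i, 1)) Finset.univ (mult κ) =
      (∏ i, (1 - s * u i) ^ L) * funF q s n κ u := by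
  rw [bvec_eq_sum_funF L hu, sum_smul_delta_apply _ _ (by simpa using hκ)]

/-- The conjugating factor of a single column. -/
def cColumn (q s : ℂ) (g : ℕ) : ℂ := qPoch q (s ^ 2) g / qPoch q q g

lemma cColumn_succ {q s : ℂ} {g : ℕ} (hq : q ^ (g + 1) ≠ 1) :
    cColumn q s (g + 1) * (1 - q ^ (g + 1)) = cColumn q s g * (1 - s ^ 2 * q ^ g) := by
  have h : 1 - q ^ (g + 1) ≠ 0 := sub_ne_zero.2 hq.symm
  have h' : 1 - q * q ^ g ≠ 0 := by rwa [← pow_succ']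
  simp only [cColumn, qPoch, Finset.prod_range_succ]
  rw [mul_div_mul_comm, pow_succ' q g, mul_assoc, div_mul_cancel₀ _ h']

lemma cFactor_eq_prod (q s : ℂ) {n L : ℕ} {κ : Signature n} (hκ : ∀ i, κ.1 i < L) :
    cFactor q s κ = ∏ x ∈ Finset.range L, cColumn q s (mult κ x) := by
  rw [cFactor]
  refine finprod_eq_prod_of_mulSupport_subset _ fun x hx => ?_
  by_contra hx'
  refine hx ?_
  have hx'' : L ≤ x := by simpa using hx'
  simp [mult_eq_zero hκ hx'', qPoch]

/-- Turning a vertex upside down. -/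
lemma homWeight_dual {q s v : ℂ} (hv : 1 - s * v ≠ 0) (hq : ∀ n, 0 < n → q ^ n ≠ 1)
    (i₁ : ℕ) (j₁ : ℤ) (i₂ : ℕ) (j₂ : ℤ) :
    homWeight q s (1, v) i₂ (1 - j₁) i₁ (1 - j₂) * cColumn q s i₁ =
      (1 - s * v) * (vertexWeight q s v i₁ j₁ i₂ j₂ * cColumn q s i₂) := by
  have hv' : 1 - v * s ≠ 0 := by rwa [mul_comm]
  by_cases h1 : j₁ = 0
  · subst h1
    by_cases h2 : j₂ = 0
    · subst h2
      by_cases h3 : i₂ = i₁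
      · subst h3
        simp only [homWeight, vertexWeight]
        norm_num
        field_simp
      · have h3' : ¬ i₁ = i₂ := fun h => h3 h.symm
        simp [homWeight, vertexWeight, h3, h3']
    by_cases h2' : j₂ = 1
    · subst h2'
      by_cases h3 : i₁ = i₂ + 1
      · subst h3
        have := cColumn_succ (s := s) (hq (i₂ + 1) (by omega))
        simp only [homWeight, vertexWeight]
        norm_num
        field_simp
        linear_combination v * this
      · simp [homWeight, vertexWeight, h3]
    · have h2'' : (1 : ℤ) - j₂ ≠ 0 := by omega
      simp [homWeight, vertexWeight, h2, h2', h2'']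
  by_cases h1' : j₁ = 1
  · subst h1'
    by_cases h2 : j₂ = 0
    · subst h2
      by_cases h3 : i₂ = i₁ + 1
      · subst h3
        have := cColumn_succ (s := s) (hq (i₁ + 1) (by omega))
        simp only [homWeight, vertexWeight]
        norm_num
        field_simp
        linear_combination -this
      · simp [homWeight, vertexWeight, h3]
    by_cases h2' : j₂ = 1
    · subst h2'
      by_cases h3 : i₂ = i₁
      · subst h3
        simp only [homWeight, vertexWeight]
        norm_num
        field_simp
      · have h3' : ¬ i₁ = i₂ := fun h => h3 h.symm
        simp [homWeight, vertexWeight, h3, h3']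
    · have h2'' : (1 : ℤ) - j₂ ≠ 0 := by omega
      have h2''' : (1 : ℤ) - j₂ ≠ 1 := by omega
      simp [homWeight, vertexWeight, h2, h2', h2'']
  · have h1'' : (1 : ℤ) - j₁ ≠ 0 := by omega
    have h1''' : (1 : ℤ) - j₁ ≠ 1 := by omega
    simp [homWeight, vertexWeight, h1, h1', h1'']

/-- Complementing the horizontal arrows turns a row without incoming or outgoing horizontal path
into one where a path enters and leaves, with κ and ρ exchanged as bottom and top. `homWeight_dual`
then applies column by column. -/
lemma monodromy_one_one_delta {q s v : ℂ} (hv : 1 - s * v ≠ 0) (hq : ∀ n, 0 < n → q ^ n ≠ 1)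
    {n L : ℕ} {κ ρ : Signature n} (hκ : ∀ i, κ.1 i < L) (hρ : ∀ i, ρ.1 i < L) :
    cFactor q s κ * monodromy q s 0 L (1, v) 1 1 (delta (mult ρ)) (mult κ) =
      (1 - s * v) ^ L * (rowWeight q s v 0 κ ρ * cFactor q s ρ) := by
  have hh : ∀ x, horiz ((1 : Fin 2) : ℕ) (mult ρ) (mult κ) x =
      1 - horiz (0 : ℕ) (mult κ) (mult ρ) x := by
    intro x
    simp only [horiz, Finset.sum_sub_distrib]
    push_cast
    simp
    ring
  rw [monodromy_delta, if_pos, rowWeight_eq_prod hv (zero_add n) hκ hρ, cFactor_eq_prod q s hκ,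
    cFactor_eq_prod q s hρ, ← Finset.prod_mul_distrib, ← Finset.prod_mul_distrib]
  · have hc : (1 - s * v) ^ L = ∏ _x ∈ Finset.range L, (1 - s * v) := by simp
    rw [hc, ← Finset.prod_mul_distrib]
    refine Finset.prod_congr rfl fun x _ => ?_
    rw [hh, hh, mul_comm, homWeight_dual hv hq]
  · refine ⟨fun x hx => by rw [mult_eq_zero hκ hx, mult_eq_zero hρ hx], ?_⟩
    rw [horiz_mult _ hρ hκ]
    simp

/-- The diagonal operator acts on the off-shell vector by a row of the function `G`. -/
theorem monodromy_one_one_bvec_mult {q s v : ℂ} {hq : q ^ 2 ≠ 1} (hv : 1 - s * v ≠ 0)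
    (hq' : ∀ n, 0 < n → q ^ n ≠ 1) {L n : ℕ} {u : Fin n → ℂ} (hu : ∀ i, 1 - s * u i ≠ 0)
    {κ : Signature n} (hκ : ∀ i, κ.1 i < L) :
    cFactor q s κ * monodromy q s 0 L (1, v) 1 1
      (bvec q s hq 0 L (fun i => (u i, 1)) Finset.univ) (mult κ) =
    (1 - s * v) ^ L * ∑ ρ ∈ signaturesLT n L, rowWeight q s v 0 κ ρ *
      (cFactor q s ρ * ((∏ i, (1 - s * u i) ^ L) * funF q s n ρ u)) := by
  rw [bvec_eq_sum_funF L hu]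
  simp only [map_sum, map_smul, Finset.sum_apply, Pi.smul_apply, smul_eq_mul, Finset.mul_sum]
  refine Finset.sum_congr rfl fun ρ hρ => ?_
  have h := monodromy_one_one_delta hv hq' hκ (ρ := ρ) (by simpa using hρ)
  linear_combination ((∏ i, (1 - s * u i) ^ L) * funF q s n ρ u) * h

/-- The Bethe vector on one column is evaluated in two ways, by `bvec_mult` and by
`bvec_one_column`. -/
lemma funF_zeroSignature {q s : ℂ} (hq : q ^ 2 ≠ 1) {n : ℕ} {u : Fin n → ℂ}
    (hu : ∀ i, 1 - s * u i ≠ 0) :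
    funF q s n (zeroSignature n) u = qPoch q q n / ∏ i, (1 - s * u i) := by
  have h0 : mult (zeroSignature n) = 
      Function.update (0 : ℕ → ℕ) 0 (Finset.univ : Finset (Fin n)).card := by
    ext x
    rcases x with _ | x <;> simp [mult, zeroSignature]
  have h := bvec_mult (hq := hq) (q := q) (s := s) (L := 1) hu (κ := zeroSignature n)
    (by simp [zeroSignature])
  have h1 := bvec_one_column (q := q) (s := s) (hq := hq) (p := fun i : Fin n => (u i, 1))
    Finset.univ
  simp only at h1
  rw [h0, h1] at h
  have h2 : (∏ i, (1 - s * u i)) ≠ 0 := Finset.prod_ne_zero_iff.2 fun i _ => hu i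
  rw [eq_div_iff h2]
  simp only [pow_one, Finset.card_univ, Fintype.card_fin] at h
  rw [h, mul_comm]

/-! ### Recursion for `G` from the bottom row -/

lemma skewG_succ {q s : ℂ} {k N L : ℕ} {v : Fin (N + 1) → ℂ} (hv : ∀ i, 1 - s * v i ≠ 0)
    {μ κ : Signature k} (hμ : ∀ i, μ.1 i < L) :
    skewG q s (N + 1) μ κ v = ∑ ρ ∈ signaturesLT k L,
      skewG q s N ρ κ (Fin.init v) * rowWeight q s (v (Fin.last N)) 0 ρ μ := by
  rw [skewG]
  refine finsum_eq_sum_of_support_subset _ fun ρ hρ => ?_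
  by_contra h
  refine hρ ?_
  rw [Finset.mem_coe, mem_signaturesLT] at h
  simp only
  rw [rowWeight_eq_zero (hv _) (zero_add k) h hμ, mul_zero]

/-- Branching of `G` with respect to the bottom row. -/
theorem skewG_succ_bottom {q s : ℂ} {k N L : ℕ} {v : Fin (N + 1) → ℂ}
    (hv : ∀ i, 1 - s * v i ≠ 0) {μ κ : Signature k} (hμ : ∀ i, μ.1 i < L) :
    skewG q s (N + 1) μ κ v = ∑ ρ ∈ signaturesLT k L,
      rowWeight q s (v 0) 0 κ ρ * skewG q s N μ ρ (Fin.tail v) := by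
  induction N generalizing μ with
  | zero =>
    rw [skewG_succ hv hμ]
    simp only [skewG, ite_mul, one_mul, zero_mul, mul_ite, mul_one, mul_zero]
    rw [Finset.sum_ite_eq', Finset.sum_ite_eq]
    by_cases hκ : ∀ i, κ.1 i < L
    · rw [if_pos (by simpa using hκ), if_pos (by simpa using hμ)]
      rfl
    · rw [if_neg (by simpa using hκ), if_pos (by simpa using hμ),
        rowWeight_eq_zero (hv _) (zero_add k) hκ hμ]
  | succ N ih =>
    rw [skewG_succ hv hμ]
    have e1 : ∀ ρ ∈ signaturesLT k L, skewG q s (N + 1) ρ κ (Fin.init v) *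
        rowWeight q s (v (Fin.last (N + 1))) 0 ρ μ =
        ∑ ρ' ∈ signaturesLT k L, rowWeight q s (v 0) 0 κ ρ' *
          (skewG q s N ρ ρ' (Fin.init (Fin.tail v)) *
            rowWeight q s (v (Fin.last (N + 1))) 0 ρ μ) := by
      intro ρ hρ
      rw [ih (v := Fin.init v) (fun i => hv _) (by simpa using hρ), Finset.sum_mul]
      refine Finset.sum_congr rfl fun ρ' _ => ?_
      rw [mul_assoc]
      rfl
    rw [Finset.sum_congr rfl e1, Finset.sum_comm]
    refine Finset.sum_congr rfl fun ρ' _ => ?_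
    rw [← Finset.mul_sum, skewG_succ (v := Fin.tail v) (fun i => hv _) hμ]
    rfl

end HigherSpin

end

section

namespace HigherSpin

open MeasureTheory Set

/-! ### Contour integrals -/

section Contour

variable {γ : ℝ → ℂ}

lemma IsPositiveContour.exists_partition (h : IsPositiveContour γ) :
    ∃ (n : ℕ) (a : ℕ → ℝ), a 0 = 0 ∧ a n = 1 ∧ (∀ k < n, a k < a (k + 1)) ∧
      ∀ k < n, ContDiffOn ℝ 1 γ (Icc (a k) (a (k + 1))) := by
  obtain ⟨n, t, ht, h0, h1, hd⟩ := h.piecewise_smooth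
  have e : ∀ k (hk : k < n), t ⟨min k n, by omega⟩ = t (Fin.castSucc ⟨k, hk⟩) := fun k hk => by
    congr 1; ext; simp [hk.le]
  have e' : ∀ k (hk : k < n), t ⟨min (k + 1) n, by omega⟩ = t (Fin.succ ⟨k, hk⟩) := fun k hk => by
    congr 1; ext; simp; omega
  refine ⟨n, fun k => t ⟨min k n, by omega⟩, ?_, ?_, fun k hk => ?_, fun k hk => ?_⟩
  · rw [← h0]; congr 1
  · have e : (⟨min n n, by omega⟩ : Fin (n + 1)) = Fin.last n := Fin.ext (min_self n)
    simp only [e, h1]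
  · simp only
    rw [e k hk, e' k hk]
    exact ht (Fin.castSucc_lt_succ)
  · simp only
    rw [e k hk, e' k hk]
    exact hd ⟨k, hk⟩

lemma IsPositiveContour.continuousOn (h : IsPositiveContour γ) : ContinuousOn γ (Icc 0 1) := by
  obtain ⟨n, a, h0, h1, hlt, hd⟩ := h.exists_partition
  have hle : ∀ k ≤ n, a 0 ≤ a k := by
    intro k hk
    induction k with
    | zero => exact le_rfl
    | succ k ih => exact (ih (by omega)).trans (hlt k (by omega)).le
  have key : ∀ k ≤ n, ContinuousOn γ (Icc (a 0) (a k)) := by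
    intro k hk
    induction k with
    | zero => simp
    | succ k ih =>
      rw [← Icc_union_Icc_eq_Icc (hle k (by omega)) (hlt k (by omega)).le]
      exact (ih (by omega)).union_of_isClosed (hd k (by omega)).continuousOn isClosed_Icc
        isClosed_Icc
  have := key n le_rfl
  rwa [h0, h1] at this

lemma IsPositiveContour.intervalIntegrable_deriv (h : IsPositiveContour γ) :
    IntervalIntegrable (deriv γ) volume 0 1 := by
  obtain ⟨n, a, h0, h1, hlt, hd⟩ := h.exists_partition
  rw [← h0, ← h1]
  refine IntervalIntegrable.trans_iterate fun k hk => ?_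
  have hc : ContinuousOn (derivWithin γ (Icc (a k) (a (k + 1)))) (Icc (a k) (a (k + 1))) :=
    (hd k hk).continuousOn_derivWithin (uniqueDiffOn_Icc (hlt k hk)) le_rfl
  rw [← uIcc_of_le (hlt k hk).le] at hc
  refine hc.intervalIntegrable.congr_uIoo fun x hx => ?_
  rw [uIoo_of_le (hlt k hk).le] at hx
  rw [uIcc_of_le (hlt k hk).le]
  exact derivWithin_of_mem_nhds (Icc_mem_nhds hx.1 hx.2)

lemma IsPositiveContour.exists_countable (h : IsPositiveContour γ) :
    ∃ S : Set ℝ, S.Countable ∧ ∀ t ∈ Ioo (0 : ℝ) 1 \ S, HasDerivAt γ (deriv γ t) t := by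
  obtain ⟨n, a, h0, h1, hlt, hd⟩ := h.exists_partition
  refine ⟨range a, countable_range a, fun t ht => ?_⟩
  have hex : ∀ k ≤ n, t < a k → ∃ j < n, t ∈ Ioo (a j) (a (j + 1)) := by
    intro k hk htk
    induction k with
    | zero => rw [h0] at htk; exact absurd ht.1.1 (not_lt.2 htk.le)
    | succ k ih =>
      rcases lt_trichotomy t (a k) with h | h | h
      · exact ih (by omega) h
      · exact absurd ⟨k, h.symm⟩ ht.2
      · exact ⟨k, by omega, h, htk⟩
  obtain ⟨j, hj, hjt⟩ := hex n le_rfl (h1 ▸ ht.1.2)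
  exact (((hd j hj).differentiableOn one_ne_zero) t ⟨hjt.1.le, hjt.2.le⟩).differentiableAt
    (Icc_mem_nhds hjt.1 hjt.2) |>.hasDerivAt

lemma mem_trace {t : ℝ} (ht : t ∈ Icc (0 : ℝ) 1) : γ t ∈ trace γ := mem_image_of_mem _ ht

lemma IsPositiveContour.isCompact_trace (h : IsPositiveContour γ) : IsCompact (trace γ) :=
  isCompact_Icc.image_of_continuousOn h.continuousOn

lemma IsPositiveContour.isPreconnected_trace (h : IsPositiveContour γ) :
    IsPreconnected (trace γ) :=
  isPreconnected_Icc.image _ h.continuousOn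

lemma trace_nonempty : (trace γ).Nonempty := ⟨γ 0, mem_trace (by simp)⟩

lemma IsPositiveContour.intervalIntegrable (h : IsPositiveContour γ) {f : ℂ → ℂ}
    (hf : ContinuousOn f (trace γ)) :
    IntervalIntegrable (fun t => f (γ t) * deriv γ t) volume 0 1 := by
  refine h.intervalIntegrable_deriv.continuousOn_mul ?_
  rw [uIcc_of_le zero_le_one]
  exact hf.comp h.continuousOn fun t ht => mem_trace ht

lemma contourIntegral_congr {f g : ℂ → ℂ} (hfg : ∀ w ∈ trace γ, f w = g w) :
    contourIntegral γ f = contourIntegral γ g := by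
  rw [contourIntegral, contourIntegral]
  congr 1
  refine intervalIntegral.integral_congr fun t ht => ?_
  rw [uIcc_of_le zero_le_one] at ht
  simp only [hfg _ (mem_trace ht)]

lemma contourIntegral_const_mul (c : ℂ) (f : ℂ → ℂ) :
    contourIntegral γ (fun w => c * f w) = c * contourIntegral γ f := by
  simp only [contourIntegral, mul_assoc, intervalIntegral.integral_const_mul]
  ring

lemma IsPositiveContour.contourIntegral_add (h : IsPositiveContour γ) {f g : ℂ → ℂ}
    (hf : ContinuousOn f (trace γ)) (hg : ContinuousOn g (trace γ)) :
    contourIntegral γ (fun w => f w + g w) = contourIntegral γ f + contourIntegral γ g := by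
  simp only [contourIntegral, add_mul]
  rw [intervalIntegral.integral_add (h.intervalIntegrable hf) (h.intervalIntegrable hg), mul_add]

/-- The fundamental theorem of calculus on a closed curve; the break points of the piecewise smooth
curve form a countable exceptional set. -/
lemma IsPositiveContour.contourIntegral_eq_zero (h : IsPositiveContour γ) {F f : ℂ → ℂ}
    (hf : ContinuousOn f (trace γ)) (hF : ∀ w ∈ trace γ, HasDerivAt F (f w) w) :
    contourIntegral γ f = 0 := by
  obtain ⟨S, hS, hd⟩ := h.exists_countable
  rw [contourIntegral, integral_eq_of_hasDerivAt_off_countable (F ∘ γ) _ hS]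
  · simp [h.closed]
  · rw [uIcc_of_le zero_le_one]
    intro t ht
    exact (hF _ (mem_trace ht)).continuousAt.comp_continuousWithinAt (h.continuousOn t ht)
  · intro t ht
    rw [min_eq_left zero_le_one, max_eq_right zero_le_one] at ht
    exact (hF _ (mem_trace (Ioo_subset_Icc_self ht.1))).comp t (hd t ht)
  · exact h.intervalIntegrable hf

/-- The winding number. -/
def windingNumber (γ : ℝ → ℂ) (z : ℂ) : ℂ := contourIntegral γ fun w => (w - z)⁻¹

lemma continuousOn_inv_sub {z : ℂ} (hz : z ∉ trace γ) :
    ContinuousOn (fun w => (w - z)⁻¹) (trace γ) :=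
  (continuousOn_id.sub continuousOn_const).inv₀ fun _ hw =>
    sub_ne_zero.2 (ne_of_mem_of_not_mem hw hz)

lemma mem_slitPlane_of_norm_sub_one {z : ℂ} (hz : ‖z - 1‖ < 1) : z ∈ Complex.slitPlane :=
  Complex.ball_one_subset_slitPlane (by simpa [dist_eq_norm] using hz)

/-- The function log((w - z')/(w - z)) is a primitive of the difference of the two kernels. The
hypothesis keeps the quotient in the unit disc around 1, away from the branch cut. -/
lemma IsPositiveContour.winding_eq_of_near (h : IsPositiveContour γ) {z z' : ℂ}
    (hz : ∀ w ∈ trace γ, ‖z' - z‖ < ‖w - z‖) : windingNumber γ z' = windingNumber γ z := by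
  have hne : ∀ w ∈ trace γ, w - z ≠ 0 := fun w hw =>
    norm_pos_iff.1 ((norm_nonneg _).trans_lt (hz w hw))
  have hne' : ∀ w ∈ trace γ, w - z' ≠ 0 := fun w hw hw' => by
    have := hz w hw
    rw [sub_eq_zero.1 hw'] at this
    exact lt_irrefl _ this
  have hzt : z ∉ trace γ := fun hm => hne z hm (sub_self z)
  have hzt' : z' ∉ trace γ := fun hm => hne' z' hm (sub_self z')
  have c1 := continuousOn_inv_sub hzt
  have c2 := continuousOn_inv_sub hzt'
  have c3 : ContinuousOn (fun w => (-1) * (w - z)⁻¹) (trace γ) := continuousOn_const.mul c1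
  have key : contourIntegral γ (fun w => (w - z')⁻¹ + (-1) * (w - z)⁻¹) = 0 := by
    refine h.contourIntegral_eq_zero (F := fun w => Complex.log ((w - z') / (w - z)))
      (c2.add c3) fun w hw => ?_
    have h1 : HasDerivAt (fun w : ℂ => (w - z') / (w - z))
        ((1 * (w - z) - (w - z') * 1) / (w - z) ^ 2) w :=
      ((hasDerivAt_id w).sub_const z').div ((hasDerivAt_id w).sub_const z) (hne w hw)
    have h2 : (w - z') / (w - z) ∈ Complex.slitPlane := by
      refine mem_slitPlane_of_norm_sub_one ?_
      rw [div_sub_one (hne w hw), norm_div, div_lt_one (norm_pos_iff.2 (hne w hw))]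
      have : w - z' - (w - z) = -(z' - z) := by ring
      rw [this, norm_neg]
      exact hz w hw
    have h3 := h1.clog h2
    convert h3 using 1
    have := hne w hw
    have := hne' w hw
    field_simp
    ring
  rw [h.contourIntegral_add c2 c3, contourIntegral_const_mul] at key
  simp only [windingNumber]
  linear_combination key

/-- Here log(1 - w/z) is a primitive on the whole contour. -/
lemma IsPositiveContour.winding_eq_zero_of_far (h : IsPositiveContour γ) {z : ℂ}
    (hz : ∀ w ∈ trace γ, ‖w‖ < ‖z‖) : windingNumber γ z = 0 := by
  have hz0 : z ≠ 0 := by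
    obtain ⟨w, hw⟩ := trace_nonempty (γ := γ)
    exact norm_pos_iff.1 ((norm_nonneg w).trans_lt (hz w hw))
  have hzt : z ∉ trace γ := fun hm => lt_irrefl _ (hz z hm)
  have hne : ∀ w ∈ trace γ, w - z ≠ 0 := fun w hw => sub_ne_zero.2 (ne_of_mem_of_not_mem hw hzt)
  refine h.contourIntegral_eq_zero (F := fun w => Complex.log (1 - w / z))
    (continuousOn_inv_sub hzt) fun w hw => ?_
  have h1 : HasDerivAt (fun w : ℂ => 1 - w / z) (-(1 / z)) w :=
    ((hasDerivAt_id w).div_const z).const_sub 1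
  have h2 : 1 - w / z ∈ Complex.slitPlane := by
    refine mem_slitPlane_of_norm_sub_one ?_
    rw [sub_sub_cancel_left, norm_neg, norm_div, div_lt_one (norm_pos_iff.2 hz0)]
    exact hz w hw
  have h3 := h1.clog h2
  convert h3 using 1
  have := hne w hw
  have h4 : 1 - w / z = -(w - z) / z := by field_simp; ring
  rw [h4]
  field_simp

lemma IsPositiveContour.exists_norm_max (h : IsPositiveContour γ) :
    ∃ w ∈ trace γ, ∀ w' ∈ trace γ, ‖w'‖ ≤ ‖w‖ :=
  h.isCompact_trace.exists_isMaxOn trace_nonempty continuous_norm.continuousOn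

/-- The winding number around a point outside vanishes. -/
lemma IsPositiveContour.winding_of_outside (h : IsPositiveContour γ) {z : ℂ} (hz : Outside γ z) :
    windingNumber γ z = 0 := by
  obtain ⟨w₀, -, hw₀⟩ := h.exists_norm_max
  have hopen : IsOpen (trace γ)ᶜ := h.isCompact_trace.isClosed.isOpen_compl
  have hcomp := hopen.connectedComponentIn (x := z)
  obtain ⟨z', hz', hz'n⟩ : ∃ z' ∈ connectedComponentIn (trace γ)ᶜ z, ‖w₀‖ < ‖z'‖ := by
    by_contra hcon
    push Not at hcon
    exact hz.2 (isBounded_iff_forall_norm_le.2 ⟨_, hcon⟩)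
  have hder : ∀ x ∈ connectedComponentIn (trace γ)ᶜ z, HasDerivAt (windingNumber γ) 0 x := by
    intro x hx
    have hx' : x ∈ (trace γ)ᶜ := connectedComponentIn_subset _ _ hx
    obtain ⟨r, hr, hball⟩ := Metric.isOpen_iff.1 hopen x hx'
    have hev : windingNumber γ =ᶠ[nhds x] fun _ => windingNumber γ x := by
      filter_upwards [Metric.ball_mem_nhds x hr] with y hy
      refine h.winding_eq_of_near fun w hw => ?_
      have h1 : r ≤ ‖w - x‖ := by
        by_contra hlt
        exact hball (by simpa [dist_eq_norm] using hlt) hw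
      refine lt_of_lt_of_le ?_ h1
      simpa [dist_eq_norm] using hy
    exact (hasDerivAt_const x (windingNumber γ x)).congr_of_eventuallyEq hev
  have e := hcomp.is_const_of_deriv_eq_zero isPreconnected_connectedComponentIn
    (fun x hx => (hder x hx).differentiableAt.differentiableWithinAt)
    (fun x hx => (hder x hx).deriv) (mem_connectedComponentIn hz.1) hz'
  rw [e]
  exact h.winding_eq_zero_of_far fun w hw => (hw₀ w hw).trans_lt hz'n

lemma IsPositiveContour.winding_of_inside (h : IsPositiveContour γ) {z : ℂ} (hz : Inside γ z) :
    windingNumber γ z = 1 := h.winding z hz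

/-! ### Inside and outside of nested contours -/

lemma inside_or_outside {z : ℂ} (hz : z ∉ trace γ) : Inside γ z ∨ Outside γ z := by
  by_cases h : Bornology.IsBounded (connectedComponentIn (trace γ)ᶜ z)
  · exact Or.inl ⟨hz, h⟩
  · exact Or.inr ⟨hz, h⟩

lemma Inside.not_outside {z : ℂ} (h : Inside γ z) : ¬ Outside γ z := fun h' => h'.2 h.2

lemma Outside.of_mem_component {z z' : ℂ} (hz : Outside γ z)
    (h : z' ∈ connectedComponentIn (trace γ)ᶜ z) : Outside γ z' :=
  ⟨connectedComponentIn_subset _ _ h, by rw [← connectedComponentIn_eq h]; exact hz.2⟩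

/-- Points of an unbounded connected set that avoids the contour are outside. -/
lemma outside_of_unbounded {A : Set ℂ} (hA : IsPreconnected A) (hAγ : A ⊆ (trace γ)ᶜ)
    (hAb : ¬ Bornology.IsBounded A) {z : ℂ} (hz : z ∈ A) : Outside γ z :=
  ⟨hAγ hz, fun h => hAb (h.subset (hA.subset_connectedComponentIn hz hAγ))⟩

/-- The ray of all r z with r ≥ 1 is connected, unbounded and avoids the contour. -/
lemma outside_of_norm_le {z : ℂ} (hz : z ∉ trace γ) (hn : ∀ w ∈ trace γ, ‖w‖ ≤ ‖z‖) :
    Outside γ z := by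
  have hz0 : z ≠ 0 := by
    rintro rfl
    obtain ⟨w, hw⟩ := trace_nonempty (γ := γ)
    have := hn w hw
    rw [norm_zero, norm_le_zero_iff] at this
    exact hz (this ▸ hw)
  have hzp : 0 < ‖z‖ := norm_pos_iff.2 hz0
  refine outside_of_unbounded (A := (fun r : ℝ => (r : ℂ) * z) '' Ici 1)
    (isPreconnected_Ici.image _ (by fun_prop)) ?_ ?_ ⟨1, by simp, by simp⟩
  · rintro _ ⟨r, hr, rfl⟩ hm
    have hr' : (1 : ℝ) ≤ r := hr
    rcases hr'.eq_or_lt with rfl | hlt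
    · exact hz (by simpa using hm)
    · have h1 := hn _ hm
      simp only at h1
      rw [norm_mul, Complex.norm_real, Real.norm_of_nonneg (by linarith)] at h1
      nlinarith
  · intro hb
    obtain ⟨C, hC⟩ := isBounded_iff_forall_norm_le.1 hb
    have h1 := hC _ ⟨max 1 ((C + 1) / ‖z‖), mem_Ici.2 (le_max_left _ _), rfl⟩
    simp only at h1
    rw [norm_mul, Complex.norm_real, Real.norm_of_nonneg (le_max_of_le_left zero_le_one)] at h1
    have h2 : (C + 1) / ‖z‖ * ‖z‖ ≤ max 1 ((C + 1) / ‖z‖) * ‖z‖ :=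
      mul_le_mul_of_nonneg_right (le_max_right _ _) hzp.le
    rw [div_mul_cancel₀ _ hzp.ne'] at h2
    linarith

/-- Nested contours: if `q γ'` lies inside `γ`, then `q⁻¹ γ` lies outside `γ'`. -/
lemma outside_of_nested {γ' : ℝ → ℂ} (h : IsPositiveContour γ) (h' : IsPositiveContour γ') {q : ℂ}
    (hq : q ≠ 0) (hn : ∀ u ∈ trace γ', Inside γ (q * u)) {w : ℂ} (hw : w ∈ trace γ) :
    Outside γ' (w / q) := by
  obtain ⟨w₀, hw₀, hmax⟩ := h.exists_norm_max
  obtain ⟨u₀, hu₀, hmax'⟩ := h'.exists_norm_max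
  have havoid : ∀ w ∈ trace γ, w / q ∉ trace γ' := by
    intro w hw hwq
    have := (hn _ hwq).1
    rw [mul_div_cancel₀ _ hq] at this
    exact this hw
  -- Points of largest modulus are compared. Otherwise q u₀ would dominate γ and be outside it.
  -- Hence w₀ / q dominates γ', so it is outside γ', and connectedness of q⁻¹γ gives the rest.
  have h1 : ‖q * u₀‖ < ‖w₀‖ := by
    by_contra hle
    push Not at hle
    exact (hn u₀ hu₀).not_outside
      (outside_of_norm_le (hn u₀ hu₀).1 fun w hw => (hmax w hw).trans hle)
  have h2 : Outside γ' (w₀ / q) := by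
    refine outside_of_norm_le (havoid _ hw₀) fun u hu => (hmax' u hu).trans ?_
    rw [norm_div, le_div_iff₀ (norm_pos_iff.2 hq), mul_comm, ← norm_mul]
    exact h1.le
  have h3 : IsPreconnected ((fun w => w / q) '' trace γ) :=
    h.isPreconnected_trace.image _ (by fun_prop)
  refine h2.of_mem_component (h3.subset_connectedComponentIn (mem_image_of_mem _ hw₀) ?_
    (mem_image_of_mem _ hw))
  rintro _ ⟨w, hw, rfl⟩
  exact havoid w hw

/-- Nested contours: if `q γ'` lies inside `γ`, then so does `q` times the inside of `γ'`. -/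
lemma inside_of_nested {γ' : ℝ → ℂ} (h : IsPositiveContour γ) (h' : IsPositiveContour γ') {q : ℂ}
    (hq : q ≠ 0) (hn : ∀ u ∈ trace γ', Inside γ (q * u)) {z : ℂ} (hz : Inside γ' z) :
    Inside γ (q * z) := by
  by_cases hqz : q * z ∈ trace γ
  · have := outside_of_nested h h' hq hn hqz
    rw [mul_div_cancel_left₀ _ hq] at this
    exact absurd this hz.not_outside
  rcases inside_or_outside hqz with hi | ho
  · exact hi
  exfalso
  refine hz.not_outside (outside_of_unbounded
    (A := (fun w => q⁻¹ * w) '' connectedComponentIn (trace γ)ᶜ (q * z))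
    (isPreconnected_connectedComponentIn.image _ (by fun_prop)) ?_ ?_
    ⟨q * z, mem_connectedComponentIn hqz, by simp [hq]⟩)
  · rintro _ ⟨w, hw, rfl⟩ hm
    have h1 := hn _ hm
    rw [mul_inv_cancel_left₀ hq] at h1
    exact h1.not_outside (ho.of_mem_component hw)
  · intro hb
    refine ho.2 ?_
    obtain ⟨C, hC⟩ := isBounded_iff_forall_norm_le.1 hb
    refine isBounded_iff_forall_norm_le.2 ⟨‖q‖ * C, fun w hw => ?_⟩
    have := hC _ (mem_image_of_mem _ hw)
    rw [norm_mul, norm_inv, inv_mul_le_iff₀ (norm_pos_iff.2 hq)] at this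
    exact this

end Contour

end HigherSpin

end

section

namespace HigherSpin

open MeasureTheory Set Polynomial

/-! ### Contour integrals of rational functions -/

section Rational

variable {γ : ℝ → ℂ}

/-- The polynomial function with given roots. -/
def rootProd (m : Multiset ℂ) (w : ℂ) : ℂ := (m.map fun z => w - z).prod

@[simp] lemma rootProd_zero (w : ℂ) : rootProd 0 w = 1 := by simp [rootProd]

@[simp] lemma rootProd_cons (z : ℂ) (m : Multiset ℂ) (w : ℂ) :
    rootProd (z ::ₘ m) w = (w - z) * rootProd m w := by simp [rootProd]

lemma rootProd_add (m m' : Multiset ℂ) (w : ℂ) :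
    rootProd (m + m') w = rootProd m w * rootProd m' w := by simp [rootProd]

lemma rootProd_ne_zero {m : Multiset ℂ} {w : ℂ} (h : ∀ z ∈ m, w ≠ z) : rootProd m w ≠ 0 := by
  intro hm
  rw [rootProd, Multiset.prod_eq_zero_iff] at hm
  obtain ⟨z, hz, hz'⟩ := Multiset.mem_map.1 hm
  exact h z hz (sub_eq_zero.1 hz')

lemma continuous_rootProd (m : Multiset ℂ) : Continuous (rootProd m) := by
  induction m using Multiset.induction_on with
  | empty =>
    have : rootProd 0 = fun _ => 1 := by ext1 w; simp
    rw [this]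
    exact continuous_const
  | cons z m ih =>
    have : rootProd (z ::ₘ m) = fun w => (w - z) * rootProd m w := by ext w; simp
    rw [this]
    fun_prop

lemma exists_eval_eq_rootProd (m : Multiset ℂ) : ∃ P : ℂ[X], ∀ w, P.eval w = rootProd m w := by
  induction m using Multiset.induction_on with
  | empty => exact ⟨1, by simp⟩
  | cons z m ih =>
    obtain ⟨P, hP⟩ := ih
    exact ⟨(X - C z) * P, fun w => by simp [hP]⟩

lemma continuousOn_div_rootProd {m : Multiset ℂ} (hm : ∀ z ∈ m, z ∉ trace γ) (P : ℂ[X]) :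
    ContinuousOn (fun w => P.eval w / rootProd m w) (trace γ) :=
  P.continuous.continuousOn.div (continuous_rootProd m).continuousOn fun _ hw =>
    rootProd_ne_zero fun z hz h => hm z hz (h ▸ hw)

lemma IsPositiveContour.contourIntegral_polynomial (h : IsPositiveContour γ) (P : ℂ[X]) :
    contourIntegral γ (fun w => P.eval w) = 0 := by
  induction P using Polynomial.induction_on' with
  | add P Q hP hQ =>
    simp only [eval_add]
    rw [h.contourIntegral_add P.continuous.continuousOn Q.continuous.continuousOn, hP, hQ, add_zero]
  | monomial n c =>
    refine h.contourIntegral_eq_zero (F := fun w => (monomial (n + 1) (c / (n + 1))).eval w)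
      (monomial n c).continuous.continuousOn fun w _ => ?_
    have h1 := (monomial (n + 1) (c / (n + 1))).hasDerivAt w
    have hn : (n : ℂ) + 1 ≠ 0 := Nat.cast_add_one_ne_zero n
    rw [derivative_monomial, add_tsub_cancel_right, Nat.cast_add_one, div_mul_cancel₀ _ hn] at h1
    exact h1

lemma IsPositiveContour.contourIntegral_inv_pow (h : IsPositiveContour γ) {z : ℂ}
    (hz : z ∉ trace γ) (n : ℕ) :
    contourIntegral γ (fun w => ((w - z) ^ (n + 2))⁻¹) = 0 := by
  have hne : ∀ w ∈ trace γ, w - z ≠ 0 := fun w hw => sub_ne_zero.2 (ne_of_mem_of_not_mem hw hz)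
  refine h.contourIntegral_eq_zero (F := fun w => -(n + 1 : ℂ)⁻¹ * ((w - z) ^ (n + 1))⁻¹)
    (((continuousOn_id.sub continuousOn_const).pow _).inv₀ fun w hw => pow_ne_zero _ (hne w hw))
    fun w hw => ?_
  have h0 := hne w hw
  have h1 : HasDerivAt (fun w : ℂ => (w - z) ^ (n + 1)) (((n + 1 : ℕ) : ℂ) * (w - z) ^ n * 1) w := by
    exact ((hasDerivAt_id w).sub_const z).fun_pow (n + 1)
  have h2 := (h1.inv (pow_ne_zero _ h0)).const_mul (-(n + 1 : ℂ)⁻¹)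
  have hn : (n : ℂ) + 1 ≠ 0 := Nat.cast_add_one_ne_zero n
  refine h2.congr_deriv ?_
  push_cast
  field_simp
  ring

/-- Two distinct roots are separated by partial fractions, leaving one root fewer in each part; if
all roots coincide there is a primitive. When the separation ends in simple poles, the equal winding
numbers cancel. -/
lemma IsPositiveContour.contourIntegral_inv_rootProd (h : IsPositiveContour γ) {W : ℂ} (n : ℕ)
    {m : Multiset ℂ} (hm : m.card = n + 1) (hW : ∀ z ∈ m, z ∉ trace γ ∧ windingNumber γ z = W)
    (hd : W = 0 ∨ 1 ≤ n) :
    contourIntegral γ (fun w => (rootProd m w)⁻¹) = 0 := by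
  induction n generalizing m with
  | zero =>
    obtain ⟨z, rfl⟩ := Multiset.card_eq_one.1 hm
    have hW0 : W = 0 := hd.resolve_right (by norm_num)
    have := (hW z (by simp)).2
    rw [hW0, windingNumber] at this
    simpa [rootProd] using this
  | succ n ih =>
    obtain ⟨z, m', rfl⟩ : ∃ z m', m = z ::ₘ m' := by
      obtain ⟨z, hz⟩ := Multiset.card_pos_iff_exists_mem.1 (show 0 < m.card by omega)
      exact ⟨z, _, (Multiset.cons_erase hz).symm⟩
    by_cases hall : ∀ z' ∈ m', z' = z
    · have hrep : m' = Multiset.replicate (n + 1) z :=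
        Multiset.eq_replicate.2 ⟨by simpa using hm, hall⟩
      have : ∀ w, (rootProd (z ::ₘ m') w)⁻¹ = ((w - z) ^ (n + 2))⁻¹ := fun w => by
        rw [rootProd_cons, hrep, rootProd, Multiset.map_replicate, Multiset.prod_replicate,
          ← pow_succ']
      simp only [this]
      exact h.contourIntegral_inv_pow (hW z (by simp)).1 n
    · push Not at hall
      obtain ⟨z', hz', hne⟩ := hall
      obtain ⟨m'', rfl⟩ : ∃ m'', m' = z' ::ₘ m'' := ⟨_, (Multiset.cons_erase hz').symm⟩
      have hzz : z - z' ≠ 0 := sub_ne_zero.2 hne.symm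
      have hz := hW z (by simp)
      have hz'W := hW z' (by simp)
      have hm'' : ∀ x ∈ m'', x ∉ trace γ := fun x hx => (hW x (by simp [hx])).1
      have hsub : ∀ y, (y = z ∨ y = z') → ∀ x ∈ y ::ₘ m'', x ∉ trace γ ∧ windingNumber γ x = W := by
        intro y hy x hx
        rcases Multiset.mem_cons.1 hx with rfl | hx
        · rcases hy with rfl | rfl
          · exact hz
          · exact hz'W
        · exact hW x (by simp [hx])
      have e : ∀ w ∈ trace γ, (rootProd (z ::ₘ z' ::ₘ m'') w)⁻¹ =
          (z - z')⁻¹ * ((rootProd (z ::ₘ m'') w)⁻¹ + (-1) * (rootProd (z' ::ₘ m'') w)⁻¹) := by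
        intro w hw
        have h1 : w - z ≠ 0 := sub_ne_zero.2 (ne_of_mem_of_not_mem hw hz.1)
        have h2 : w - z' ≠ 0 := sub_ne_zero.2 (ne_of_mem_of_not_mem hw hz'W.1)
        have h3 : rootProd m'' w ≠ 0 := rootProd_ne_zero fun x hx hwx => hm'' x hx (hwx ▸ hw)
        simp only [rootProd_cons]
        field_simp
        ring
      have hc : ∀ y, (y = z ∨ y = z') → ContinuousOn (fun w => (rootProd (y ::ₘ m'') w)⁻¹) (trace γ) :=
        fun y hy => (continuous_rootProd _).continuousOn.inv₀ fun w hw =>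
          rootProd_ne_zero fun x hx hwx => (hsub y hy x hx).1 (hwx ▸ hw)
      have hc' : ContinuousOn (fun w => (-1) * (rootProd (z' ::ₘ m'') w)⁻¹) (trace γ) :=
        continuousOn_const.mul (hc z' (Or.inr rfl))
      rw [contourIntegral_congr e, contourIntegral_const_mul,
        h.contourIntegral_add (hc z (Or.inl rfl)) hc', contourIntegral_const_mul]
      by_cases hd' : W = 0 ∨ 1 ≤ n
      · have hcard : ∀ y : ℂ, (y ::ₘ m'').card = n + 1 := fun y => by
          simp only [Multiset.card_cons] at hm ⊢; omega
        rw [ih (hcard z) (hsub z (Or.inl rfl)) hd', ih (hcard z') (hsub z' (Or.inr rfl)) hd']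
        simp
      · push Not at hd'
        have hm0 : m'' = 0 := by
          rw [← Multiset.card_eq_zero]
          simp only [Multiset.card_cons] at hm
          omega
        subst hm0
        have e1 := hz.2
        have e2 := hz'W.2
        simp only [windingNumber] at e1 e2
        simp only [rootProd_cons, rootProd_zero, mul_one]
        rw [e1, e2]
        ring

/-- The contour integral of a rational function vanishes if all of its poles are outside, or if
all of them are inside and it decays at infinity. -/
lemma IsPositiveContour.contourIntegral_div_rootProd (h : IsPositiveContour γ) {W : ℂ}
    {m : Multiset ℂ} (hW : ∀ z ∈ m, z ∉ trace γ ∧ windingNumber γ z = W) (P : ℂ[X])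
    (hd : W = 0 ∨ P.natDegree + 2 ≤ m.card) :
    contourIntegral γ (fun w => P.eval w / rootProd m w) = 0 := by
  induction m using Multiset.induction_on generalizing P with
  | empty =>
    simpa using h.contourIntegral_polynomial P
  | cons z m ih =>
    have hz := hW z (by simp)
    have hm : ∀ x ∈ m, x ∉ trace γ ∧ windingNumber γ x = W := fun x hx => hW x (by simp [hx])
    set Q := P /ₘ (X - C z) with hQ
    have hP : ∀ w, P.eval w = (w - z) * Q.eval w + P.eval z := by
      intro w
      have := congrArg (Polynomial.eval w) (modByMonic_add_div P (X - C z))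
      rw [modByMonic_X_sub_C_eq_C_eval] at this
      simp only [eval_add, eval_C, eval_mul, eval_sub, eval_X] at this
      rw [← this]
      ring
    have e : ∀ w ∈ trace γ, P.eval w / rootProd (z ::ₘ m) w =
        Q.eval w / rootProd m w + P.eval z * (rootProd (z ::ₘ m) w)⁻¹ := by
      intro w hw
      have h1 : w - z ≠ 0 := sub_ne_zero.2 (ne_of_mem_of_not_mem hw hz.1)
      have h3 : rootProd m w ≠ 0 := rootProd_ne_zero fun x hx hwx => (hm x hx).1 (hwx ▸ hw)
      rw [hP w, rootProd_cons]
      field_simp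
    have hcz : ContinuousOn (fun w => P.eval z * (rootProd (z ::ₘ m) w)⁻¹) (trace γ) :=
      continuousOn_const.mul ((continuous_rootProd _).continuousOn.inv₀ fun w hw =>
        rootProd_ne_zero fun x hx hwx => (hW x hx).1 (hwx ▸ hw))
    rw [contourIntegral_congr e, h.contourIntegral_add
      (continuousOn_div_rootProd (fun x hx => (hm x hx).1) Q) hcz, contourIntegral_const_mul,
      h.contourIntegral_inv_rootProd m.card (by simp) hW (hd.imp_right fun hd => by
        simp at hd; omega), mul_zero, add_zero]
    -- Division by w - z lowers the degree together with the number of roots, except for constant P;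
    -- then the quotient is zero.
    by_cases hP0 : P.natDegree = 0
    · have hQ0 : Q = 0 := by
        rw [hQ, divByMonic_eq_zero_iff (monic_X_sub_C z), degree_X_sub_C]
        rw [eq_C_of_natDegree_eq_zero hP0]
        exact degree_C_le.trans_lt (by norm_num)
      simp [hQ0, contourIntegral]
    · refine ih hm Q (hd.imp_right fun hd => ?_)
      rw [hQ, natDegree_divByMonic P (monic_X_sub_C z), natDegree_X_sub_C]
      rw [Multiset.card_cons] at hd
      omega

/-- On the set `T`, the function `f` is rational with poles in `Z` and degree at most `d`. -/
def RatOn (T Z : Set ℂ) (d : ℤ) (f : ℂ → ℂ) : Prop :=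
  ∃ (P : ℂ[X]) (m : Multiset ℂ), (∀ z ∈ m, z ∈ Z) ∧ (P.natDegree : ℤ) ≤ m.card + d ∧
    ∀ w ∈ T, f w = P.eval w / rootProd m w

variable {T Z : Set ℂ} {d d' : ℤ} {f g : ℂ → ℂ}

lemma RatOn.congr (hf : RatOn T Z d f) (h : ∀ w ∈ T, g w = f w) : RatOn T Z d g := by
  obtain ⟨P, m, h1, h2, h3⟩ := hf
  exact ⟨P, m, h1, h2, fun w hw => (h w hw).trans (h3 w hw)⟩

lemma RatOn.mono (hf : RatOn T Z d f) (h : d ≤ d') : RatOn T Z d' f := by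
  obtain ⟨P, m, h1, h2, h3⟩ := hf
  exact ⟨P, m, h1, by omega, h3⟩

lemma ratOn_polynomial (P : ℂ[X]) : RatOn T Z P.natDegree (fun w => P.eval w) :=
  ⟨P, 0, by simp, by simp, by simp⟩

lemma ratOn_const (c : ℂ) : RatOn T Z 0 (fun _ => c) := by
  simpa using ratOn_polynomial (T := T) (Z := Z) (C c)

lemma ratOn_linear (a b : ℂ) : RatOn T Z 1 (fun w => a * w + b) := by
  refine ((ratOn_polynomial (C a * X + C b)).mono ?_).congr fun w _ => by simp
  exact_mod_cast natDegree_linear_le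

lemma RatOn.mul (hf : RatOn T Z d f) (hg : RatOn T Z d' g) :
    RatOn T Z (d + d') (fun w => f w * g w) := by
  obtain ⟨P, m, h1, h2, h3⟩ := hf
  obtain ⟨Q, m', h1', h2', h3'⟩ := hg
  refine ⟨P * Q, m + m', ?_, ?_, fun w hw => ?_⟩
  · intro z hz
    rcases Multiset.mem_add.1 hz with hz | hz
    exacts [h1 z hz, h1' z hz]
  · have := natDegree_mul_le (p := P) (q := Q)
    rw [Multiset.card_add]
    push_cast
    omega
  · simp only
    rw [h3 w hw, h3' w hw, rootProd_add, eval_mul, div_mul_div_comm]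

lemma RatOn.pow (hf : RatOn T Z d f) (n : ℕ) : RatOn T Z (n * d) (fun w => f w ^ n) := by
  induction n with
  | zero => simpa using ratOn_const (T := T) (Z := Z) 1
  | succ n ih =>
    refine ((ih.mul hf).mono ?_).congr fun w _ => pow_succ _ _
    push_cast
    linarith

lemma RatOn.prod {ι : Type*} {F : ι → ℂ → ℂ} (s : Finset ι) (h : ∀ i ∈ s, RatOn T Z 0 (F i)) :
    RatOn T Z 0 (fun w => ∏ i ∈ s, F i w) := by
  classical
  induction s using Finset.induction_on with
  | empty => simpa using ratOn_const (T := T) (Z := Z) 1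
  | insert i s hi ih =>
    simp only [Finset.prod_insert hi]
    simpa using (h i (by simp)).mul (ih fun j hj => h j (by simp [hj]))

lemma ratOn_inv {z : ℂ} (hz : z ∈ Z) : RatOn T Z (-1) (fun w => (w - z)⁻¹) :=
  ⟨1, {z}, by simpa using hz, by simp, fun w _ => by simp [rootProd]⟩

lemma ratOn_inv_linear {a b : ℂ} (ha : a ≠ 0) (hz : -b / a ∈ Z) :
    RatOn T Z (-1) (fun w => (a * w + b)⁻¹) := by
  refine ((ratOn_const a⁻¹).mul (ratOn_inv hz)).congr fun w _ => ?_
  rw [← mul_inv]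
  congr 1
  field_simp
  ring

lemma IsPositiveContour.contourIntegral_of_outside (h : IsPositiveContour γ)
    (hf : RatOn (trace γ) {z | Outside γ z} d f) : contourIntegral γ f = 0 := by
  obtain ⟨P, m, h1, -, h3⟩ := hf
  rw [contourIntegral_congr h3]
  exact h.contourIntegral_div_rootProd (W := 0)
    (fun z hz => ⟨(h1 z hz).1, h.winding_of_outside (h1 z hz)⟩) P (Or.inl rfl)

lemma IsPositiveContour.contourIntegral_of_inside (h : IsPositiveContour γ)
    (hf : RatOn (trace γ) {z | Inside γ z} (-2) f) : contourIntegral γ f = 0 := by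
  obtain ⟨P, m, h1, h2, h3⟩ := hf
  rw [contourIntegral_congr h3]
  exact h.contourIntegral_div_rootProd (W := 1)
    (fun z hz => ⟨(h1 z hz).1, h.winding_of_inside (h1 z hz)⟩) P (Or.inr (by omega))

/-- Cauchy's formula for rational functions. -/
lemma IsPositiveContour.contourIntegral_cauchy (h : IsPositiveContour γ) {z : ℂ}
    (hz : Inside γ z) (hf : RatOn (insert z (trace γ)) {z | Outside γ z} d f) :
    contourIntegral γ (fun w => f w / (w - z)) = f z := by
  obtain ⟨P, m, h1, -, h3⟩ := hf
  obtain ⟨M, hM⟩ := exists_eval_eq_rootProd m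
  have hMz : rootProd m z ≠ 0 := rootProd_ne_zero fun x hx hzx =>
    hz.not_outside (hzx ▸ h1 x hx)
  -- R divided by the root product is f - f(z). It vanishes at z, so the factor w - z cancels and
  -- only poles outside remain.
  set R : ℂ[X] := C (rootProd m z)⁻¹ * (C (rootProd m z) * P - C (P.eval z) * M) with hR
  have hRz : R.IsRoot z := by
    simp [hR, IsRoot.def, hM]
    right; ring
  obtain ⟨Q, hQ⟩ := dvd_iff_isRoot.2 hRz
  have e : ∀ w ∈ trace γ, f w / (w - z) = Q.eval w / rootProd m w + f z * (w - z)⁻¹ := by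
    intro w hw
    have h4 : w - z ≠ 0 := sub_ne_zero.2 (ne_of_mem_of_not_mem hw hz.1)
    have h5 : rootProd m w ≠ 0 := rootProd_ne_zero fun x hx hwx => (h1 x hx).1 (hwx ▸ hw)
    have h6 := congrArg (Polynomial.eval w) hQ
    simp only [hR, eval_mul, eval_sub, eval_C, eval_X, hM] at h6
    have h7 : Q.eval w = ((rootProd m z)⁻¹ *
        (rootProd m z * P.eval w - P.eval z * rootProd m w)) / (w - z) := by
      rw [eq_div_iff h4, mul_comm]
      exact h6.symm
    rw [h3 w (mem_insert_of_mem _ hw), h3 z (mem_insert _ _), h7]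
    field_simp
    ring
  have hc : ContinuousOn (fun w => f z * (w - z)⁻¹) (trace γ) :=
    continuousOn_const.mul (continuousOn_inv_sub hz.1)
  rw [contourIntegral_congr e, h.contourIntegral_add
    (continuousOn_div_rootProd (fun x hx => (h1 x hx).1) Q) hc, contourIntegral_const_mul,
    h.contourIntegral_div_rootProd (W := 0)
      (fun z hz => ⟨(h1 z hz).1, h.winding_of_outside (h1 z hz)⟩) Q (Or.inl rfl), zero_add]
  have := h.winding_of_inside hz
  rw [windingNumber] at this
  rw [this, mul_one]

end Rational

end HigherSpin

end

section

namespace HigherSpin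

open MeasureTheory Set

/-! ### Iterated contour integrals -/

section Iterated

variable {k : ℕ}

/-- The product of the contours. -/
def torus (γ : Fin k → ℝ → ℂ) : Set (Fin k → ℂ) := Set.univ.pi fun i => trace (γ i)

lemma torus_apply {γ : Fin k → ℝ → ℂ} {w : Fin k → ℂ} (hw : w ∈ torus γ) (i : Fin k) :
    w i ∈ trace (γ i) := hw i (mem_univ i)

lemma iteratedIntegral_congr {γ : Fin k → ℝ → ℂ} {f g : (Fin k → ℂ) → ℂ}
    (h : ∀ w ∈ torus γ, f w = g w) : iteratedIntegral k γ f = iteratedIntegral k γ g := by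
  induction k with
  | zero => exact h _ fun i => i.elim0
  | succ k ih =>
    refine contourIntegral_congr fun u hu => ih fun w hw => h _ fun i _ => ?_
    refine Fin.cases ?_ (fun j => ?_) i
    · simpa using hu
    · simpa using torus_apply hw j

lemma iteratedIntegral_const_mul (γ : Fin k → ℝ → ℂ) (c : ℂ) (f : (Fin k → ℂ) → ℂ) :
    iteratedIntegral k γ (fun w => c * f w) = c * iteratedIntegral k γ f := by
  induction k with
  | zero => rfl
  | succ k ih =>
    simp only [iteratedIntegral, ih]
    exact contourIntegral_const_mul _ _

lemma iteratedIntegral_snoc (γ : Fin (k + 1) → ℝ → ℂ) (f : (Fin (k + 1) → ℂ) → ℂ) :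
    iteratedIntegral (k + 1) γ f = iteratedIntegral k (fun i => γ i.castSucc) (fun w =>
      contourIntegral (γ (Fin.last k)) fun u => f (Fin.snoc (α := fun _ => ℂ) w u)) := by
  induction k with
  | zero =>
    simp only [iteratedIntegral]
    congr 1
    ext u
    congr 1
    ext i
    fin_cases i
    rfl
  | succ k ih =>
    refine (congrArg (contourIntegral (γ 0)) (funext fun u => ih _ _)).trans ?_
    simp only [Fin.cons_snoc_eq_snoc_cons]
    rfl

lemma iteratedIntegral_append {m : ℕ} (γ : Fin (k + m) → ℝ → ℂ) (f : (Fin k → ℂ) → ℂ)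
    (g : (Fin m → ℂ) → ℂ) :
    iteratedIntegral (k + m) γ
      (fun w => f (fun i => w (Fin.castAdd m i)) * g (fun i => w (Fin.natAdd k i))) =
    iteratedIntegral k (fun i => γ (Fin.castAdd m i)) f *
      iteratedIntegral m (fun i => γ (Fin.natAdd k i)) g := by
  induction m with
  | zero =>
    have : ∀ h : (Fin 0 → ℂ), h = Fin.elim0 := fun h => Subsingleton.elim _ _
    simp only [this, mul_comm _ (g Fin.elim0)]
    rw [mul_comm]
    exact iteratedIntegral_const_mul _ _ _
  | succ m ih =>
    have h1 := iteratedIntegral_snoc (k := k + m) γ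
      (fun w => f (fun i => w (Fin.castAdd (m + 1) i)) * g (fun i => w (Fin.natAdd k i)))
    refine h1.trans ?_
    rw [iteratedIntegral_snoc (k := m) (fun i => γ (Fin.natAdd k i)) g]
    refine Eq.trans ?_ (ih (fun i => γ i.castSucc) _)
    refine iteratedIntegral_congr fun w _ => ?_
    rw [← contourIntegral_const_mul]
    have e1 : ∀ u, (fun i => (Fin.snoc w u : Fin (k + m + 1) → ℂ) (Fin.castAdd (m + 1) i)) =
        fun i => w (Fin.castAdd m i) := fun u => by
      ext i
      exact Fin.snoc_castSucc (α := fun _ => ℂ) u w (Fin.castAdd m i)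
    have e2 : ∀ u, (fun i => (Fin.snoc w u : Fin (k + m + 1) → ℂ) (Fin.natAdd k i)) =
        (Fin.snoc (fun i => w (Fin.natAdd k i)) u : Fin (m + 1) → ℂ) := fun u => by
      ext i
      refine Fin.lastCases ?_ (fun j => ?_) i
      · rw [Fin.snoc_last]
        exact Fin.snoc_last (α := fun _ => ℂ) u w
      · rw [Fin.snoc_castSucc]
        exact Fin.snoc_castSucc (α := fun _ => ℂ) u w (Fin.natAdd k j)
    simp only [e1, e2]
    rfl

/-- The Lebesgue measure on `(0, 1]`. -/
abbrev unitMeasure : Measure ℝ := volume.restrict (Ioc 0 1)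

/-- A continuous function is bounded on the compact torus and the product of the derivatives is
integrable. This is what Fubini's theorem needs. -/
lemma integrable_torus {γ : Fin k → ℝ → ℂ} (hγ : ∀ i, IsPositiveContour (γ i))
    {f : (Fin k → ℂ) → ℂ} (hf : ContinuousOn f (torus γ)) :
    Integrable (fun t : Fin k → ℝ => f (fun i => γ i (t i)) * ∏ i, deriv (γ i) (t i))
      (Measure.pi fun _ => unitMeasure) := by
  have hd : Integrable (fun t : Fin k → ℝ => ∏ i, deriv (γ i) (t i))
      (Measure.pi fun _ => unitMeasure) :=
    Integrable.fintype_prod fun i =>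
      (intervalIntegrable_iff_integrableOn_Ioc_of_le zero_le_one).1 (hγ i).intervalIntegrable_deriv
  have hc : IsCompact (torus γ) := isCompact_univ_pi fun i => (hγ i).isCompact_trace
  obtain ⟨C, hC⟩ := hc.exists_bound_of_continuousOn hf
  have hmem : ∀ t ∈ (Set.univ.pi fun _ : Fin k => Ioc (0 : ℝ) 1),
      (fun i => γ i (t i)) ∈ torus γ := fun t ht i _ => by
    have := ht i (mem_univ i)
    exact mem_trace ⟨this.1.le, this.2⟩
  have hmeas : MeasurableSet (Set.univ.pi fun _ : Fin k => Ioc (0 : ℝ) 1) :=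
    MeasurableSet.univ_pi fun _ => measurableSet_Ioc
  rw [← Measure.restrict_pi_pi] at hd ⊢
  refine hd.bdd_mul (c := C) (ContinuousOn.aestronglyMeasurable ?_ hmeas)
    ((ae_restrict_iff' hmeas).2 (Filter.Eventually.of_forall fun t ht => hC _ (hmem t ht)))
  refine hf.comp ?_ hmem
  refine continuousOn_pi.2 fun i => (hγ i).continuousOn.comp (continuous_apply i).continuousOn ?_
  intro t ht
  have := ht i (mem_univ i)
  exact ⟨this.1.le, this.2⟩

lemma integral_pi_insertNth (i : Fin (k + 1)) {g : (Fin (k + 1) → ℝ) → ℂ}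
    (hg : Integrable g (Measure.pi fun _ => unitMeasure)) :
    Integrable (fun p : ℝ × (Fin k → ℝ) => g (i.insertNth p.1 p.2))
      (unitMeasure.prod (Measure.pi fun _ => unitMeasure)) ∧
    ∫ t, g t ∂(Measure.pi fun _ => unitMeasure) =
      ∫ p : ℝ × (Fin k → ℝ), g (i.insertNth p.1 p.2)
        ∂(unitMeasure.prod (Measure.pi fun _ => unitMeasure)) := by
  have h := (measurePreserving_piFinSuccAbove (fun _ : Fin (k + 1) => unitMeasure) i).symm
  refine ⟨?_, (h.integral_comp' g).symm⟩
  exact (h.integrable_comp_emb (MeasurableEquiv.measurableEmbedding _)).2 hg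

lemma contourIntegral_eq_integral (γ : ℝ → ℂ) (f : ℂ → ℂ) :
    contourIntegral γ f = (2 * (Real.pi : ℂ) * Complex.I)⁻¹ *
      ∫ t, f (γ t) * deriv γ t ∂unitMeasure := by
  rw [contourIntegral, intervalIntegral.integral_of_le zero_le_one]

lemma iteratedIntegral_eq_integral {γ : Fin k → ℝ → ℂ} (hγ : ∀ i, IsPositiveContour (γ i))
    {f : (Fin k → ℂ) → ℂ} (hf : ContinuousOn f (torus γ)) :
    iteratedIntegral k γ f = ((2 * (Real.pi : ℂ) * Complex.I)⁻¹) ^ k *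
      ∫ t : Fin k → ℝ, f (fun i => γ i (t i)) * ∏ i, deriv (γ i) (t i)
        ∂(Measure.pi fun _ => unitMeasure) := by
  induction k with
  | zero =>
    simp only [iteratedIntegral, pow_zero, one_mul, Finset.univ_eq_empty, Finset.prod_empty, mul_one]
    rw [Measure.pi_of_empty]
    simp only [integral_dirac]
    congr 1
    exact Subsingleton.elim _ _
  | succ k ih =>
    have h1 := integral_pi_insertNth 0 (integrable_torus hγ hf)
    rw [h1.2, integral_prod _ h1.1, iteratedIntegral, contourIntegral_eq_integral, pow_succ']
    rw [mul_assoc _ (_ ^ k)]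
    congr 1
    rw [← integral_const_mul]
    refine setIntegral_congr_fun measurableSet_Ioc fun x hx => ?_
    have hc : ContinuousOn (fun w => f (Fin.cons (γ 0 x) w)) (torus fun i : Fin k => γ i.succ) := by
      refine hf.comp (Continuous.continuousOn (by fun_prop)) fun w hw i _ => ?_
      refine Fin.cases ?_ (fun j => ?_) i
      · exact mem_trace ⟨hx.1.le, hx.2⟩
      · exact torus_apply hw j
    simp only
    rw [ih (fun i => hγ i.succ) hc, mul_assoc, mul_comm _ (deriv (γ 0) x), ← integral_const_mul]
    congr 2
    ext t
    rw [Fin.insertNth_zero', Fin.prod_univ_succ]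
    simp only [Fin.cons_zero, Fin.cons_succ]
    rw [mul_left_comm]
    congr 2
    ext i
    refine Fin.cases rfl (fun j => ?_) i
    simp

lemma iteratedIntegral_sum {γ : Fin k → ℝ → ℂ} (hγ : ∀ i, IsPositiveContour (γ i))
    {ι : Type*} (A : Finset ι) {f : ι → (Fin k → ℂ) → ℂ}
    (hf : ∀ a ∈ A, ContinuousOn (f a) (torus γ)) :
    iteratedIntegral k γ (fun w => ∑ a ∈ A, f a w) = ∑ a ∈ A, iteratedIntegral k γ (f a) := by
  rw [iteratedIntegral_eq_integral hγ (continuousOn_finsetSum A hf),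
    Finset.sum_congr rfl fun a ha => iteratedIntegral_eq_integral hγ (hf a ha), ← Finset.mul_sum,
    ← integral_finsetSum A fun a ha => integrable_torus hγ (hf a ha)]
  simp only [Finset.sum_mul]

/-- An iterated integral vanishes as soon as the integral over one of its variables does. -/
lemma iteratedIntegral_eq_zero {γ : Fin k → ℝ → ℂ} (hγ : ∀ i, IsPositiveContour (γ i))
    {f : (Fin k → ℂ) → ℂ} (hf : ContinuousOn f (torus γ)) (i : Fin k)
    (h : ∀ w ∈ torus γ, contourIntegral (γ i) (fun u => f (Function.update w i u)) = 0) :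
    iteratedIntegral k γ f = 0 := by
  cases k with
  | zero => exact i.elim0
  | succ k =>
    have h1 := integral_pi_insertNth i (integrable_torus hγ hf)
    rw [iteratedIntegral_eq_integral hγ hf, h1.2, integral_prod_symm _ h1.1]
    refine mul_eq_zero_of_right _ ?_
    rw [← Measure.restrict_pi_pi]
    have hmeas : MeasurableSet (Set.univ.pi fun _ : Fin k => Ioc (0 : ℝ) 1) :=
      MeasurableSet.univ_pi fun _ => measurableSet_Ioc
    refine setIntegral_eq_zero_of_forall_eq_zero fun t ht => ?_
    set t' : Fin (k + 1) → ℝ := i.insertNth 0 t with ht'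
    have hw : (fun j => γ j (t' j)) ∈ torus γ := by
      intro j _
      refine mem_trace ?_
      refine i.succAboveCases ?_ (fun l => ?_) j
      · simp [ht']
      · have := ht l (mem_univ l)
        simpa [ht'] using ⟨this.1.le, this.2⟩
    have := h _ hw
    rw [contourIntegral_eq_integral, mul_eq_zero] at this
    replace this := this.resolve_left (inv_ne_zero Complex.two_pi_I_ne_zero)
    have e : ∀ x, (fun j => γ j ((i.insertNth x t : Fin (k + 1) → ℝ) j)) =
        Function.update (fun j => γ j (t' j)) i (γ i x) := fun x => by
      ext j
      refine i.succAboveCases ?_ (fun l => ?_) j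
      · simp
      · simp [ht']
    simp only [e, Fin.prod_univ_succAbove _ i, Fin.insertNth_apply_same,
      Fin.insertNth_apply_succAbove, ← mul_assoc]
    rw [integral_mul_const, this, zero_mul]

end Iterated

end HigherSpin

end

section

namespace HigherSpin

open Filter Topology

/-! ### Dependence of the off-shell vectors on the spectral parameters -/

section Regularity

variable {X : Type*} {q s : ℂ}

/-- Coordinates are polynomial in the parameters. Stating this for any subalgebra of functions gives
continuity and polynomiality from a single induction. -/
lemma monodromy_mem (A : Subalgebra ℂ (X → ℂ)) {p : X → ℂ × ℂ} (h1 : (fun x => (p x).1) ∈ A)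
    (h2 : (fun x => (p x).2) ∈ A) {f : X → StateFn} (hf : ∀ ν, (fun x => f x ν) ∈ A) (a L : ℕ)
    (i j : Fin 2) (ν : ℕ → ℕ) : (fun x => monodromy q s a L (p x) i j (f x) ν) ∈ A := by
  have hc : ∀ c : ℂ, (fun _ : X => c) ∈ A := fun c => A.algebraMap_mem c
  have hs : ∀ c i j (f : X → StateFn), (∀ ν, (fun x => f x ν) ∈ A) → ∀ ν,
      (fun x => siteOp q s c (p x) i j (f x) ν) ∈ A := by
    intro c i j f hf ν
    simp only [siteOp_apply, siteCoef]
    refine A.mul_mem (y := fun x => f x (shiftConf c i j ν)) ?_ (hf _)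
    split_ifs
    · exact A.sub_mem h2 (A.mul_mem (A.mul_mem (hc s) h1) (hc _))
    · exact A.mul_mem h1 (hc _)
    · exact A.mul_mem h2 (hc _)
    · exact A.sub_mem h1 (A.mul_mem (A.mul_mem (hc s) h2) (hc _))
  induction L generalizing a i j ν with
  | zero =>
    simp only [monodromy, Matrix.one_apply]
    split_ifs
    · exact hf ν
    · exact A.zero_mem
  | succ L ih =>
    simp only [monodromy_succ_apply, LinearMap.add_apply, Module.End.mul_apply, Pi.add_apply]
    exact A.add_mem (hs _ _ _ _ (ih _ _ _) ν) (hs _ _ _ _ (ih _ _ _) ν)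

lemma bvec_mem {ι : Type*} [DecidableEq ι] (A : Subalgebra ℂ (X → ℂ)) {u : X → ι → ℂ}
    (h : ∀ i, (fun x => u x i) ∈ A) (hq : q ^ 2 ≠ 1) (a L : ℕ) (U : Finset ι) (ν : ℕ → ℕ) :
    (fun x => bvec q s hq a L (fun i => (u x i, 1)) U ν) ∈ A := by
  induction U using Finset.induction_on generalizing ν with
  | empty =>
    simp only [bvec_empty]
    exact A.algebraMap_mem (vacuum ν)
  | insert i U hi ih =>
    simp only [bvec_insert hi]
    exact monodromy_mem A (h i) A.one_mem ih _ _ _ _ _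

lemma bvec_congr {ι : Type*} [DecidableEq ι] {hq : q ^ 2 ≠ 1} {a L : ℕ} {p p' : ι → ℂ × ℂ}
    {U : Finset ι} (h : ∀ i ∈ U, p i = p' i) : bvec q s hq a L p U = bvec q s hq a L p' U := by
  induction U using Finset.induction_on with
  | empty => simp
  | insert i U hi ih =>
    rw [bvec_insert hi, bvec_insert hi, h i (by simp), ih fun j hj => h j (by simp [hj])]

lemma continuous_bvec {k : ℕ} (hq : q ^ 2 ≠ 1) (a L : ℕ) (U : Finset (Fin k)) (ν : ℕ → ℕ) :
    Continuous fun u : Fin k → ℂ => bvec q s hq a L (fun i => (u i, 1)) U ν :=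
  bvec_mem (continuousSubalgebra (R := ℂ)) (fun i => continuous_apply i) hq a L U ν

lemma continuous_monodromy_bvec {k : ℕ} (hq : q ^ 2 ≠ 1) (a L : ℕ) (U : Finset (Fin k)) (p : ℂ × ℂ)
    (i j : Fin 2) (ν : ℕ → ℕ) :
    Continuous fun u : Fin k → ℂ =>
      monodromy q s a L p i j (bvec q s hq a L (fun i => (u i, 1)) U) ν :=
  monodromy_mem (continuousSubalgebra (R := ℂ)) (p := fun _ => p) continuous_const
    continuous_const (fun ν => continuous_bvec hq a L U ν) a L i j ν

lemma exists_polynomial_bvec {k : ℕ} (hq : q ^ 2 ≠ 1) (a L : ℕ) (U : Finset (Fin k)) (ν : ℕ → ℕ)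
    (w : Fin k → ℂ) (i : Fin k) : ∃ P : Polynomial ℂ, ∀ z,
      bvec q s hq a L (fun j => (Function.update w i z j, 1)) U ν = P.eval z := by
  have h := bvec_mem (q := q) (s := s) (Polynomial.aeval (R := ℂ) (id : ℂ → ℂ)).range
    (u := fun z => Function.update w i z) (fun j => ?_) hq a L U ν
  · obtain ⟨P, hP⟩ := h
    refine ⟨P, fun z => (congrFun hP z).symm.trans ?_⟩
    have := Polynomial.aeval_algHom_apply (Pi.evalAlgHom ℂ (fun _ : ℂ => ℂ) z) id P
    exact this.symm.trans (by simp)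
  · by_cases hj : j = i
    · subst hj
      refine ⟨Polynomial.X, ?_⟩
      ext z
      simp
    · simp only [Function.update_of_ne hj]
      exact (Polynomial.aeval (R := ℂ) (id : ℂ → ℂ)).range.algebraMap_mem (w j)

/-- Injective families of numbers are dense. -/
lemma eq_of_eventually_injective {k : ℕ} {f g : (Fin k → ℂ) → ℂ} {u : Fin k → ℂ}
    (hf : ContinuousAt f u) (hg : ContinuousAt g u)
    (h : ∀ᶠ w in 𝓝 u, Function.Injective w → f w = g w) : f u = g u := by
  -- Two given coordinates of u_i + t i coincide for at most one t, so the perturbed family is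
  -- injective for all small t ≠ 0.
  let c : ℂ → Fin k → ℂ := fun t i => u i + t * (i : ℕ)
  have hc : Tendsto c (𝓝[≠] 0) (𝓝 u) := by
    have : Continuous c := by fun_prop
    have h0 := (this.tendsto 0).mono_left (nhdsWithin_le_nhds (s := {0}ᶜ))
    simpa [c] using h0
  have hinj : ∀ᶠ t in 𝓝[≠] (0 : ℂ), Function.Injective (c t) := by
    have : ∀ᶠ t in 𝓝[≠] (0 : ℂ), ∀ i j : Fin k, i ≠ j → c t i ≠ c t j := by
      refine eventually_all.2 fun i => eventually_all.2 fun j => ?_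
      by_cases hij : i = j
      · exact Eventually.of_forall fun t h => absurd hij h
      have hd : ((j : ℕ) : ℂ) - (i : ℕ) ≠ 0 := by
        rw [sub_ne_zero]
        exact_mod_cast fun h : (j : ℕ) = i => hij (Fin.ext h.symm)
      have hne : ∀ᶠ t in 𝓝[≠] (0 : ℂ), t ≠ (u i - u j) / ((j : ℕ) - (i : ℕ)) := by
        by_cases h0 : (u i - u j) / (((j : ℕ) : ℂ) - (i : ℕ)) = 0
        · rw [h0]
          exact self_mem_nhdsWithin
        · exact nhdsWithin_le_nhds (isOpen_ne.mem_nhds (Ne.symm h0))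
      filter_upwards [hne] with t ht _ hcc
      refine ht ?_
      rw [eq_div_iff hd]
      simp only [c] at hcc
      linear_combination -hcc
    filter_upwards [this] with t ht i j hij
    by_contra hne
    exact ht i j hne hij
  refine tendsto_nhds_unique (hf.tendsto.comp hc) ((hg.tendsto.comp hc).congr' ?_)
  filter_upwards [hc.eventually h, hinj] with t ht hi
  exact (ht hi).symm

end Regularity

/-! ### The cross weights -/

section Cross

variable {k : ℕ} {q : ℂ}

/-- The product of the factors `(u_α - u_β) / (u_α - q u_β)`. -/
def pairWeight (q : ℂ) (u : Fin k → ℂ) : ℂ :=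
  ∏ a : Fin k, ∏ b ∈ Finset.Ioi a, (u a - u b) / (u a - q * u b)

/-- The contribution of a pair of parameters to `crossWeight`. -/
def crossFactor (q : ℂ) (S : Finset (Fin k)) (a b : Fin k) (x y : ℂ) : ℂ :=
  if (a ∈ S ↔ b ∈ S) then (x - y) / (x - q * y)
  else if a ∈ S then (q * x - y) / (x - q * y) else 1

/-- The product of `pairWeight` with the factors `(q u_i - u_j) / (u_i - u_j)` over
`i ∈ S`, `j ∉ S`, without the removable singularities. -/
def crossWeight (q : ℂ) (S : Finset (Fin k)) (u : Fin k → ℂ) : ℂ :=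
  ∏ a : Fin k, ∏ b ∈ Finset.Ioi a, crossFactor q S a b (u a) (u b)

/-- The parameters for which the cross weights have no pole. -/
def Regular (q : ℂ) (u : Fin k → ℂ) : Prop := ∀ a b, a < b → u a - q * u b ≠ 0

lemma Regular.eventually {u : Fin k → ℂ} (h : Regular q u) : ∀ᶠ w in 𝓝 u, Regular q w := by
  refine eventually_all.2 fun a => eventually_all.2 fun b => ?_
  by_cases hab : a < b
  · have hc : Continuous fun w : Fin k → ℂ => w a - q * w b := by fun_prop
    filter_upwards [hc.continuousAt.eventually_ne (h a b hab)] with w hw _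
    exact hw
  · exact Eventually.of_forall fun w h => absurd h hab

lemma Regular.continuousAt_pairWeight {u : Fin k → ℂ} (h : Regular q u) :
    ContinuousAt (pairWeight q) u := by
  unfold pairWeight
  refine tendsto_finsetProd _ fun a _ => tendsto_finsetProd _ fun b hb => ?_
  exact ContinuousAt.div (by fun_prop) (by fun_prop) (h a b (Finset.mem_Ioi.1 hb))

lemma Regular.continuousAt_crossWeight {u : Fin k → ℂ} (h : Regular q u) (S : Finset (Fin k)) :
    ContinuousAt (crossWeight q S) u := by
  unfold crossWeight
  refine tendsto_finsetProd _ fun a _ => tendsto_finsetProd _ fun b hb => ?_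
  unfold crossFactor
  have h0 := h a b (Finset.mem_Ioi.1 hb)
  split_ifs
  · exact ContinuousAt.div (by fun_prop) (by fun_prop) h0
  · exact ContinuousAt.div (by fun_prop) (by fun_prop) h0
  · exact tendsto_const_nhds

/-- The factors are grouped by pairs a < b. If a ∉ S and b ∈ S, the factor of the pair weight is
cancelled completely. This loss of the pole at u_a = q u_b drives all the vanishing arguments. -/
lemma pairWeight_mul_cross {u : Fin k → ℂ} (h : Regular q u) (hu : Function.Injective u)
    (S : Finset (Fin k)) :
    pairWeight q u * ∏ i ∈ S, ∏ j ∈ Finset.univ \ S, (q * u i - u j) / (u i - u j) =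
      crossWeight q S u := by
  let G : Fin k → Fin k → ℂ := fun i j => if i ∈ S ∧ j ∉ S then (q * u i - u j) / (u i - u j) else 1
  have h1 : ∏ i ∈ S, ∏ j ∈ Finset.univ \ S, (q * u i - u j) / (u i - u j) =
      ∏ i, ∏ j ∈ Finset.Ioi i, G i j * G j i := by
    refine Eq.trans ?_ (Finset.prod_prod_Ioi_mul_eq_prod_prod_off_diag (fun j i => G i j)).symm
    refine (Finset.prod_congr rfl fun i hi => ?_).trans
      (Finset.prod_subset (Finset.subset_univ S) fun i _ hi =>
        Finset.prod_eq_one fun j _ => if_neg fun h => hi h.1)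
    refine (Finset.prod_congr rfl fun j hj => ?_).trans
      (Finset.prod_subset (s₁ := Finset.univ \ S) ?_ fun j _ hj => if_neg ?_)
    · exact (if_pos ⟨hi, (Finset.mem_sdiff.1 hj).2⟩).symm
    · intro j hj
      have := (Finset.mem_sdiff.1 hj).2
      simp only [Finset.mem_compl, Finset.mem_singleton]
      rintro rfl
      exact this hi
    · rintro ⟨_, h⟩
      exact hj (by simp [h])
  rw [h1, pairWeight, crossWeight, ← Finset.prod_mul_distrib]
  refine Finset.prod_congr rfl fun a _ => ?_
  rw [← Finset.prod_mul_distrib]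
  refine Finset.prod_congr rfl fun b hb => ?_
  have hab := Finset.mem_Ioi.1 hb
  have h0 := h a b hab
  have h2 : u a - u b ≠ 0 := sub_ne_zero.2 (hu.ne hab.ne)
  have h3 : u b - u a ≠ 0 := sub_ne_zero.2 (hu.ne hab.ne')
  simp only [G, crossFactor]
  by_cases ha : a ∈ S <;> by_cases hb : b ∈ S <;> simp [ha, hb]
  · field_simp
  · rw [div_mul_div_comm, div_eq_one_iff_eq (mul_ne_zero h0 h3)]
    ring

lemma ratOn_crossFactor_left {T Z : Set ℂ} {S : Finset (Fin k)} {a b : Fin k} {y : ℂ}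
    (hz : ¬ (a ∉ S ∧ b ∈ S) → q * y ∈ Z) :
    RatOn T Z 0 (fun z => crossFactor q S a b z y) := by
  unfold crossFactor
  split_ifs with h1 h2
  · refine (((ratOn_linear 1 (-y)).mul (ratOn_inv (hz (by tauto)))).mono (by norm_num)).congr
      fun w _ => ?_
    rw [div_eq_mul_inv]; ring
  · refine (((ratOn_linear q (-y)).mul (ratOn_inv (hz (by tauto)))).mono (by norm_num)).congr
      fun w _ => ?_
    rw [div_eq_mul_inv]; ring
  · exact ratOn_const 1

lemma ratOn_crossFactor_right {T Z : Set ℂ} {S : Finset (Fin k)} {a b : Fin k} {x : ℂ}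
    (hq : q ≠ 0) (hz : ¬ (a ∉ S ∧ b ∈ S) → x / q ∈ Z) :
    RatOn T Z 0 (fun z => crossFactor q S a b x z) := by
  have hinv : ¬ (a ∉ S ∧ b ∈ S) → RatOn T Z (-1) (fun z => (-q * z + x)⁻¹) := fun h =>
    ratOn_inv_linear (neg_ne_zero.2 hq) (by simpa using hz h)
  unfold crossFactor
  split_ifs with h1 h2
  · refine (((ratOn_linear (-1) x).mul (hinv (by tauto))).mono (by norm_num)).congr
      fun w _ => ?_
    rw [div_eq_mul_inv]; ring
  · refine (((ratOn_linear (-1) (q * x)).mul (hinv (by tauto))).mono (by norm_num)).congr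
      fun w _ => ?_
    rw [div_eq_mul_inv]; ring
  · exact ratOn_const 1

/-- As a function of u_i, the possible poles are q u_b for b > i, which nesting puts inside γ_i, and
u_a / q for a < i, which it puts outside. Pairs whose first index alone is outside S contribute
none. -/
lemma ratOn_crossWeight {T Z : Set ℂ} {S : Finset (Fin k)} (hq : q ≠ 0) {i : Fin k}
    {w : Fin k → ℂ} (hr : ∀ b, i < b → ¬ (i ∉ S ∧ b ∈ S) → q * w b ∈ Z)
    (hl : ∀ a, a < i → ¬ (a ∉ S ∧ i ∈ S) → w a / q ∈ Z) :
    RatOn T Z 0 (fun z => crossWeight q S (Function.update w i z)) := by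
  unfold crossWeight
  refine RatOn.prod _ fun a _ => RatOn.prod _ fun b hb => ?_
  have hab := Finset.mem_Ioi.1 hb
  by_cases ha : a = i
  · subst ha
    simp only [Function.update_self, Function.update_of_ne hab.ne']
    exact ratOn_crossFactor_left (hr b hab)
  · by_cases hbi : b = i
    · subst hbi
      simp only [Function.update_self, Function.update_of_ne ha]
      exact ratOn_crossFactor_right hq (hl a hab)
    · simp only [Function.update_of_ne ha, Function.update_of_ne hbi]
      exact ratOn_const _

lemma RatOn.prod_update {T Z : Set ℂ} {d : ℤ} {h : Fin k → ℂ → ℂ} {i : Fin k}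
    (hi : RatOn T Z d (h i)) (w : Fin k → ℂ) :
    RatOn T Z d (fun z => ∏ j, h j (Function.update w i z j)) := by
  have e : ∀ z, ∏ j, h j (Function.update w i z j) =
      h i z * ∏ j ∈ Finset.univ.erase i, h j (w j) := fun z => by
    rw [← Finset.mul_prod_erase _ _ (Finset.mem_univ i), Function.update_self]
    congr 1
    refine Finset.prod_congr rfl fun j hj => ?_
    rw [Function.update_of_ne (Finset.ne_of_mem_erase hj)]
  simp only [e]
  simpa using hi.mul (ratOn_const (∏ j ∈ Finset.univ.erase i, h j (w j)))

end Cross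

end HigherSpin

end

section

namespace HigherSpin

open Filter Topology

/-! ### Orthogonality of the off-shell vectors -/

/-- Nested contours around `s`. -/
structure QNested (q s : ℂ) {k : ℕ} (γ : Fin k → ℝ → ℂ) : Prop where
  contour : ∀ a, IsPositiveContour (γ a)
  encircles : ∀ a, Inside (γ a) s
  leaves_outside : ∀ a, Outside (γ a) s⁻¹
  nested : ∀ a b, a < b → ∀ u ∈ trace (γ b), Inside (γ a) (q * u)

section Orthogonality

variable {k : ℕ} {q s : ℂ} {γ : Fin k → ℝ → ℂ}

lemma QNested.comp (h : QNested q s γ) {m : ℕ} {e : Fin m → Fin k} (he : StrictMono e) :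
    QNested q s (fun i => γ (e i)) :=
  ⟨fun _ => h.contour _, fun _ => h.encircles _, fun _ => h.leaves_outside _,
    fun _ _ hab => h.nested _ _ (he hab)⟩

lemma QNested.regular (h : QNested q s γ) {u : Fin k → ℂ} (hu : u ∈ torus γ) : Regular q u :=
  fun a b hab h0 => (h.nested a b hab _ (torus_apply hu b)).1
    (sub_eq_zero.1 h0 ▸ torus_apply hu a)

lemma QNested.sub_ne_zero (h : QNested q s γ) {i : Fin k} {z : ℂ} (hz : z ∈ trace (γ i)) :
    z - s ≠ 0 :=
  _root_.sub_ne_zero.2 fun h0 => (h.encircles i).1 (h0 ▸ hz)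

lemma QNested.one_sub_ne_zero (h : QNested q s γ) {i : Fin k} {z : ℂ}
    (hz : z ∈ trace (γ i)) : 1 - s * z ≠ 0 := fun h0 => by
  refine (h.leaves_outside i).1 ?_
  rwa [inv_eq_of_mul_eq_one_right (sub_eq_zero.1 h0).symm]

lemma QNested.div_outside (h : QNested q s γ) (hq : q ≠ 0) {a b : Fin k} (hab : a < b) {z : ℂ}
    (hz : z ∈ trace (γ a)) : Outside (γ b) (z / q) :=
  outside_of_nested (h.contour a) (h.contour b) hq (h.nested a b hab) hz

lemma ratOn_inv_one_sub {T Z : Set ℂ} (hs : s ≠ 0) (hZ : s⁻¹ ∈ Z) :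
    RatOn T Z (-1) (fun z => (1 - s * z)⁻¹) := by
  refine (ratOn_inv_linear (a := -s) (b := 1) (neg_ne_zero.2 hs) ?_).congr fun w _ => ?_
  · simpa using hZ
  · ring

lemma ratOn_one_sub {T Z : Set ℂ} : RatOn T Z 1 (fun z => 1 - s * z) :=
  (ratOn_linear (-s) 1).congr fun w _ => by ring

lemma prod_Ioi_eq_prod_ite {M : Type*} [CommMonoid M] (a : Fin k) (f : Fin k → M) :
    ∏ b ∈ Finset.Ioi a, f b = ∏ b, if a < b then f b else 1 := by
  rw [← Finset.filter_lt_eq_Ioi, Finset.prod_filter]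

lemma pairWeight_snoc (w : Fin k → ℂ) (z : ℂ) :
    pairWeight q (Fin.snoc (α := fun _ => ℂ) w z) =
      pairWeight q w * ∏ a, (w a - z) / (w a - q * z) := by
  simp only [pairWeight, prod_Ioi_eq_prod_ite, Fin.prod_univ_castSucc, Fin.snoc_castSucc,
    Fin.snoc_last, Fin.castSucc_lt_castSucc_iff, Fin.castSucc_lt_last, if_true, lt_irrefl, if_false,
    mul_one, Finset.prod_mul_distrib]
  congr 1
  refine (congrArg _ (Finset.prod_eq_one ?_)).trans (mul_one _)
  intro b _
  rw [if_neg]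
  exact (Fin.castSucc_lt_last b).not_gt

/-- In the last variable the only pole inside is t. Its residue yields 1/(1 - s t) and replaces t by
q t in the other variables; q t is again inside their contours. Hence the induction runs over
general t, although only t = s is needed later. -/
lemma integral_pairWeight (h : QNested q s γ) (hq : q ≠ 0) (hs : s ≠ 0) {t : ℂ}
    (ht : ∀ i, Inside (γ i) t) :
    iteratedIntegral k γ (fun u => pairWeight q u * ∏ i, ((u i - t) * (1 - s * u i))⁻¹) =
      (∏ j ∈ Finset.range k, (1 - s * t * q ^ j))⁻¹ := by
  induction k generalizing t with
  | zero => simp [iteratedIntegral, pairWeight]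
  | succ k ih =>
    have h' : QNested q s (fun i => γ (Fin.castSucc i)) := h.comp (Fin.strictMono_castSucc)
    have hqt : ∀ i : Fin k, Inside (γ i.castSucc) (q * t) := fun i =>
      inside_of_nested (h.contour _) (h.contour (Fin.last k)) hq
        (h.nested _ _ (Fin.castSucc_lt_last i)) (ht _)
    rw [iteratedIntegral_snoc, Finset.prod_range_succ', mul_inv, mul_comm]
    have e : ∀ j, 1 - s * t * q ^ (j + 1) = 1 - s * (q * t) * q ^ j := fun j => by ring
    simp only [e, pow_zero, mul_one]
    rw [← ih h' hqt, ← iteratedIntegral_const_mul]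
    refine iteratedIntegral_congr fun w hw => ?_
    have hfac : ∀ z, pairWeight q (Fin.snoc (α := fun _ => ℂ) w z) *
        ∏ i, ((Fin.snoc (α := fun _ => ℂ) w z i - t) *
          (1 - s * Fin.snoc (α := fun _ => ℂ) w z i))⁻¹ =
        pairWeight q w * (∏ i, ((w i - t) * (1 - s * w i))⁻¹) *
          (((∏ a, (w a - z) / (w a - q * z)) * (1 - s * z)⁻¹) / (z - t)) := fun z => by
      rw [pairWeight_snoc, Fin.prod_univ_castSucc]
      simp only [Fin.snoc_castSucc, Fin.snoc_last, mul_inv, div_eq_mul_inv]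
      ring
    simp only [hfac]
    have hR : RatOn (insert t (trace (γ (Fin.last k)))) {z | Outside (γ (Fin.last k)) z} (0 + -1)
        (fun z => (∏ a, (w a - z) / (w a - q * z)) * (1 - s * z)⁻¹) := by
      refine (RatOn.prod _ fun a _ => ?_).mul (ratOn_inv_one_sub hs (h.leaves_outside _))
      have h1 := ratOn_inv_linear (T := insert t (trace (γ (Fin.last k))))
        (Z := {z | Outside (γ (Fin.last k)) z}) (a := -q) (b := w a) (neg_ne_zero.2 hq) (by
          simpa using h.div_outside hq (Fin.castSucc_lt_last a) (torus_apply hw a))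
      refine (((ratOn_linear (-1) (w a)).mul h1).mono (by norm_num)).congr fun z _ => ?_
      rw [div_eq_mul_inv]; ring
    rw [contourIntegral_const_mul, (h.contour _).contourIntegral_cauchy (ht _) hR]
    have hprod : (∏ i, ((w i - t) * (1 - s * w i))⁻¹) * ∏ a, (w a - t) / (w a - q * t) =
        ∏ i, ((w i - q * t) * (1 - s * w i))⁻¹ := by
      rw [← Finset.prod_mul_distrib]
      refine Finset.prod_congr rfl fun i _ => ?_
      have h1 : w i - t ≠ 0 := _root_.sub_ne_zero.2 fun h0 =>
        (ht i.castSucc).1 (h0 ▸ torus_apply hw i)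
      rw [mul_inv, mul_inv, div_eq_mul_inv]
      field_simp
    rw [← hprod]
    ring

/-- The weight attached to a final position `x` in the columns `a, ..., a + L - 1`. -/
def siteWeight (s : ℂ) (a L x : ℕ) (z : ℂ) : ℂ :=
  ((z - s) ^ (x - a + 1) * (1 - s * z) ^ (a + L - x))⁻¹

lemma QNested.continuousOn_siteWeight (h : QNested q s γ) (a L : ℕ) (x : Fin k → ℕ) :
    ContinuousOn (fun u : Fin k → ℂ => ∏ i, siteWeight s a L (x i) (u i)) (torus γ) := by
  unfold siteWeight
  refine continuousOn_finsetProd _ fun i _ => ContinuousOn.inv₀ (by fun_prop) fun u hu => ?_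
  exact mul_ne_zero (pow_ne_zero _ (h.sub_ne_zero (torus_apply hu i)))
    (pow_ne_zero _ (h.one_sub_ne_zero (torus_apply hu i)))

lemma QNested.continuousOn_pairWeight (h : QNested q s γ) :
    ContinuousOn (pairWeight q) (torus γ) := fun _ hu =>
  (h.regular hu).continuousAt_pairWeight.continuousWithinAt

lemma QNested.continuousOn_crossWeight (h : QNested q s γ) (S : Finset (Fin k)) :
    ContinuousOn (crossWeight q S) (torus γ) := fun _ hu =>
  ((h.regular hu).continuousAt_crossWeight S).continuousWithinAt

/-- The factor of a parameter in the first column. -/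
def firstFactor (s : ℂ) (L : ℕ) (S : Finset (Fin k)) (i : Fin k) (z : ℂ) : ℂ :=
  if i ∈ S then (1 - s * z) ^ L else z - s

lemma continuous_firstFactor (s : ℂ) (L : ℕ) (S : Finset (Fin k)) (i : Fin k) :
    Continuous (firstFactor s L S i) := by
  unfold firstFactor
  split_ifs <;> fun_prop

/-- `bvec_first_column` requires distinct parameters. Multiplied by the pair weight, its
singularities at u_i = u_j are removable, and continuity extends it to all regular parameters. -/
lemma pairWeight_mul_bvec {u : Fin k → ℂ} (hu : Regular q u) (hq2 : q ^ 2 ≠ 1)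
    (hq' : ∀ n, 0 < n → q ^ n ≠ 1) (a L : ℕ) (ν : ℕ → ℕ) :
    pairWeight q u * bvec q s hq2 a (L + 1) (fun i => (u i, 1)) Finset.univ ν =
      ∑ S ∈ Finset.univ.powersetCard (ν a), qPoch q q (ν a) * (crossWeight q S u *
        bvec q s hq2 (a + 1) L (fun i => (u i, 1)) (Finset.univ \ S) (Function.update ν a 0) *
          ∏ i, firstFactor s L S i (u i)) := by
  refine eq_of_eventually_injective
    (f := fun u => pairWeight q u * bvec q s hq2 a (L + 1) (fun i => (u i, 1)) Finset.univ ν)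
    (g := fun u => ∑ S ∈ Finset.univ.powersetCard (ν a), qPoch q q (ν a) * (crossWeight q S u *
        bvec q s hq2 (a + 1) L (fun i => (u i, 1)) (Finset.univ \ S) (Function.update ν a 0) *
          ∏ i, firstFactor s L S i (u i))) ?_ ?_ ?_
  · exact hu.continuousAt_pairWeight.mul (continuous_bvec hq2 _ _ _ _).continuousAt
  · refine tendsto_finsetSum _ fun S _ => tendsto_const_nhds.mul ?_
    refine Tendsto.mul ((hu.continuousAt_crossWeight S).mul
      (continuous_bvec hq2 _ _ _ _).continuousAt) ?_
    exact (continuous_finsetProd _ fun i _ =>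
      (continuous_firstFactor s L S i).comp (continuous_apply i)).continuousAt
  · filter_upwards [hu.eventually] with w hw hinj
    rw [bvec_first_column hinj hq', Finset.mul_sum]
    refine Finset.sum_congr rfl fun S _ => ?_
    rw [← pairWeight_mul_cross hw hinj S]
    have : ∏ i, firstFactor s L S i (w i) =
        (∏ i ∈ S, (1 - s * w i) ^ L) * ∏ i ∈ Finset.univ \ S, (w i - s) := by
      rw [← Finset.prod_sdiff (Finset.subset_univ S), mul_comm]
      congr 1
      · exact Finset.prod_congr rfl fun i hi => if_pos hi
      · exact Finset.prod_congr rfl fun i hi => if_neg (Finset.mem_sdiff.1 hi).2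
    rw [this]
    ring

/-- The contribution of the set `S` of paths that stop in the first column. -/
def columnTerm (q s : ℂ) (hq2 : q ^ 2 ≠ 1) (a L : ℕ) (μ : Fin k → ℕ) (ν : ℕ → ℕ)
    (S : Finset (Fin k)) (u : Fin k → ℂ) : ℂ :=
  crossWeight q S u * bvec q s hq2 (a + 1) L (fun i => (u i, 1)) (Finset.univ \ S) ν *
    ∏ i, (firstFactor s L S i (u i) * siteWeight s a (L + 1) (μ i) (u i))

lemma QNested.continuousOn_columnTerm (h : QNested q s γ) (hq2 : q ^ 2 ≠ 1) (a L : ℕ)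
    (μ : Fin k → ℕ) (ν : ℕ → ℕ) (S : Finset (Fin k)) :
    ContinuousOn (columnTerm q s hq2 a L μ ν S) (torus γ) := by
  unfold columnTerm
  refine ((h.continuousOn_crossWeight S).mul (continuous_bvec hq2 _ _ _ _).continuousOn).mul ?_
  simp only [Finset.prod_mul_distrib]
  refine ContinuousOn.mul ?_ (h.continuousOn_siteWeight _ _ _)
  exact (continuous_finsetProd _ fun i _ =>
      (continuous_firstFactor s L S i).comp (continuous_apply i)).continuousOn

/-- A path that stops in the first column although it should not. -/
lemma columnTerm_integral_of_mem (h : QNested q s γ) (hq : q ≠ 0) (hq2 : q ^ 2 ≠ 1) {a L : ℕ}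
    {μ : Fin k → ℕ} (hμ : Antitone μ) (hμL : ∀ i, μ i < a + (L + 1)) (ν : ℕ → ℕ)
    {S : Finset (Fin k)} {i₀ : Fin k} (hi₀ : i₀ ∈ S) (hμi : a < μ i₀) :
    iteratedIntegral k γ (columnTerm q s hq2 a L μ ν S) = 0 := by
  -- For the smallest index i of S, every a < i is outside S and contributes no pole. The remaining
  -- poles q u_b and s are inside γ_i, and monotonicity of μ still gives a < μ i.
  obtain ⟨i, hiS, hmin⟩ : ∃ i ∈ S, ∀ j ∈ S, i ≤ j :=
    ⟨S.min' ⟨i₀, hi₀⟩, S.min'_mem _, fun j hj => S.min'_le j hj⟩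
  have hai : a < μ i := hμi.trans_le (hμ (hmin _ hi₀))
  refine iteratedIntegral_eq_zero h.contour (h.continuousOn_columnTerm hq2 a L μ ν S) i
    fun w hw => (h.contour i).contourIntegral_of_inside ?_
  unfold columnTerm
  have h1 : RatOn (trace (γ i)) {z | Inside (γ i) z} 0
      (fun z => crossWeight q S (Function.update w i z)) := by
    refine ratOn_crossWeight hq (fun b hb _ => h.nested i b hb _ (torus_apply hw b)) ?_
    intro b hb hn
    exact absurd ⟨fun hbS => (hmin b hbS).not_gt hb, hiS⟩ hn
  have h2 : ∀ z, bvec q s hq2 (a + 1) L (fun j => (Function.update w i z j, 1))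
      (Finset.univ \ S) ν = bvec q s hq2 (a + 1) L (fun j => (w j, 1)) (Finset.univ \ S) ν := by
    intro z
    refine congrFun (bvec_congr fun j hj => ?_) ν
    have : j ≠ i := by
      rintro rfl
      exact (Finset.mem_sdiff.1 hj).2 hiS
    rw [Function.update_of_ne this]
  -- The factor is (1 - s z)^(μ_i - a - 1) / (z - s)^(μ_i - a + 1), of degree -2, so there is no
  -- contribution from infinity.
  have h3 : RatOn (trace (γ i)) {z | Inside (γ i) z} (-2)
      (fun z => firstFactor s L S i z * siteWeight s a (L + 1) (μ i) z) := by
    have hs1 := (ratOn_inv (T := trace (γ i)) (Z := {z | Inside (γ i) z}) (h.encircles i)).pow (μ i - a + 1)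
    have hs2 := (ratOn_one_sub (s := s) (T := trace (γ i)) (Z := {z | Inside (γ i) z})).pow
      (μ i - a - 1)
    refine ((hs2.mul hs1).mono ?_).congr fun z hz => ?_
    · omega
    · have hz1 := h.one_sub_ne_zero hz
      rw [firstFactor, if_pos hiS, siteWeight, mul_inv, mul_left_comm, mul_comm, inv_pow]
      congr 1
      rw [← div_eq_mul_inv, div_eq_iff (pow_ne_zero _ hz1), ← pow_add]
      congr 1
      have := hμL i
      omega
  simp only [h2]
  exact ((h1.mul (ratOn_const _)).mul (RatOn.prod_update
    (h := fun j z => firstFactor s L S j z * siteWeight s a (L + 1) (μ j) z) h3 w)).mono (by norm_num)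

/-- A path that does not stop in the first column although it should. -/
lemma columnTerm_integral_of_notMem (h : QNested q s γ) (hq : q ≠ 0) (hs : s ≠ 0)
    (hq2 : q ^ 2 ≠ 1) {a L : ℕ}
    {μ : Fin k → ℕ} (hμ : Antitone μ) (hμa : ∀ i, a ≤ μ i) (ν : ℕ → ℕ)
    {S : Finset (Fin k)} {i₀ : Fin k} (hi₀ : i₀ ∉ S) (hμi : μ i₀ = a) :
    iteratedIntegral k γ (columnTerm q s hq2 a L μ ν S) = 0 := by
  classical
  -- For the largest index i outside S, every b > i is in S, so no pole q u_b remains. Also μ i = a,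
  -- so the simple pole at s is cancelled by the factor z - s, and all other poles are outside γ_i.
  obtain ⟨i, hiS, hmax⟩ : ∃ i ∈ Finset.univ \ S, ∀ j ∈ Finset.univ \ S, j ≤ i :=
    have hne : (Finset.univ \ S).Nonempty := ⟨i₀, by simpa using hi₀⟩
    ⟨(Finset.univ \ S).max' hne, Finset.max'_mem _ _, fun j hj => Finset.le_max' _ j hj⟩
  replace hiS := (Finset.mem_sdiff.1 hiS).2
  have hai : μ i = a := le_antisymm ((hμ (hmax i₀ (by simpa using hi₀))).trans_eq hμi) (hμa i)
  obtain ⟨P, hP⟩ : ∃ P : (Fin k → ℂ) → Polynomial ℂ, ∀ w z,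
      bvec q s hq2 (a + 1) L (fun j => (Function.update w i z j, 1)) (Finset.univ \ S) ν =
        (P w).eval z :=
    Classical.skolem.1 fun w => exists_polynomial_bvec hq2 (a + 1) L (Finset.univ \ S) ν w i
  refine iteratedIntegral_eq_zero h.contour (h.continuousOn_columnTerm hq2 a L μ ν S) i
    fun w hw => ?_
  unfold columnTerm
  have h1 : RatOn (trace (γ i)) {z | Outside (γ i) z} 0
      (fun z => crossWeight q S (Function.update w i z)) := by
    refine ratOn_crossWeight hq (fun b hb hn => ?_)
      fun b hb _ => h.div_outside hq hb (torus_apply hw b)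
    by_contra
    refine hn ⟨hiS, ?_⟩
    by_contra hbS
    exact (hmax b (by simpa using hbS)).not_gt hb
  have h3 : RatOn (trace (γ i)) {z | Outside (γ i) z} ((L + 1 : ℕ) * (-1))
      (fun z => firstFactor s L S i z * siteWeight s a (L + 1) (μ i) z) := by
    have hs1 := (ratOn_inv_one_sub (T := trace (γ i)) (Z := {z | Outside (γ i) z}) hs
      (h.leaves_outside i)).pow (L + 1)
    refine hs1.congr fun z hz => ?_
    have hz1 := h.sub_ne_zero hz
    rw [firstFactor, if_neg hiS, siteWeight, hai, Nat.sub_self, zero_add, pow_one,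
      Nat.add_sub_cancel_left, mul_inv, mul_inv_cancel_left₀ hz1, inv_pow]
  simp only [hP]
  exact (h.contour i).contourIntegral_of_outside ((h1.mul (ratOn_polynomial (P w))).mul
    (RatOn.prod_update
      (h := fun j z => firstFactor s L S j z * siteWeight s a (L + 1) (μ j) z) h3 w))

end Orthogonality

end HigherSpin

end

section

namespace HigherSpin

/-! ### Spatial orthogonality by induction on the columns -/

section Orthogonality

variable {q s : ℂ}

/-- If S is the final block of indices, each mixed pair has its first index outside S and its second
inside, hence contributes 1; the integral factorizes. -/
lemma crossWeight_append {k m : ℕ} {S : Finset (Fin (k + m))} (h1 : ∀ i, Fin.castAdd m i ∉ S)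
    (h2 : ∀ j, Fin.natAdd k j ∈ S) (u : Fin (k + m) → ℂ) :
    crossWeight q S u = pairWeight q (fun i => u (Fin.castAdd m i)) *
      pairWeight q (fun j => u (Fin.natAdd k j)) := by
  have e1 : ∀ (i : Fin k) (j : Fin m), Fin.castAdd m i < Fin.natAdd k j := fun i j => by
    rw [Fin.lt_def, Fin.val_castAdd, Fin.val_natAdd]; omega
  have e2 : ∀ (i : Fin k) (j : Fin m), ¬ Fin.natAdd k j < Fin.castAdd m i := fun i j =>
    (e1 i j).not_gt
  have e3 : ∀ i j : Fin k, Fin.castAdd m i < Fin.castAdd m j ↔ i < j := fun i j => Iff.rfl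
  have e4 : ∀ i j : Fin m, Fin.natAdd k i < Fin.natAdd k j ↔ i < j := fun i j => by
    rw [Fin.lt_def, Fin.lt_def, Fin.val_natAdd, Fin.val_natAdd]; omega
  simp only [crossWeight, pairWeight, prod_Ioi_eq_prod_ite, Fin.prod_univ_add, crossFactor, e1, e2,
    e3, e4, h1, h2, if_true, if_false, iff_true, iff_false, not_true, not_false_iff,
    Finset.prod_const_one, mul_one, one_mul]

variable {k m : ℕ}

/-- The paths that stop in the first column and have to do so. -/
lemma columnTerm_integral_diagonal {γ : Fin (k + m) → ℝ → ℂ} (h : QNested q s γ) (hq : q ≠ 0)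
    (hs : s ≠ 0) (hq2 : q ^ 2 ≠ 1) {a L : ℕ} {μ : Fin (k + m) → ℕ}
    (h1 : ∀ i, a < μ (Fin.castAdd m i)) (h2 : ∀ j, μ (Fin.natAdd k j) = a) (ν : ℕ → ℕ) :
    iteratedIntegral (k + m) γ
      (columnTerm q s hq2 a L μ ν (Finset.univ.filter fun i => μ i = a)) =
    iteratedIntegral k (fun i => γ (Fin.castAdd m i)) (fun u => pairWeight q u *
      bvec q s hq2 (a + 1) L (fun i => (u i, 1)) Finset.univ ν *
        ∏ i, siteWeight s (a + 1) L (μ (Fin.castAdd m i)) (u i)) * (qPoch q (s ^ 2) m)⁻¹ := by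
  have hS1 : ∀ i, Fin.castAdd m i ∉ Finset.univ.filter fun i => μ i = a := fun i => by
    simpa using (h1 i).ne'
  have hS2 : ∀ j, Fin.natAdd k j ∈ Finset.univ.filter fun i => μ i = a := fun j => by
    simpa using h2 j
  have hU : Finset.univ \ (Finset.univ.filter fun i => μ i = a) =
      Finset.univ.map (Fin.castAddEmb m) := by
    ext i
    refine Fin.addCases (fun i => ?_) (fun j => ?_) i
    · simp [(h1 i).ne']
    · have e1 : ∀ i : Fin k, Fin.castAdd m i ≠ Fin.natAdd k j := fun i hij => by
        have := congrArg Fin.val hij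
        rw [Fin.val_castAdd, Fin.val_natAdd] at this
        omega
      simp [h2, e1]
  have hm := integral_pairWeight
    (h.comp (e := Fin.natAdd k) (Fin.strictMono_natAdd k)) hq hs (t := s)
    (fun i => h.encircles _)
  rw [show qPoch q (s ^ 2) m = ∏ j ∈ Finset.range m, (1 - s * s * q ^ j) by
    simp only [qPoch, sq], ← hm, ← iteratedIntegral_append]
  refine iteratedIntegral_congr fun u hu => ?_
  rw [columnTerm, crossWeight_append hS1 hS2, hU, bvec_map, Fin.prod_univ_add]
  have e1 : ∀ i, firstFactor s L (Finset.univ.filter fun i => μ i = a) (Fin.castAdd m i)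
      (u (Fin.castAdd m i)) * siteWeight s a (L + 1) (μ (Fin.castAdd m i)) (u (Fin.castAdd m i)) =
      siteWeight s (a + 1) L (μ (Fin.castAdd m i)) (u (Fin.castAdd m i)) := by
    intro i
    have hz := h.sub_ne_zero (torus_apply hu (Fin.castAdd m i))
    have := h1 i
    rw [firstFactor, if_neg (hS1 i), siteWeight, siteWeight,
      show μ (Fin.castAdd m i) - a + 1 = μ (Fin.castAdd m i) - (a + 1) + 1 + 1 by omega,
      show a + (L + 1) = a + 1 + L by omega, pow_succ', mul_assoc, mul_inv, mul_inv_cancel_left₀ hz]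
  have e2 : ∀ j, firstFactor s L (Finset.univ.filter fun i => μ i = a) (Fin.natAdd k j)
      (u (Fin.natAdd k j)) * siteWeight s a (L + 1) (μ (Fin.natAdd k j)) (u (Fin.natAdd k j)) =
      ((u (Fin.natAdd k j) - s) * (1 - s * u (Fin.natAdd k j)))⁻¹ := by
    intro j
    have hz := h.one_sub_ne_zero (torus_apply hu (Fin.natAdd k j))
    rw [firstFactor, if_pos (hS2 j), siteWeight, h2, Nat.sub_self, Nat.add_sub_cancel_left, zero_add,
      pow_one, pow_succ', mul_inv, mul_inv, mul_inv, ← mul_assoc, ← mul_assoc]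
    have := pow_ne_zero L hz
    field_simp
  simp only [e1, e2, Fin.coe_castAddEmb]
  ring

/-- The parts equal to the minimal allowed value a form a final block, which permits splitting Fin k
as a sum of two ranges. -/
lemma exists_split_of_antitone {k : ℕ} {μ : Fin k → ℕ} (hμ : Antitone μ) {a : ℕ}
    (ha : ∀ i, a ≤ μ i) : ∃ n ≤ k, ∀ i : Fin k, (i : ℕ) < n ↔ a < μ i := by
  classical
  have hex : ∃ n, ∀ i : Fin k, n ≤ (i : ℕ) → μ i = a := ⟨k, fun i hi => absurd i.2 hi.not_gt⟩
  refine ⟨Nat.find hex, Nat.find_min' hex fun i hi => absurd i.2 hi.not_gt, fun i => ?_⟩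
  constructor
  · intro hi
    have := Nat.find_min hex hi
    push Not at this
    obtain ⟨j, hij, hj⟩ := this
    exact ((ha j).lt_of_ne hj.symm).trans_le (hμ hij)
  · intro hi
    by_contra hle
    exact hi.ne' (Nat.find_spec hex i (not_lt.1 hle))

/-- The number of parts equal to `x`. -/
def countOf {k : ℕ} (μ : Fin k → ℕ) (x : ℕ) : ℕ := (Finset.univ.filter fun i => μ i = x).card

lemma countOf_append {μ : Fin (k + m) → ℕ} {a : ℕ} (h2 : ∀ j, μ (Fin.natAdd k j) = a) (x : ℕ) :
    countOf μ x = countOf (fun i => μ (Fin.castAdd m i)) x + if x = a then m else 0 := by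
  simp only [countOf, Finset.card_filter, Fin.sum_univ_add, h2]
  congr 1
  by_cases h : x = a
  · simp [h]
  · simp [h, Ne.symm h]

lemma countOf_eq_zero {μ : Fin k → ℕ} {x : ℕ} (h : ∀ i, μ i ≠ x) : countOf μ x = 0 := by
  rw [countOf, Finset.card_eq_zero, Finset.filter_eq_empty_iff]
  exact fun i _ => h i

open Classical in
/-- Spatial orthogonality. -/
theorem integral_bvec (hq : q ≠ 0) (hs : s ≠ 0) (hq2 : q ^ 2 ≠ 1) (hq' : ∀ n, 0 < n → q ^ n ≠ 1)
    (L : ℕ) : ∀ {k : ℕ} {γ : Fin k → ℝ → ℂ}, QNested q s γ → ∀ (a : ℕ) {μ : Fin k → ℕ},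
      Antitone μ → (∀ i, a ≤ μ i) → (∀ i, μ i < a + L) → ∀ ν : ℕ → ℕ,
    iteratedIntegral k γ (fun u => pairWeight q u *
      bvec q s hq2 a L (fun i => (u i, 1)) Finset.univ ν * ∏ i, siteWeight s a L (μ i) (u i)) =
    if ν = countOf μ then
      ∏ x ∈ Finset.range L, qPoch q q (ν (a + x)) / qPoch q (s ^ 2) (ν (a + x)) else 0 := by
  induction L with
  | zero =>
    intro k γ _ a μ _ ha hL ν
    cases k with
    | succ k => exact absurd (hL 0) (ha 0).not_gt
    | zero =>
      have : countOf μ = 0 := funext fun x => countOf_eq_zero fun i => i.elim0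
      simp [iteratedIntegral, pairWeight, this, vacuum]
  | succ L ih =>
    intro k γ h a μ hμ ha hL ν
    obtain ⟨n, hn, hsplit⟩ := exists_split_of_antitone hμ ha
    obtain ⟨m, rfl⟩ := Nat.exists_eq_add_of_le hn
    have h1 : ∀ i, a < μ (Fin.castAdd m i) := fun i => (hsplit _).1 i.2
    have h2 : ∀ j, μ (Fin.natAdd n j) = a := fun j =>
      le_antisymm (not_lt.1 fun hlt => by
        have := (hsplit _).2 hlt
        rw [Fin.val_natAdd] at this
        omega) (ha _)
    have hcount := countOf_append (k := n) h2
    have hcount_a : countOf (fun i => μ (Fin.castAdd m i)) a = 0 :=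
      countOf_eq_zero fun i => (h1 i).ne'
    have e : ∀ u ∈ torus γ, pairWeight q u *
        bvec q s hq2 a (L + 1) (fun i => (u i, 1)) Finset.univ ν *
          ∏ i, siteWeight s a (L + 1) (μ i) (u i) =
        ∑ S ∈ Finset.univ.powersetCard (ν a), qPoch q q (ν a) *
          columnTerm q s hq2 a L μ (Function.update ν a 0) S u := by
      intro u hu
      rw [pairWeight_mul_bvec (h.regular hu) hq2 hq', Finset.sum_mul]
      refine Finset.sum_congr rfl fun S _ => ?_
      rw [columnTerm, Finset.prod_mul_distrib]
      ring
    rw [iteratedIntegral_congr e, iteratedIntegral_sum h.contour _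
      (f := fun S u => qPoch q q (ν a) * columnTerm q s hq2 a L μ (Function.update ν a 0) S u)
      fun S _ => continuousOn_const.mul (h.continuousOn_columnTerm hq2 a L μ _ S)]
    simp only [iteratedIntegral_const_mul]
    set T : Finset (Fin (n + m)) := Finset.univ.filter fun i => μ i = a with hT
    -- A set other than T contains an index with μ i > a or misses one with μ i = a.
    have hzero : ∀ S : Finset (Fin (n + m)), S ≠ T →
        iteratedIntegral (n + m) γ (columnTerm q s hq2 a L μ (Function.update ν a 0) S) = 0 := by
      intro S hS
      by_cases hc1 : ∃ i ∈ S, a < μ i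
      · obtain ⟨i, hi, hai⟩ := hc1
        exact columnTerm_integral_of_mem h hq hq2 hμ hL _ hi hai
      by_cases hc2 : ∃ i ∉ S, μ i = a
      · obtain ⟨i, hi, hai⟩ := hc2
        exact columnTerm_integral_of_notMem h hq hs hq2 hμ ha _ hi hai
      push Not at hc1 hc2
      refine absurd ?_ hS
      ext i
      simp only [hT, Finset.mem_filter, Finset.mem_univ, true_and]
      refine ⟨fun hi => le_antisymm (hc1 i hi) (ha i), fun hi => ?_⟩
      by_contra hiS
      exact hc2 i hiS hi
    have hTcard : T.card = m := by
      have := hcount a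
      rw [hcount_a, if_pos rfl, zero_add] at this
      exact this
    have hdiag := columnTerm_integral_diagonal h hq hs hq2 (L := L) h1 h2 (Function.update ν a 0)
    rw [ih (h.comp (e := Fin.castAdd m) (Fin.strictMono_castAdd m)) (a + 1)
      (fun i j hij => hμ ((Fin.strictMono_castAdd m).monotone hij)) (fun i => h1 i)
      (fun i => by have := hL (Fin.castAdd m i); omega)] at hdiag
    -- The surviving set T has m elements, so it occurs among the sets of size ν a only if ν a = m.
    by_cases hνm : ν a = m
    · rw [Finset.sum_eq_single T (fun S _ hS => by rw [hzero S hS, mul_zero]) (fun hT' => by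
        refine absurd (Finset.mem_powersetCard.2 ⟨Finset.subset_univ _, ?_⟩) hT'
        rw [hTcard, hνm]), hdiag]
      have hiff : Function.update ν a 0 = countOf (fun i => μ (Fin.castAdd m i)) ↔
          ν = countOf μ := by
        constructor
        · intro heq
          ext x
          rw [hcount x, ← heq]
          by_cases hx : x = a
          · subst hx; simp [hνm]
          · simp [hx]
        · intro heq
          ext x
          by_cases hx : x = a
          · subst hx; simp [hcount_a]
          · rw [Function.update_of_ne hx, heq, hcount x, if_neg hx, add_zero]
      simp only [hiff]
      split_ifs
      · rw [Finset.prod_range_succ', add_zero, hνm]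
        have : ∀ x ∈ Finset.range L, qPoch q q (Function.update ν a 0 (a + 1 + x)) /
            qPoch q (s ^ 2) (Function.update ν a 0 (a + 1 + x)) =
            qPoch q q (ν (a + (x + 1))) / qPoch q (s ^ 2) (ν (a + (x + 1))) := fun x _ => by
          rw [Function.update_of_ne (by omega), show a + 1 + x = a + (x + 1) by omega]
        rw [Finset.prod_congr rfl this, div_eq_mul_inv (qPoch q q m)]
        ring
      · simp
    · rw [if_neg, Finset.sum_eq_zero]
      · intro S hS
        rw [hzero S, mul_zero]
        rintro rfl
        exact hνm ((Finset.mem_powersetCard.1 hS).2.symm.trans hTcard)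
      · intro heq
        have := hcount a
        rw [← heq, hcount_a, if_pos rfl, zero_add] at this
        exact hνm this

end Orthogonality

end HigherSpin

end

section

namespace HigherSpin

open Filter Topology

/-! ### Adding one row of G under the integral -/

section Pieri

variable {k : ℕ} {q s : ℂ} {γ : Fin k → ℝ → ℂ}

/-- The term of the action of the diagonal operator in which the parameter `u_j` is replaced. -/
def exchangeTerm (q s : ℂ) (hq2 : q ^ 2 ≠ 1) (L : ℕ) (v : ℂ) (ν : ℕ → ℕ) (j : Fin k)
    (u : Fin k → ℂ) : ℂ :=
  (1 - q) * (1 - v * u j)⁻¹ * (u j - s) ^ L * crossWeight q (Finset.univ.erase j) u *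
    monodromy q s 0 L (1, v) 1 0 (bvec q s hq2 0 L (fun i => (u i, 1)) (Finset.univ.erase j)) ν

/-- The spectral factor of one row. -/
def rowFactor (q v : ℂ) (z : ℂ) : ℂ := (1 - q * z * v) / (1 - z * v)

lemma continuousAt_rowFactor {q v z : ℂ} (h : 1 - z * v ≠ 0) : ContinuousAt (rowFactor q v) z := by
  unfold rowFactor
  exact ContinuousAt.div (by fun_prop) (by fun_prop) h

/-- The Bethe ansatz action of D at 1/v, solved for the eigenvalue term. It is proved for distinct
parameters and extended by continuity, the pair weight having absorbed the singularities. -/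
lemma pairWeight_mul_diagonal {u : Fin k → ℂ} (hu : Regular q u) (hq2 : q ^ 2 ≠ 1) {v : ℂ}
    (hv : ∀ i, 1 - u i * v ≠ 0) (L : ℕ) (ν : ℕ → ℕ) :
    pairWeight q u * ((∏ i, rowFactor q v (u i)) * (1 - s * v) ^ L *
      bvec q s hq2 0 L (fun i => (u i, 1)) Finset.univ ν) =
    pairWeight q u * monodromy q s 0 L (1, v) 1 1
      (bvec q s hq2 0 L (fun i => (u i, 1)) Finset.univ) ν +
        ∑ j, exchangeTerm q s hq2 L v ν j u := by
  refine eq_of_eventually_injective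
    (f := fun u => pairWeight q u * ((∏ i, rowFactor q v (u i)) * (1 - s * v) ^ L *
      bvec q s hq2 0 L (fun i => (u i, 1)) Finset.univ ν))
    (g := fun u => pairWeight q u * monodromy q s 0 L (1, v) 1 1
      (bvec q s hq2 0 L (fun i => (u i, 1)) Finset.univ) ν +
        ∑ j, exchangeTerm q s hq2 L v ν j u) ?_ ?_ ?_
  · refine hu.continuousAt_pairWeight.mul (ContinuousAt.mul (ContinuousAt.mul ?_ continuousAt_const)
      (continuous_bvec hq2 _ _ _ _).continuousAt)
    exact tendsto_finsetProd _ fun i _ =>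
      (continuousAt_rowFactor (hv i)).comp (f := fun u : Fin k → ℂ => u i)
        (continuous_apply i).continuousAt
  · refine ContinuousAt.add (hu.continuousAt_pairWeight.mul
      (continuous_monodromy_bvec hq2 _ _ _ _ _ _ _).continuousAt)
      (tendsto_finsetSum _ fun j _ => ?_)
    unfold exchangeTerm
    refine Tendsto.mul (Tendsto.mul ?_ (hu.continuousAt_crossWeight _))
      (continuous_monodromy_bvec hq2 _ _ _ _ _ _ _).continuousAt
    refine ContinuousAt.mul (continuousAt_const.mul (ContinuousAt.inv₀
      (Continuous.continuousAt (by fun_prop)) ?_)) (Continuous.continuousAt (by fun_prop))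
    rw [mul_comm]
    exact hv j
  · have hev : ∀ᶠ w in 𝓝 u, ∀ i, 1 - w i * v ≠ 0 := eventually_all.2 fun i => by
      have : Continuous fun w : Fin k → ℂ => 1 - w i * v := by fun_prop
      exact this.continuousAt.eventually_ne (hv i)
    filter_upwards [hu.eventually, hev] with w hw hwv hinj
    -- The index `none` carries the extra parameter 1/v = (1, v) next to the u_i.
    obtain ⟨p, hpn, hps⟩ : ∃ p : Option (Fin k) → ℂ × ℂ, p none = (1, v) ∧
        ∀ i, p (some i) = (w i, 1) := ⟨fun o => o.elim (1, v) fun i => (w i, 1), rfl, fun _ => rfl⟩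
    have hp : ∀ i j, i ≠ j → (p j).1 * (p i).2 - (p i).1 * (p j).2 ≠ 0 := by
      intro i j hij
      rcases i with _ | i <;> rcases j with _ | j
      · exact absurd rfl hij
      · have := hwv j
        simp only [hpn, hps]
        rw [one_mul, ← neg_ne_zero, neg_sub]
        exact this
      · simpa [hpn, hps] using hwv i
      · have hij' : j ≠ i := fun h => hij (h ▸ rfl)
        simpa [hps, sub_eq_zero] using hinj.ne hij'
    have hD := monodromy_one_one_bvec (q := q) (s := s) (hq := hq2) (a := 0) (L := L) hp
      (k := none) (U := Finset.univ.map Function.Embedding.some) (by simp)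
    have hbv : ∀ U : Finset (Fin k), bvec q s hq2 0 L p (U.map Function.Embedding.some) =
        bvec q s hq2 0 L (fun i => (w i, 1)) U := fun U => by
      rw [bvec_map]
      exact congrArg (fun p => bvec q s hq2 0 L p U) (funext hps)
    have herase : ∀ j : Fin k, (Finset.univ.map Function.Embedding.some).erase (some j) =
        (Finset.univ.erase j).map Function.Embedding.some := fun j => by
      rw [Finset.map_erase]; rfl
    have hD' := congrFun hD ν
    simp only [Finset.sum_map, Finset.prod_map, Function.Embedding.some_apply, Pi.add_apply,
      Finset.sum_apply, Pi.smul_apply, smul_eq_mul, herase, hbv] at hD'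
    have hins : ∀ j : Fin k, bvec q s hq2 0 L p
        (insert none ((Finset.univ.erase j).map Function.Embedding.some)) =
        monodromy q s 0 L (1, v) 1 0
          (bvec q s hq2 0 L (fun i => (w i, 1)) (Finset.univ.erase j)) := fun j => by
      rw [bvec_insert (by simp), hbv, hpn]
    simp only [hins, hpn, hps, mul_one] at hD'
    rw [hD', mul_add, Finset.mul_sum, add_assoc, ← Finset.sum_add_distrib, Finset.sum_eq_zero,
      add_zero]
    · congr 2
      congr 1
      refine Finset.prod_congr rfl fun i _ => ?_
      rw [rowFactor, ← neg_div_neg_eq, neg_sub, neg_sub, mul_assoc]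
    · intro j _
      rw [exchangeTerm, ← pairWeight_mul_cross hw hinj]
      have h1 : ∏ i ∈ Finset.univ.erase j, ∏ j' ∈ Finset.univ \ Finset.univ.erase j,
          (q * w i - w j') / (w i - w j') =
          ∏ i ∈ Finset.univ.erase j, (q * w i - w j) / (w i - w j) := by
        refine Finset.prod_congr rfl fun i _ => ?_
        rw [show Finset.univ \ Finset.univ.erase j = {j} by ext; simp, Finset.prod_singleton]
      have h2 : (1 - v * w j)⁻¹ = -(w j * v - 1)⁻¹ := by
        rw [← inv_neg, neg_sub, mul_comm]
      rw [h1, h2]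
      ring

lemma ratOn_rowFactor {T : Set ℂ} {i : Fin k} {v : ℂ} (hv : v = 0 ∨ Outside (γ i) v⁻¹) :
    RatOn T {z | Outside (γ i) z} 0 (rowFactor q v) := by
  rcases hv with rfl | hv
  · exact (ratOn_const 1).congr fun w _ => by simp [rowFactor]
  · by_cases h0 : v = 0
    · subst h0
      exact (ratOn_const 1).congr fun w _ => by simp [rowFactor]
    · refine (((ratOn_linear (-(q * v)) 1).mul
        (ratOn_inv_one_sub (Z := {z | Outside (γ i) z}) h0 hv)).mono (by norm_num)).congr
        fun w _ => ?_
      rw [rowFactor, div_eq_mul_inv, mul_comm w v]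
      ring

lemma one_sub_mul_ne_zero {γ : ℝ → ℂ} {v z : ℂ} (hv : v = 0 ∨ Outside γ v⁻¹) (hz : z ∈ trace γ) :
    1 - z * v ≠ 0 := fun h0 => by
  rcases hv with rfl | hv
  · simp at h0
  · refine hv.1 ?_
    rwa [inv_eq_of_mul_eq_one_left (sub_eq_zero.1 h0).symm]

variable {N : ℕ}

lemma continuousOn_rowFactors {v : Fin N → ℂ} (hv : ∀ i j, v j = 0 ∨ Outside (γ i) (v j)⁻¹) :
    ContinuousOn (fun u : Fin k → ℂ => ∏ i, ∏ j, rowFactor q (v j) (u i)) (torus γ) :=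
  continuousOn_finsetProd _ fun i _ => continuousOn_finsetProd _ fun j _ => fun _ hu =>
    ((continuousAt_rowFactor (one_sub_mul_ne_zero (hv i j) (torus_apply hu i))).comp
      (f := fun u : Fin k → ℂ => u i) (continuous_apply i).continuousAt).continuousWithinAt

lemma QNested.continuousOn_exchangeTerm (h : QNested q s γ) (hq2 : q ^ 2 ≠ 1) (L : ℕ) {v : ℂ}
    (hv : ∀ i, v = 0 ∨ Outside (γ i) v⁻¹) (ν : ℕ → ℕ) (j : Fin k) :
    ContinuousOn (exchangeTerm q s hq2 L v ν j) (torus γ) := by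
  unfold exchangeTerm
  refine ContinuousOn.mul (ContinuousOn.mul ?_ (h.continuousOn_crossWeight _))
    (continuous_monodromy_bvec hq2 _ _ _ _ _ _ _).continuousOn
  refine ContinuousOn.mul (continuousOn_const.mul (ContinuousOn.inv₀ (by fun_prop) ?_))
    (by fun_prop)
  intro u hu
  rw [mul_comm]
  exact one_sub_mul_ne_zero (hv j) (torus_apply hu j)

/-- The exchanged vector no longer depends on u_j. With S the complement of j, the cross weight
loses the poles q u_b and keeps only u_a / q, which is outside γ_j. The points s⁻¹ and v_l⁻¹ are
outside as well. -/
lemma integral_exchangeTerm (h : QNested q s γ) (hq : q ≠ 0) (hs : s ≠ 0) (hq2 : q ^ 2 ≠ 1)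
    {L : ℕ} {v₀ : ℂ} (hv₀ : ∀ i, v₀ = 0 ∨ Outside (γ i) v₀⁻¹) {v : Fin N → ℂ}
    (hv : ∀ i j, v j = 0 ∨ Outside (γ i) (v j)⁻¹) (ν : ℕ → ℕ) {μ : Fin k → ℕ}
    (hμ : ∀ i, μ i < L) (j : Fin k) :
    iteratedIntegral k γ (fun u => exchangeTerm q s hq2 L v₀ ν j u *
      (∏ i, siteWeight s 0 L (μ i) (u i)) * ∏ i, ∏ l, rowFactor q (v l) (u i)) = 0 := by
  refine iteratedIntegral_eq_zero h.contour (((h.continuousOn_exchangeTerm hq2 L hv₀ ν j).mul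
    (h.continuousOn_siteWeight _ _ _)).mul (continuousOn_rowFactors hv)) j fun w hw => ?_
  have h1 : RatOn (trace (γ j)) {z | Outside (γ j) z} 0
      (fun z => crossWeight q (Finset.univ.erase j) (Function.update w j z)) :=
    ratOn_crossWeight hq (fun b hb hn => absurd ⟨by simp, by simpa using hb.ne'⟩ hn)
      fun b hb _ => h.div_outside hq hb (torus_apply hw b)
  have h2 : ∀ z, bvec q s hq2 0 L (fun i => (Function.update w j z i, 1)) (Finset.univ.erase j) =
      bvec q s hq2 0 L (fun i => (w i, 1)) (Finset.univ.erase j) := fun z =>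
    bvec_congr fun i hi => by rw [Function.update_of_ne (Finset.ne_of_mem_erase hi)]
  -- Since μ_j < L, the power (z - s)^L cancels the whole pole (z - s)^(μ_j + 1).
  have h3 : RatOn (trace (γ j)) {z | Outside (γ j) z} ((L - μ j - 1 : ℕ) * 1 + (L - μ j : ℕ) * (-1))
      (fun z => (z - s) ^ L * siteWeight s 0 L (μ j) z) := by
    have hs1 := (ratOn_inv_one_sub (T := trace (γ j)) (Z := {z | Outside (γ j) z}) hs
      (h.leaves_outside j)).pow (L - μ j)
    have hs2 := (ratOn_linear (T := trace (γ j)) (Z := {z | Outside (γ j) z}) 1 (-s)).pow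
      (L - μ j - 1)
    refine (hs2.mul hs1).congr fun z hz => ?_
    have hz1 := h.sub_ne_zero hz
    have hL : (z - s) ^ L = (z - s) ^ (L - μ j - 1) * (z - s) ^ (μ j - 0 + 1) := by
      rw [← pow_add]
      congr 1
      have := hμ j
      omega
    rw [siteWeight, hL, mul_inv, inv_pow, zero_add]
    have := pow_ne_zero (μ j - 0 + 1) hz1
    field_simp
    ring
  have h4 : RatOn (trace (γ j)) {z | Outside (γ j) z} 0 (fun z => ∏ l, rowFactor q (v l) z) :=
    RatOn.prod _ fun l _ => ratOn_rowFactor (hv j l)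
  have h5 : ∃ d, RatOn (trace (γ j)) {z | Outside (γ j) z} d (fun z => (1 - v₀ * z)⁻¹) := by
    by_cases h0 : v₀ = 0
    · exact ⟨0, (ratOn_const 1).congr fun w _ => by simp [h0]⟩
    · exact ⟨-1, ratOn_inv_one_sub h0 ((hv₀ j).resolve_left h0)⟩
  obtain ⟨d, h5⟩ := h5
  have hfin := ((((ratOn_const (T := trace (γ j)) (Z := {z | Outside (γ j) z}) ((1 - q) *
    monodromy q s 0 L (1, v₀) 1 0 (bvec q s hq2 0 L (fun i => (w i, 1)) (Finset.univ.erase j)) ν *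
      ∏ i ∈ Finset.univ.erase j, siteWeight s 0 L (μ i) (w i))).mul h5).mul h1).mul h3).mul
      (RatOn.prod_update (i := j) (h := fun _ z => ∏ l, rowFactor q (v l) z) h4 w)
  refine (h.contour j).contourIntegral_of_outside (hfin.congr fun z _ => ?_)
  have e : ∏ i, siteWeight s 0 L (μ i) (Function.update w j z i) =
      siteWeight s 0 L (μ j) z * ∏ i ∈ Finset.univ.erase j, siteWeight s 0 L (μ i) (w i) := by
    rw [← Finset.mul_prod_erase _ _ (Finset.mem_univ j), Function.update_self]
    congr 1
    refine Finset.prod_congr rfl fun i hi => ?_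
    rw [Function.update_of_ne (Finset.ne_of_mem_erase hi)]
  rw [exchangeTerm, h2, e, Function.update_self]
  ring

end Pieri

/-! ### The integral representation of the skew functions -/

section Main

variable {k : ℕ} {q s : ℂ} {γ : Fin k → ℝ → ℂ}

/-- The integral representation of the skew functions, in terms of the off-shell vectors on a
sufficiently large number `L` of columns. -/
theorem skewG_eq_integral_bvec (h : QNested q s γ) (hq : q ≠ 0) (hs : s ≠ 0) (hq2 : q ^ 2 ≠ 1)
    (hq' : ∀ n, 0 < n → q ^ n ≠ 1) (hsq : ∀ n, s ^ 2 * q ^ n ≠ 1) {L : ℕ} {μ : Signature k}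
    (hμ : ∀ i, μ.1 i < L) {N : ℕ} {v : Fin N → ℂ} (hsv : ∀ j, 1 - s * v j ≠ 0)
    (hv : ∀ i j, v j = 0 ∨ Outside (γ i) (v j)⁻¹) {κ : Signature k} (hκ : ∀ i, κ.1 i < L) :
    skewG q s N μ κ v = cFactor q s κ * iteratedIntegral k γ (fun u => pairWeight q u *
      bvec q s hq2 0 L (fun i => (u i, 1)) Finset.univ (mult κ) *
        (∏ i, siteWeight s 0 L (μ.1 i) (u i)) * ∏ i, ∏ j, rowFactor q (v j) (u i)) := by
  induction N generalizing κ with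
  | zero =>
    simp only [skewG, Finset.univ_eq_empty, Finset.prod_empty, Finset.prod_const_one, mul_one]
    rw [integral_bvec hq hs hq2 hq' L h 0 μ.2 (fun i => Nat.zero_le _) (fun i => by simpa using hμ i)]
    have hc : mult κ = countOf μ.1 ↔ μ = κ := by
      change mult κ = mult μ ↔ _
      exact ⟨fun h => (mult_injective h).symm, fun h => by rw [h]⟩
    simp only [hc]
    split_ifs
    · rw [cFactor_eq_prod q s hκ, ← Finset.prod_mul_distrib, Finset.prod_eq_one]
      intro x _
      have h1 : qPoch q q (mult κ x) ≠ 0 := Finset.prod_ne_zero_iff.2 fun i _ h0 =>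
        hq' (i + 1) (by omega) (by rw [pow_succ']; exact (sub_eq_zero.1 h0).symm)
      have h2 : qPoch q (s ^ 2) (mult κ x) ≠ 0 := Finset.prod_ne_zero_iff.2 fun i _ h0 =>
        hsq i (sub_eq_zero.1 h0).symm
      rw [zero_add, cColumn]
      field_simp
    · rw [mul_zero]
  | succ N ih =>
    have hvt : ∀ i j, Fin.tail v j = 0 ∨ Outside (γ i) (Fin.tail v j)⁻¹ := fun i j => hv i j.succ
    have hsL : (1 - s * v 0) ^ L ≠ 0 := pow_ne_zero _ (hsv 0)
    rw [skewG_succ_bottom hsv hμ]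
    -- The integrand for N + 1 rows is the branching sum of integrands for N rows plus the exchange
    -- terms. The sum type collects both kinds so that the integral is distributed once.
    have e : ∀ u ∈ torus γ, cFactor q s κ * (pairWeight q u *
        bvec q s hq2 0 L (fun i => (u i, 1)) Finset.univ (mult κ) *
          (∏ i, siteWeight s 0 L (μ.1 i) (u i)) * ∏ i, ∏ j, rowFactor q (v j) (u i)) =
        (∑ o : signaturesLT k L ⊕ Fin k, Sum.elim
          (fun ρ u => rowWeight q s (v 0) 0 κ ρ.1 * (cFactor q s ρ.1 * (pairWeight q u *
            bvec q s hq2 0 L (fun i => (u i, 1)) Finset.univ (mult ρ.1) *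
            (∏ i, siteWeight s 0 L (μ.1 i) (u i)) * ∏ i, ∏ j, rowFactor q (Fin.tail v j) (u i))))
          (fun j u => cFactor q s κ * ((1 - s * v 0) ^ L)⁻¹ *
            (exchangeTerm q s hq2 L (v 0) (mult κ) j u * (∏ i, siteWeight s 0 L (μ.1 i) (u i)) *
              ∏ i, ∏ j, rowFactor q (Fin.tail v j) (u i))) o u) := by
      intro u hu
      have hu1 : ∀ i, 1 - s * u i ≠ 0 := fun i => h.one_sub_ne_zero (torus_apply hu i)
      have hP := pairWeight_mul_diagonal (s := s) (h.regular hu) hq2 (v := v 0)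
        (fun i => one_sub_mul_ne_zero (hv i 0) (torus_apply hu i)) L (mult κ)
      have hD := monodromy_one_one_bvec_mult (hq := hq2) (hsv 0) hq' hu1 hκ
      have hDρ : ∑ ρ ∈ signaturesLT k L, rowWeight q s (v 0) 0 κ ρ *
          (cFactor q s ρ * ((∏ i, (1 - s * u i) ^ L) * funF q s k ρ u)) =
          ∑ ρ : signaturesLT k L, rowWeight q s (v 0) 0 κ ρ.1 * (cFactor q s ρ.1 *
            bvec q s hq2 0 L (fun i => (u i, 1)) Finset.univ (mult ρ.1)) := by
        rw [← Finset.sum_coe_sort]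
        refine Finset.sum_congr rfl fun ρ _ => ?_
        rw [bvec_mult hu1 (mem_signaturesLT.1 ρ.2)]
      rw [hDρ] at hD
      simp only [Fintype.sum_sum_type, Sum.elim_inl, Sum.elim_inr, Fin.prod_univ_succ,
        Finset.prod_mul_distrib]
      set R := ∏ i, ∏ j : Fin N, rowFactor q (v j.succ) (u i)
      have hR : ∏ i, ∏ j : Fin N, rowFactor q (Fin.tail v j) (u i) = R := rfl
      set W := ∏ i, siteWeight s 0 L (μ.1 i) (u i)
      rw [hR]
      have e1 : ∑ ρ : signaturesLT k L, rowWeight q s (v 0) 0 κ ρ.1 * (cFactor q s ρ.1 *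
          (pairWeight q u * bvec q s hq2 0 L (fun i => (u i, 1)) Finset.univ (mult ρ.1) * W * R)) =
          (∑ ρ : signaturesLT k L, rowWeight q s (v 0) 0 κ ρ.1 * (cFactor q s ρ.1 *
            bvec q s hq2 0 L (fun i => (u i, 1)) Finset.univ (mult ρ.1))) *
            (pairWeight q u * W * R) := by
        rw [Finset.sum_mul]
        exact Finset.sum_congr rfl fun ρ _ => by ring
      rw [e1, ← Finset.mul_sum, ← Finset.sum_mul, ← Finset.sum_mul]
      refine mul_left_cancel₀ hsL ?_
      rw [mul_add, ← mul_assoc, ← mul_assoc ((1 - s * v 0) ^ L), ← hD,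
        mul_comm (cFactor q s κ) ((1 - s * v 0) ^ L)⁻¹, mul_assoc (((1 - s * v 0) ^ L)⁻¹),
        mul_inv_cancel_left₀ hsL]
      linear_combination (cFactor q s κ * W * R) * hP
    have hcont : ∀ ρ : Signature k, ContinuousOn (fun u => pairWeight q u *
        bvec q s hq2 0 L (fun i => (u i, 1)) Finset.univ (mult ρ) *
        (∏ i, siteWeight s 0 L (μ.1 i) (u i)) * ∏ i, ∏ j, rowFactor q (Fin.tail v j) (u i))
        (torus γ) := fun ρ =>
      ((h.continuousOn_pairWeight.mul (continuous_bvec hq2 _ _ _ _).continuousOn).mul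
        (h.continuousOn_siteWeight _ _ _)).mul (continuousOn_rowFactors hvt)
    rw [← iteratedIntegral_const_mul, iteratedIntegral_congr e, iteratedIntegral_sum h.contour]
    · simp only [Fintype.sum_sum_type, Sum.elim_inl, Sum.elim_inr, iteratedIntegral_const_mul]
      rw [Finset.sum_eq_zero (s := (Finset.univ : Finset (Fin k))), add_zero, ← Finset.sum_coe_sort]
      · refine Finset.sum_congr rfl fun ρ _ => ?_
        rw [ih (v := Fin.tail v) (fun j => hsv j.succ) hvt (mem_signaturesLT.1 ρ.2)]
      · intro j _
        rw [integral_exchangeTerm h hq hs hq2 (fun i => hv i 0) hvt (mult κ) hμ, mul_zero]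
    · rintro (ρ | j) _
      · exact continuousOn_const.mul (continuousOn_const.mul (hcont ρ.1))
      · exact continuousOn_const.mul (((h.continuousOn_exchangeTerm hq2 L (fun i => hv i 0) _ j).mul
          (h.continuousOn_siteWeight _ _ _)).mul (continuousOn_rowFactors hvt))

/-- The integral representation of the skew functions. -/
theorem skewG_eq_integral (h : QNested q s γ) (hq : q ≠ 0) (hs : s ≠ 0) (hq2 : q ^ 2 ≠ 1)
    (hq' : ∀ n, 0 < n → q ^ n ≠ 1) (hsq : ∀ n, s ^ 2 * q ^ n ≠ 1) {N : ℕ} {v : Fin N → ℂ}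
    (hsv : ∀ j, 1 - s * v j ≠ 0) (hv : ∀ i j, v j = 0 ∨ Outside (γ i) (v j)⁻¹)
    (μ κ : Signature k) :
    skewG q s N μ κ v = iteratedIntegral k γ (fun u =>
      (∏ a : Fin k, ∏ b ∈ Finset.Ioi a, (u a - u b) / (u a - q * u b)) * funFc q s κ u *
      (∏ i : Fin k, 1 / (u i - s) * ((1 - s * u i) / (u i - s)) ^ (μ.1 i)) *
      ∏ i : Fin k, ∏ j : Fin N, (1 - q * u i * v j) / (1 - u i * v j)) := by
  -- Any number exceeding all parts of μ and κ would do as the number of columns.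
  set L := ∑ i, (μ.1 i + κ.1 i) + 1 with hL
  have hle : ∀ i, μ.1 i + κ.1 i < L := fun i =>
    Nat.lt_succ_of_le (Finset.single_le_sum (f := fun i => μ.1 i + κ.1 i)
      (fun _ _ => Nat.zero_le _) (Finset.mem_univ i))
  have hμ : ∀ i, μ.1 i < L := fun i => (Nat.le_add_right _ _).trans_lt (hle i)
  have hκ : ∀ i, κ.1 i < L := fun i => (Nat.le_add_left _ _).trans_lt (hle i)
  rw [skewG_eq_integral_bvec h hq hs hq2 hq' hsq hμ hsv hv hκ, ← iteratedIntegral_const_mul]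
  refine iteratedIntegral_congr fun u hu => ?_
  rw [bvec_mult (fun i => h.one_sub_ne_zero (torus_apply hu i)) hκ, funFc]
  -- The power (1 - s u)^L from clearing denominators combines with `siteWeight` into an expression
  -- free of L.
  have e : ∏ i : Fin k, 1 / (u i - s) * ((1 - s * u i) / (u i - s)) ^ (μ.1 i) =
      (∏ i, (1 - s * u i) ^ L) * ∏ i, siteWeight s 0 L (μ.1 i) (u i) := by
    rw [← Finset.prod_mul_distrib]
    refine Finset.prod_congr rfl fun i _ => ?_
    have h1 := h.one_sub_ne_zero (torus_apply hu i)
    have h2 : (1 - s * u i) ^ L = (1 - s * u i) ^ μ.1 i * (1 - s * u i) ^ (0 + L - μ.1 i) := by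
      rw [← pow_add]
      congr 1
      have := hμ i
      omega
    have h3 := pow_ne_zero (0 + L - μ.1 i) h1
    rw [siteWeight, h2, Nat.sub_zero, mul_inv, pow_succ, mul_inv, div_pow]
    generalize (1 - s * u i) ^ (0 + L - μ.1 i) = c at h3 ⊢
    field_simp
  rw [e]
  simp only [pairWeight, rowFactor]
  ring

end Main

end HigherSpin

end

section

namespace HigherSpin

/-! ### The zero signature and the conclusion -/

lemma IsNestedFamily.qNested {q s : ℂ} {k : ℕ} {γ : Fin k → ℝ → ℂ} (h : IsNestedFamily q s γ) :
    QNested q s γ :=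
  ⟨h.contour, h.encircles, h.leaves_outside, h.nested⟩

lemma cFactor_zeroSignature (q s : ℂ) (k : ℕ) :
    cFactor q s (zeroSignature k) = qPoch q (s ^ 2) k / qPoch q q k := by
  rw [cFactor_eq_prod q s (L := 1) (by simp [zeroSignature])]
  simp [cColumn, mult, zeroSignature]

lemma funFc_zeroSignature {q s : ℂ} (hq' : ∀ n, 0 < n → q ^ n ≠ 1) {k : ℕ} {u : Fin k → ℂ}
    (hu : ∀ i, 1 - s * u i ≠ 0) :
    funFc q s (zeroSignature k) u = qPoch q (s ^ 2) k * ∏ i, (1 - s * u i)⁻¹ := by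
  have h1 : qPoch q q k ≠ 0 := Finset.prod_ne_zero_iff.2 fun i _ h0 =>
    hq' (i + 1) (by omega) (by rw [pow_succ']; exact (sub_eq_zero.1 h0).symm)
  rw [funFc, cFactor_zeroSignature, funF_zeroSignature (hq' 2 (by norm_num)) hu,
    Finset.prod_inv_distrib]
  field_simp

end HigherSpin

end

end

theorem proposition7p13 (q s : ℝ) (hq0 : 0 < q) (hq1 : q < 1) (hs1 : -1 < s) (hs0 : s < 0)
    (k N : ℕ) (hk : 1 ≤ k) (hN : 1 ≤ N)
    (γ : Fin k → ℝ → ℂ) (hγ : HigherSpin.IsNestedFamily (q : ℂ) (s : ℂ) γ)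
    (v : Fin N → ℂ)
    -- the points `1 / v_j` are outside all contours (`1 / 0` is the point at infinity)
    (hv : ∀ i j, v j = 0 ∨ HigherSpin.Outside (γ i) (v j)⁻¹) :
    (∀ μ κ : HigherSpin.Signature k,
      HigherSpin.skewG (q : ℂ) (s : ℂ) N μ κ v =
        HigherSpin.iteratedIntegral k γ (fun u =>
          (∏ a : Fin k, ∏ b ∈ Finset.Ioi a, (u a - u b) / (u a - (q : ℂ) * u b)) *
          HigherSpin.funFc (q : ℂ) (s : ℂ) κ u *
          (∏ i : Fin k, 1 / (u i - (s : ℂ)) *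
            ((1 - (s : ℂ) * u i) / (u i - (s : ℂ))) ^ (μ.1 i)) *
          ∏ i : Fin k, ∏ j : Fin N, (1 - (q : ℂ) * u i * v j) / (1 - u i * v j))) ∧
    (∀ μ : HigherSpin.Signature k,
      HigherSpin.funG (q : ℂ) (s : ℂ) N μ v =
        HigherSpin.qPoch (q : ℂ) ((s : ℂ) ^ 2) k *
        HigherSpin.iteratedIntegral k γ (fun u =>
          (∏ a : Fin k, ∏ b ∈ Finset.Ioi a, (u a - u b) / (u a - (q : ℂ) * u b)) *
          (∏ i : Fin k, 1 / ((u i - (s : ℂ)) * (1 - (s : ℂ) * u i)) *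
            ((1 - (s : ℂ) * u i) / (u i - (s : ℂ))) ^ (μ.1 i)) *
          ∏ i : Fin k, ∏ j : Fin N, (1 - (q : ℂ) * u i * v j) / (1 - u i * v j))) := by
  have hq : (q : ℂ) ≠ 0 := by exact_mod_cast hq0.ne'
  have hs : (s : ℂ) ≠ 0 := by exact_mod_cast hs0.ne
  have hq' : ∀ n, 0 < n → (q : ℂ) ^ n ≠ 1 := fun n hn => by
    exact_mod_cast (pow_lt_one₀ hq0.le hq1 hn.ne').ne
  have hsq : ∀ n, (s : ℂ) ^ 2 * (q : ℂ) ^ n ≠ 1 := fun n => by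
    have h1 : q ^ n ≤ 1 := pow_le_one₀ hq0.le hq1.le
    have h2 : s ^ 2 < 1 := by nlinarith
    have h3 : s ^ 2 * q ^ n < 1 := (mul_le_of_le_one_right (sq_nonneg s) h1).trans_lt h2
    exact_mod_cast h3.ne
  have h := hγ.qNested
  -- If s v_j = 1, then 1/v_j = s would be inside the first contour, which exists because k ≥ 1.
  have hsv : ∀ j, 1 - (s : ℂ) * v j ≠ 0 := fun j h0 => by
    rcases hv ⟨0, hk⟩ j with hj | hj
    · simp [hj] at h0
    · refine (h.encircles ⟨0, hk⟩).not_outside ?_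
      rwa [inv_eq_of_mul_eq_one_left (sub_eq_zero.1 h0).symm] at hj
  have main := fun μ κ => HigherSpin.skewG_eq_integral h hq hs (hq' 2 (by norm_num)) hq' hsq hsv hv μ κ
  refine ⟨main, fun μ => ?_⟩
  rw [HigherSpin.funG, main, ← HigherSpin.iteratedIntegral_const_mul]
  refine HigherSpin.iteratedIntegral_congr fun u hu => ?_
  rw [HigherSpin.funFc_zeroSignature hq' fun i => h.one_sub_ne_zero (HigherSpin.torus_apply hu i)]
  have e : ∏ i : Fin k, 1 / ((u i - (s : ℂ)) * (1 - (s : ℂ) * u i)) *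
      ((1 - (s : ℂ) * u i) / (u i - (s : ℂ))) ^ (μ.1 i) =
      (∏ i, (1 - (s : ℂ) * u i)⁻¹) * ∏ i : Fin k, 1 / (u i - (s : ℂ)) *
        ((1 - (s : ℂ) * u i) / (u i - (s : ℂ))) ^ (μ.1 i) := by
    rw [← Finset.prod_mul_distrib]
    refine Finset.prod_congr rfl fun i _ => ?_
    rw [one_div, one_div, mul_inv]
    ring
  rw [e]
  ring
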